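/- **Proposition 3 (Dyadic expansion principle, or Stabilization).** For $n\ge 2$ let $\overline{\mathcal M}_{0,n+1}(\mathbb R)$ be the space of real stable curves of genus zero with marked points $x_0,\dots,x_n$, i.e. the iterated blow-up $p$ onto the real projective space $\mathbb P\{a\in\mathbb R^n:\sum a_i=0\}$ along (the proper transforms of) the subspaces $L_S=\{a_i=a_j \text{ for } i,j\in S\}$, $S\subsetneq\{1,\dots,n\}$, $|S|\ge 2$, in order of increasing dimension; let $\widetilde{\mathcal M}_{0,n+1}(\mathbb R)$ be its two-sheeted cover, obtained by the same blow-ups from the unit sphere of $\{a\in\mathbb R^n:\sum a_i=0\}$. For a permutation $\sigma$ let $K^\sigma$ be the closure of the inverse image of the open chamber $a_{\sigma(1)}<\dots<a_{\sigma(n)}$, and for $S$ as above let $D_S$ be the proper transform of the exceptional divisor over $L_S$ (the closure of the inverse image of the set of points with $a_i=a_j$ exactly when $i=j$ or $i,j\in S$). The closed strata are the non-empty intersections of one $K^\sigma$ with some of the $D_S$; a stratum is a closed stratum minus all closed strata strictly contained in it. These strata form a finite partition into locally closed open cells that satisfies the frontier condition. 1. For $n\ge 2$, the map $\overline{\exp}:\overline{\mathcal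 M}_{0,n+1}(\mathbb R)\to\overline{\mathcal M}_{0,2(n+1)}(\mathbb R)$ that grafts at every marked point $x_i$ a new component carrying two marked points (namely $y_{2i-1},y_{2i}$ for $i\ne0$, and $y_0,y_{2n+1}$ for $i=0$) is a topological embedding and a morphism of stratified spaces: it maps every stratum onto a stratum. The same holds, for $n\ge2$, for the map $\exp_n:\widetilde{\mathcal M}_{0,n+1}(\mathbb R)\to\widetilde{\mathcal M}_{0,2n+1}(\mathbb R)$ that expands in this way all marked points except $x_0$ (on the unit sphere it is $(a_1,\dots,a_n)\mapsto(a_1,a_1,\dots,a_n,a_n)/\sqrt2$). 2. The inductive limits (the "towers") $$\overline{\mathcal M}_{0,3\cdot2^\infty}(\mathbb R)=\varinjlim_{k\ge0}\overline{\mathcal M}_{0,3\cdot2^k}(\mathbb R),\qquad \widetilde{\mathcal M}_{0,2^\infty}(\mathbb R)=\varinjlim_{k\ge1}\widetilde{\mathcal M}_{0,2^k+1}(\mathbb R)$$ along these embeddings, with the inductive limit topology, are (Hausdorff) CW complexes whose open cells are exactly the images of the strata of the spaces of the system. They are nowhere locally finite: no point has a neighbourhood that meets only finitely many cells. 3. $\overline{\mathcal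 M}_{0,3}(\mathbb R)$ is a single point and $\widetilde{\mathcal M}_{0,3}(\mathbb R)$ consists of two points. The image of any of these points in the respective tower is a $0$-cell, so that it can serve as a base point of the tower. -/

import Mathlib

open Set Filter Topology CategoryTheory CategoryTheory.Limits

noncomputable section

namespace RealModuli

/-! ### Projective spaces and centred vectors -/

/-- The quotient topology on a projective space. -/
instance projectivizationTopology {E : Type*} [AddCommGroup E] [Module ℝ E] [TopologicalSpace E] :
    TopologicalSpace (Projectivization ℝ E) :=
  inferInstanceAs (TopologicalSpace (Quotient (projectivizationSetoid ℝ E)))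

lemma tendsto_mk {E α : Type*} [AddCommGroup E] [Module ℝ E] [TopologicalSpace E] {l : Filter α}
    {f : α → E} {v : E} (h : Tendsto f l (𝓝 v)) (hf : ∀ x, f x ≠ 0) (hv : v ≠ 0) :
    Tendsto (fun x => Projectivization.mk ℝ (f x) (hf x)) l (𝓝 (Projectivization.mk ℝ v hv)) := by
  have hc : Continuous (fun w : {w : E // w ≠ 0} => Projectivization.mk' ℝ w) :=
    continuous_quotient_mk'
  have h2 : Tendsto (fun x => (⟨f x, hf x⟩ : {w : E // w ≠ 0})) l (𝓝 ⟨v, hv⟩) :=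
    tendsto_subtype_rng.2 h
  exact (hc.tendsto ⟨v, hv⟩).comp h2

lemma continuous_map {E F : Type*} [AddCommGroup E] [Module ℝ E] [TopologicalSpace E]
    [AddCommGroup F] [Module ℝ F] [TopologicalSpace F] (f : E →ₗ[ℝ] F)
    (hf : Function.Injective f) (hc : Continuous f) : Continuous (Projectivization.map f hf) := by
  refine continuous_quot_lift _ ?_
  have h2 : Continuous (fun w : {w : E // w ≠ 0} =>
      (⟨f w, by simpa using (map_ne_zero_iff f hf).2 w.2⟩ : {w : F // w ≠ 0})) := by
    fun_prop
  exact (continuous_quotient_mk' (s := projectivizationSetoid ℝ F)).comp h2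

/-- The vectors `(v_i)_{i ∈ S}` with `∑ v_i = 0` (extended by zero outside `S`): a model of the
quotient of `ℝ^S` by the diagonal line. -/
def V {n : ℕ} (S : Finset (Fin n)) : Submodule ℝ (Fin n → ℝ) where
  carrier := {v | (∀ i, i ∉ S → v i = 0) ∧ ∑ i ∈ S, v i = 0}
  add_mem' := by
    rintro v w ⟨h1, h2⟩ ⟨h3, h4⟩
    exact ⟨fun i hi => by simp [h1 i hi, h3 i hi], by simp [Finset.sum_add_distrib, h2, h4]⟩
  zero_mem' := by simp
  smul_mem' := by
    rintro c v ⟨h1, h2⟩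
    exact ⟨fun i hi => by simp [h1 i hi], by simp [← Finset.mul_sum, h2]⟩

/-- Restriction of `v` to the index set `S`, recentred so that the sum over `S` is zero. -/
def ctr {n : ℕ} (S : Finset (Fin n)) : (Fin n → ℝ) →ₗ[ℝ] V S where
  toFun v := ⟨fun i => if i ∈ S then v i - (∑ j ∈ S, v j) / S.card else 0, by
    refine ⟨fun i hi => by simp [hi], ?_⟩
    rw [Finset.sum_congr rfl (fun i hi => if_pos hi)]
    rcases S.eq_empty_or_nonempty with rfl | hS
    · simp
    · have : (S.card : ℝ) ≠ 0 := by exact_mod_cast hS.card_ne_zero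
      simp only [Finset.sum_sub_distrib, Finset.sum_const, nsmul_eq_mul]
      field_simp
      ring⟩
  map_add' v w := by
    ext i
    by_cases hi : i ∈ S
    · simp [hi, Finset.sum_add_distrib]; ring
    · simp [hi]
  map_smul' c v := by
    ext i
    by_cases hi : i ∈ S
    · simp [hi, ← Finset.mul_sum]; ring
    · simp [hi]

lemma continuous_ctr {n : ℕ} (S : Finset (Fin n)) : Continuous (ctr S) :=
  LinearMap.continuous_of_finiteDimensional _

lemma ctr_eq_zero_iff {n : ℕ} (S : Finset (Fin n)) (v : Fin n → ℝ) :
    ctr S v = 0 ↔ ∀ i ∈ S, ∀ j ∈ S, v i = v j := by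
  constructor
  · intro h i hi j hj
    have h1 := congrFun (congrArg Subtype.val h) i
    have h2 := congrFun (congrArg Subtype.val h) j
    simp only [ctr, LinearMap.coe_mk, AddHom.coe_mk, hi, hj, if_true, ZeroMemClass.coe_zero,
      Pi.zero_apply] at h1 h2
    linarith
  · intro h
    ext i
    simp only [ctr, LinearMap.coe_mk, AddHom.coe_mk, ZeroMemClass.coe_zero, Pi.zero_apply]
    split_ifs with hi
    · have : (S.card : ℝ) ≠ 0 := by exact_mod_cast (Finset.card_pos.2 ⟨i, hi⟩).ne'
      rw [Finset.sum_congr rfl (fun j hj => h j hj i hi)]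
      simp [this]
    · rfl

lemma ctr_ne_zero {n : ℕ} {S : Finset (Fin n)} {v : Fin n → ℝ} {i j : Fin n} (hi : i ∈ S)
    (hj : j ∈ S) (h : v i ≠ v j) : ctr S v ≠ 0 :=
  fun h0 => h ((ctr_eq_zero_iff S v).1 h0 i hi j hj)

/-! ### The compactified moduli spaces

Throughout, the marked points of a real stable `(n+1)`-pointed curve of genus zero are
`x_0 = ∞` and `x_1, …, x_n`; the point `x_{i+1}` has the index `i : Fin n`. -/

/-- Sets of at least two of the marked points `x_1, …, x_n`. -/
abbrev Big (n : ℕ) := {S : Finset (Fin n) // 2 ≤ S.card}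

/-- The product, over all sets `S` of at least two marked points, of the projective spaces of
configurations of points indexed by `S` on the real line, up to affine transformations. -/
abbrev Fam (n : ℕ) := ∀ S : Big n, Projectivization ℝ (V S.1)

lemma ctr_ne_zero_of_injective {n : ℕ} {a : Fin n → ℝ} (ha : Function.Injective a) (S : Big n) :
    ctr S.1 a ≠ 0 := by
  obtain ⟨i, hi, j, hj, hij⟩ := Finset.one_lt_card.1 S.2
  exact ctr_ne_zero hi hj (fun h => hij (ha h))

/-- The class `([a|_S])_S` of a configuration of `n` distinct points on the real line. -/
def conf {n : ℕ} (a : Fin n → ℝ) (ha : Function.Injective a) : Fam n :=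
  fun S => Projectivization.mk ℝ (ctr S.1 a) (ctr_ne_zero_of_injective ha S)

/-- The space of real stable curves of genus zero with the `n + 1` marked points
`x_0, …, x_n`: the iterated blow-up of the real projective space `P(V)`,
`V = {a ∈ ℝ^n : ∑ a_i = 0}`, along the proper transforms of the subspaces
`L_S = {a_i = a_j for i, j ∈ S}`, `S` a proper subset with at least two elements. As the ideal of
`L_S` is generated by the linear forms `a_i - a_j` (`i, j ∈ S`), blowing up `L_S` is taking the
closure of the graph of the rational map `a ↦ [a|_S]` to `P(V S)`, and the iterated blow-up is the
closure of the configuration space in the product of `P(V)` and all the `P(V S)`. The coordinate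
`S` of a stable curve records the marked points in `S` on the component at which the branches to
the points of `S` and to `x_0` separate, with `x_0` at infinity. -/
def Mbar (n : ℕ) : Set (Fam n) :=
  closure {x | ∃ (a : Fin n → ℝ) (ha : Function.Injective a), x = conf a ha}

/-- The two-sheeted cover of `Mbar n`: the same iterated blow-up of the unit sphere of `V` instead
of `P(V)`. (The coordinate of the full index set is the image in `P(V)` of the point of the
sphere, so that the covering map is the second projection.) -/
def Mtil (n : ℕ) : Set ((Fin n → ℝ) × Fam n) :=
  closure {x | (∑ i, x.1 i = 0 ∧ ∑ i, x.1 i ^ 2 = 1) ∧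
    ∃ ha : Function.Injective x.1, x.2 = conf x.1 ha}

/-! ### Strata -/

/-- The index sets of the blown-up subspaces: proper subsets with at least two elements. -/
abbrev Center (n : ℕ) := {S : Finset (Fin n) // 2 ≤ S.card ∧ S ≠ Finset.univ}

/-- The blow-down map `Mbar n → P(V)` sends `x` to the class of `a`. -/
def LiesOver {n : ℕ} (x : Mbar n) (a : Fin n → ℝ) : Prop :=
  ∀ h : 2 ≤ (Finset.univ : Finset (Fin n)).card, ∃ ha : ctr Finset.univ a ≠ 0,
    x.1 ⟨Finset.univ, h⟩ = Projectivization.mk ℝ (ctr Finset.univ a) ha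

/-- The closed tile: the closure of the inverse image of the projective Weyl chamber
`a_{σ(1)} < … < a_{σ(n)}`. -/
def tileBar {n : ℕ} (σ : Equiv.Perm (Fin n)) : Set (Mbar n) :=
  closure {x | ∃ a : Fin n → ℝ, StrictMono (a ∘ σ) ∧ LiesOver x a}

/-- The irreducible component, attached to `S`, of the exceptional divisor: the closure of the
inverse image of the generic part of `L_S`. -/
def divisorBar {n : ℕ} (S : Center n) : Set (Mbar n) :=
  closure {x | ∃ a : Fin n → ℝ, (∀ i j, a i = a j ↔ i = j ∨ (i ∈ S.1 ∧ j ∈ S.1)) ∧ LiesOver x a}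

/-- The closed tile of the cover: the closure of the inverse image of the spherical Weyl chamber
`a_{σ(1)} < … < a_{σ(n)}`. -/
def tileTil {n : ℕ} (σ : Equiv.Perm (Fin n)) : Set (Mtil n) :=
  closure {x | StrictMono (x.1.1 ∘ σ)}

/-- The divisor of the cover attached to `S`. -/
def divisorTil {n : ℕ} (S : Center n) : Set (Mtil n) :=
  closure {x | ∀ i j, x.1.1 i = x.1.1 j ↔ i = j ∨ (i ∈ S.1 ∧ j ∈ S.1)}

/-- The closed strata: nonempty intersections of a tile with some of the divisors. -/
def closedStrata {X α β : Type*} (tile : α → Set X) (divisor : β → Set X) : Set (Set X) :=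
  {F | F.Nonempty ∧ ∃ (σ : α) (B : Set β), F = tile σ ∩ ⋂ S ∈ B, divisor S}

/-- The (open) strata: what is left of a closed stratum when all the closed strata strictly
contained in it are removed. -/
def openStrata {X : Type*} (C : Set (Set X)) : Set (Set X) :=
  {s | ∃ F ∈ C, s = F \ ⋃₀ {F' | F' ∈ C ∧ F' ⊂ F}}

/-- The strata of `Mbar n`. -/
def strataBar (n : ℕ) : Set (Set (Mbar n)) :=
  openStrata (closedStrata (tileBar (n := n)) (divisorBar (n := n)))

/-- The strata of `Mtil n`. -/
def strataTil (n : ℕ) : Set (Set (Mtil n)) :=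
  openStrata (closedStrata (tileTil (n := n)) (divisorTil (n := n)))

/-- A finite partition into locally closed open cells satisfying the frontier condition. -/
structure IsStratification {X : Type*} [TopologicalSpace X] (A : Set (Set X)) : Prop where
  finite : A.Finite
  nonempty : ∀ s ∈ A, s.Nonempty
  disjoint : A.PairwiseDisjoint id
  cover : ⋃₀ A = univ
  isLocallyClosed : ∀ s ∈ A, IsLocallyClosed s
  frontier : ∀ s ∈ A, ∀ t ∈ A, (t ∩ closure s).Nonempty → t ⊆ closure s
  cell : ∀ s ∈ A, ∃ d : ℕ, Nonempty (s ≃ₜ EuclideanSpace ℝ (Fin d))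

/-- `f` is an embedding and a morphism of stratified spaces: source and target are stratified
spaces and `f` is a topological embedding that maps every stratum onto a stratum. -/
structure IsStratifiedEmbedding {X Y : Type*} [TopologicalSpace X] [TopologicalSpace Y]
    (A : Set (Set X)) (B : Set (Set Y)) (f : X → Y) : Prop where
  source : IsStratification A
  target : IsStratification B
  isEmbedding : IsEmbedding f
  image_mem : ∀ s ∈ A, f '' s ∈ B

/-! ### Dyadic expansion -/

/-- Each marked point with index `i < n` is replaced by two points with indices `2i`, `2i+1`;
`pull` gives both of them the coordinate of the old point. -/
def pull (n N : ℕ) : (Fin n → ℝ) →ₗ[ℝ] (Fin N → ℝ) where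
  toFun w := fun j => if h : j.1 / 2 < n then w ⟨j.1 / 2, h⟩ else 0
  map_add' v w := by
    ext j
    by_cases h : j.1 / 2 < n <;> simp [h]
  map_smul' c v := by
    ext j
    by_cases h : j.1 / 2 < n <;> simp [h]

lemma continuous_pull (n N : ℕ) : Continuous (pull n N) :=
  LinearMap.continuous_of_finiteDimensional _

/-- The old marked points from which the points in `S` come. -/
def base (n : ℕ) {N : ℕ} (S : Finset (Fin N)) : Finset (Fin n) :=
  Finset.univ.filter fun i => ∃ j ∈ S, j.1 / 2 = i.1

lemma mem_base {n N : ℕ} {S : Finset (Fin N)} {i : Fin n} :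
    i ∈ base n S ↔ ∃ j ∈ S, j.1 / 2 = i.1 := by
  simp [base]

/-- The indicator of the last index `2n`. -/
def lastVec (n N : ℕ) : Fin N → ℝ := fun j => if 2 * n ≤ j.1 then 1 else 0

/-- The coordinate separating the two points on a grafted component. -/
def pairVec (n N : ℕ) : Fin N → ℝ := fun j => if j.1 < 2 * n ∧ j.1 % 2 = 1 then 1 else 0

lemma ctr_lastVec_ne_zero {n N : ℕ} (hN : N ≤ 2 * n + 1) (S : Big N)
    (h : ∃ j ∈ S.1, 2 * n ≤ j.1) : ctr S.1 (lastVec n N) ≠ 0 := by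
  obtain ⟨j, hj, hjn⟩ := h
  obtain ⟨k, hk, hkj⟩ := Finset.exists_mem_ne S.2 j
  refine ctr_ne_zero hj hk ?_
  have h1 : j.1 < N := j.2
  have h2 : k.1 < N := k.2
  have h3 : k.1 ≠ j.1 := fun h => hkj (Fin.ext h)
  have h4 : ¬ 2 * n ≤ k.1 := by omega
  simp [lastVec, hjn, h4]

lemma ctr_pairVec_ne_zero {n N : ℕ} (S : Big N)
    (h : ¬ ∃ j ∈ S.1, 2 * n ≤ j.1)
    (h2 : ¬ 2 ≤ (base n S.1).card) :
    ctr S.1 (pairVec n N) ≠ 0 := by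
  obtain ⟨i, hi, j, hj, hij⟩ := Finset.one_lt_card.1 S.2
  refine ctr_ne_zero hi hj ?_
  have hi' : i.1 < 2 * n := by by_contra hc; exact h ⟨i, hi, by omega⟩
  have hj' : j.1 < 2 * n := by by_contra hc; exact h ⟨j, hj, by omega⟩
  have hh : i.1 / 2 = j.1 / 2 := by
    by_contra hne
    refine h2 (Finset.one_lt_card.2 ⟨⟨i.1 / 2, by omega⟩, mem_base.2 ⟨i, hi, rfl⟩,
      ⟨j.1 / 2, by omega⟩, mem_base.2 ⟨j, hj, rfl⟩, fun e => hne ?_⟩)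
    simpa using e
  have hne : i.1 ≠ j.1 := fun e => hij (Fin.ext e)
  rcases Nat.mod_two_eq_zero_or_one i.1 with e1 | e1 <;>
    rcases Nat.mod_two_eq_zero_or_one j.1 with e2 | e2
  · omega
  · simp [pairVec, hi', hj', e1, e2]
  · simp [pairVec, hi', hj', e1, e2]
  · omega

/-- Duplicating the coordinates of a configuration of the points in `base n S`. -/
def dup (n : ℕ) {N : ℕ} (S : Finset (Fin N)) : V (base n S) →ₗ[ℝ] V S :=
  (ctr S).comp ((pull n N).comp (V (base n S)).subtype)

lemma continuous_dup (n : ℕ) {N : ℕ} (S : Finset (Fin N)) : Continuous (dup n S) :=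
  LinearMap.continuous_of_finiteDimensional _

lemma dup_injective {n N : ℕ} {S : Finset (Fin N)} :
    Function.Injective (dup n S) := by
  rw [← LinearMap.ker_eq_bot, LinearMap.ker_eq_bot']
  rintro ⟨w, hw1, hw2⟩ hw
  have hw' := (ctr_eq_zero_iff _ _).1 hw
  have hc : ∀ i ∈ base n S, ∀ k ∈ base n S, w i = w k := by
    intro i hi k hk
    obtain ⟨j, hj, hji⟩ := mem_base.1 hi
    obtain ⟨l, hl, hlk⟩ := mem_base.1 hk
    have := hw' j hj l hl
    simpa [pull, hji, hlk] using this
  ext i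
  by_cases hi : i ∈ base n S
  · rw [Finset.sum_congr rfl (fun k hk => hc k hk i hi)] at hw2
    have hpos : ((base n S).card : ℝ) ≠ 0 := by exact_mod_cast (Finset.card_pos.2 ⟨i, hi⟩).ne'
    simpa [hpos] using hw2
  · exact hw1 i hi

/-- The expansion of a stable curve, in coordinates. Each marked point `x_{i+1}` (index `i`) is
replaced by a grafted component that carries, besides the node, the two marked points of
indices `2i`, `2i+1`. If `N = 2n`, the point `x_0` is kept; if `N = 2n+1`, a component with the
node, the new marked point at infinity and the marked point of index `2n` is grafted at `x_0`.
The coordinate `S` of the new curve is: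
the one of the component grafted at `x_0` if `S` contains the index `2n`; otherwise, the one of the
component of the old curve separating the points below `S`, if there are at least two of them;
otherwise `S = {2i, 2i+1}` for some `i`, and it is the only possible one. -/
def expFam {n N : ℕ} (hN : N ≤ 2 * n + 1) (x : Fam n) : Fam N := fun S =>
  open Classical in
  if h1 : ∃ j ∈ S.1, 2 * n ≤ j.1 then
    Projectivization.mk ℝ (ctr S.1 (lastVec n N)) (ctr_lastVec_ne_zero hN S h1)
  else if h2 : 2 ≤ (base n S.1).card then
    Projectivization.map (dup n S.1) dup_injective (x ⟨base n S.1, h2⟩)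
  else
    Projectivization.mk ℝ (ctr S.1 (pairVec n N)) (ctr_pairVec_ne_zero S h1 h2)

lemma continuous_expFam {n N : ℕ} (hN : N ≤ 2 * n + 1) : Continuous (expFam hN) := by
  refine continuous_pi fun S => ?_
  by_cases h1 : ∃ j ∈ S.1, 2 * n ≤ j.1
  · simp only [expFam, dif_pos h1]
    exact continuous_const
  · by_cases h2 : 2 ≤ (base n S.1).card
    · simp only [expFam, dif_neg h1, dif_pos h2]
      exact (continuous_map _ _ (continuous_dup _ _)).comp (continuous_apply _)
    · simp only [expFam, dif_neg h1, dif_neg h2]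
      exact continuous_const


/-- Configurations with `2n` or `2n+1` points that degenerate to the expanded curve. -/
def approx {n : ℕ} (N : ℕ) (a : Fin n → ℝ) (e : ℝ) : Fin N → ℝ :=
  lastVec n N + e • (pull n N a + e • pairVec n N)

lemma eventually_injective {n N : ℕ} (hN : N ≤ 2 * n + 1) {a : Fin n → ℝ}
    (ha : Function.Injective a) :
    ∀ᶠ e in 𝓝[>] (0 : ℝ), Function.Injective (approx N a e) := by
  have key : ∀ i j : Fin N, i ≠ j → ∀ᶠ e in 𝓝[>] (0 : ℝ), approx N a e i ≠ approx N a e j := by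
    have hpos : ∀ᶠ e in 𝓝[>] (0 : ℝ), 0 < e := eventually_mem_nhdsWithin
    have last : ∀ i j : Fin N, i ≠ j → 2 * n ≤ i.1 →
        ∀ᶠ e in 𝓝[>] (0 : ℝ), approx N a e i ≠ approx N a e j := by
      intro i j hij hi
      have h1 := i.2
      have h2 := j.2
      have h3 : i.1 ≠ j.1 := fun h => hij (Fin.ext h)
      have h4 : ¬ 2 * n ≤ j.1 := by omega
      have hcont : Continuous fun e : ℝ => approx N a e i - approx N a e j := by
        simp only [approx, Pi.add_apply, Pi.smul_apply, smul_eq_mul]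
        fun_prop
      have h0 : approx N a 0 i - approx N a 0 j ≠ 0 := by
        simp [approx, lastVec, hi, h4]
      have := (hcont.tendsto 0).eventually_ne h0
      filter_upwards [this.filter_mono nhdsWithin_le_nhds] with e he
      exact sub_ne_zero.1 he
    intro i j hij
    by_cases hi : 2 * n ≤ i.1
    · exact last i j hij hi
    by_cases hj : 2 * n ≤ j.1
    · exact (last j i hij.symm hj).mono fun e he => he.symm
    have h3 : i.1 ≠ j.1 := fun h => hij (Fin.ext h)
    have hi2 : i.1 / 2 < n := by omega
    have hj2 : j.1 / 2 < n := by omega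
    by_cases hh : i.1 / 2 = j.1 / 2
    · filter_upwards [hpos] with e he
      have e1 : pull n N a i = pull n N a j := by simp [pull, hh]
      have e2 : pairVec n N i ≠ pairVec n N j := by
        rcases Nat.mod_two_eq_zero_or_one i.1 with e1 | e1 <;>
          rcases Nat.mod_two_eq_zero_or_one j.1 with e2 | e2
        · omega
        · simp [pairVec, e1, e2]; omega
        · simp [pairVec, e1, e2]; omega
        · omega
      simpa [approx, lastVec, hi, hj, e1, he.ne'] using e2
    · have hcont : Continuous fun e : ℝ =>
          (pull n N a i + e * pairVec n N i) - (pull n N a j + e * pairVec n N j) := by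
        fun_prop
      have h0 : (pull n N a i + 0 * pairVec n N i) - (pull n N a j + 0 * pairVec n N j) ≠ 0 := by
        have : a ⟨i.1 / 2, hi2⟩ ≠ a ⟨j.1 / 2, hj2⟩ := fun h => hh (by simpa using ha h)
        simpa [pull, hi2, hj2, sub_eq_zero] using this
      have := (hcont.tendsto 0).eventually_ne h0
      filter_upwards [this.filter_mono nhdsWithin_le_nhds, hpos] with e he he0
      simp only [approx, Pi.add_apply, Pi.smul_apply, smul_eq_mul, lastVec, hi, hj, if_false,
        zero_add]
      intro h
      exact he (sub_eq_zero.2 (mul_left_cancel₀ he0.ne' h))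
  have h2 : ∀ᶠ e in 𝓝[>] (0 : ℝ), ∀ i j : Fin N, i ≠ j → approx N a e i ≠ approx N a e j := by
    rw [eventually_all]; intro i
    rw [eventually_all]; intro j
    by_cases hij : i = j
    · simp [hij]
    · exact (key i j hij).mono fun e he _ => he
  filter_upwards [h2] with e he i j h
  by_contra hij
  exact he i j hij h

lemma ctr_congr {n : ℕ} {S : Finset (Fin n)} {v w : Fin n → ℝ} (c : ℝ)
    (h : ∀ i ∈ S, v i = w i + c) : ctr S v = ctr S w := by
  rw [← sub_eq_zero, ← map_sub, ctr_eq_zero_iff]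
  intro i hi j hj
  simp [h i hi, h j hj]

lemma mk_congr {E : Type*} [AddCommGroup E] [Module ℝ E] {v w : E} (hv : v ≠ 0) (hw : w ≠ 0)
    (c : ℝ) (h : v = c • w) : Projectivization.mk ℝ v hv = Projectivization.mk ℝ w hw :=
  (Projectivization.mk_eq_mk_iff' ℝ v w hv hw).2 ⟨c, h.symm⟩

/-- Small positive parameters for which the approximating configuration is injective. -/
abbrev Small {n : ℕ} (N : ℕ) (a : Fin n → ℝ) :=
  {e : ℝ // 0 < e ∧ Function.Injective (approx N a e)}

lemma small_neBot {n N : ℕ} (hN : N ≤ 2 * n + 1) {a : Fin n → ℝ} (ha : Function.Injective a) :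
    (comap (Subtype.val : Small N a → ℝ) (𝓝 0)).NeBot := by
  rw [comap_neBot_iff_frequently]
  have h1 : ∀ᶠ e in 𝓝[>] (0 : ℝ), 0 < e ∧ Function.Injective (approx N a e) :=
    eventually_mem_nhdsWithin.and (eventually_injective hN ha)
  refine (h1.frequently.filter_mono nhdsWithin_le_nhds).mono fun e he => ⟨⟨e, he⟩, rfl⟩

lemma tendsto_conf_approx {n N : ℕ} (hN : N ≤ 2 * n + 1) {a : Fin n → ℝ}
    (ha : Function.Injective a) :
    Tendsto (fun e : Small N a => conf (approx N a e) e.2.2) (comap Subtype.val (𝓝 0))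
      (𝓝 (expFam hN (conf a ha))) := by
  have hval : Tendsto (Subtype.val : Small N a → ℝ) (comap Subtype.val (𝓝 0)) (𝓝 0) := tendsto_comap
  refine tendsto_pi_nhds.2 fun S => ?_
  by_cases h1 : ∃ j ∈ S.1, 2 * n ≤ j.1
  · simp only [expFam, dif_pos h1, conf]
    refine tendsto_mk ?_ _ _
    have hc : Continuous fun e : ℝ => ctr S.1 (approx N a e) := by
      refine (continuous_ctr _).comp ?_
      unfold approx
      fun_prop
    have h0 : ctr S.1 (approx N a 0) = ctr S.1 (lastVec n N) := by simp [approx]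
    rw [← h0]
    exact (hc.tendsto 0).comp hval
  have hlast : ∀ j ∈ S.1, lastVec n N j = 0 := fun j hj => by
    have : ¬ 2 * n ≤ j.1 := fun h => h1 ⟨j, hj, h⟩
    simp [lastVec, this]
  by_cases h2 : 2 ≤ (base n S.1).card
  · simp only [expFam, dif_neg h1, dif_pos h2, conf, Projectivization.map_mk]
    have hz : ∀ e : Small N a,
        ctr S.1 (approx N a e) = e.1 • ctr S.1 (pull n N a + e.1 • pairVec n N) := by
      intro e
      rw [← map_smul]
      refine ctr_congr 0 fun i hi => ?_
      simp only [approx, Pi.add_apply, Pi.smul_apply, smul_eq_mul, hlast i hi, zero_add, add_zero]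
    have hne : ∀ e : Small N a, ctr S.1 (pull n N a + e.1 • pairVec n N) ≠ 0 := by
      intro e h
      exact ctr_ne_zero_of_injective e.2.2 S (by rw [hz e, h, smul_zero])
    have hd : dup n S.1 (ctr (base n S.1) a) = ctr S.1 (pull n N a) := by
      refine ctr_congr (-((∑ j ∈ base n S.1, a j) / (base n S.1).card)) fun i hi => ?_
      have hi2 : i.1 / 2 < n := by
        have : ¬ 2 * n ≤ i.1 := fun h => h1 ⟨i, hi, h⟩
        omega
      have hm : (⟨i.1 / 2, hi2⟩ : Fin n) ∈ base n S.1 := mem_base.2 ⟨i, hi, rfl⟩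
      simp [pull, hi2, ctr, hm]
      ring
    have hgoal : Tendsto (fun e : Small N a => Projectivization.mk ℝ _ (hne e)) (comap Subtype.val (𝓝 0))
        (𝓝 (Projectivization.mk ℝ (dup n S.1 (ctr (base n S.1) a))
          (by simpa using (map_ne_zero_iff _ dup_injective).2
                (ctr_ne_zero_of_injective ha ⟨_, h2⟩)))) := by
      refine tendsto_mk ?_ _ _
      have hc : Continuous fun e : ℝ => ctr S.1 (pull n N a + e • pairVec n N) :=
        (continuous_ctr _).comp (by fun_prop)
      have h0 : ctr S.1 (pull n N a + (0 : ℝ) • pairVec n N) = ctr S.1 (pull n N a) := by simp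
      rw [hd, ← h0]
      exact (hc.tendsto 0).comp hval
    refine hgoal.congr fun e => ?_
    exact (mk_congr _ _ e.1 (hz e)).symm
  · simp only [expFam, dif_neg h1, dif_neg h2, conf]
    refine tendsto_const_nhds.congr fun e => ?_
    refine (mk_congr _ _ (e.1 ^ 2) ?_).symm
    obtain ⟨i, hi, -⟩ := Finset.one_lt_card.1 S.2
    rw [← map_smul]
    refine ctr_congr (e.1 * pull n N a i) fun j hj => ?_
    have hi' : i.1 < 2 * n := by by_contra hc; exact h1 ⟨i, hi, by omega⟩
    have hj' : j.1 < 2 * n := by by_contra hc; exact h1 ⟨j, hj, by omega⟩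
    have hh : j.1 / 2 = i.1 / 2 := by
      by_contra hne
      refine h2 (Finset.one_lt_card.2 ⟨⟨i.1 / 2, by omega⟩, mem_base.2 ⟨i, hi, rfl⟩,
        ⟨j.1 / 2, by omega⟩, mem_base.2 ⟨j, hj, rfl⟩, fun e => hne ?_⟩)
      simpa using e.symm
    have hp : pull n N a j = pull n N a i := by simp [pull, hh]
    simp only [approx, Pi.add_apply, Pi.smul_apply, smul_eq_mul, hlast j hj, hp]
    ring

lemma expFam_mem {n N : ℕ} (hN : N ≤ 2 * n + 1) :
    MapsTo (expFam hN) (Mbar n) (Mbar N) := by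
  have h : MapsTo (expFam hN) {x | ∃ (a : Fin n → ℝ) (ha : Function.Injective a), x = conf a ha}
      (Mbar N) := by
    rintro _ ⟨a, ha, rfl⟩
    have := small_neBot hN ha
    exact mem_closure_of_tendsto (tendsto_conf_approx hN ha)
      (Eventually.of_forall fun e => ⟨_, e.2.2, rfl⟩)
  have h2 := h.closure (continuous_expFam hN)
  have h3 : closure (Mbar N) = Mbar N := closure_closure
  rwa [h3] at h2

/-- The dyadic expansion of the curves with `n + 1` marked points to curves with `2(n + 1)` marked
points, all the marked points being expanded. -/
def expBar (n : ℕ) : Mbar n → Mbar (2 * n + 1) :=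
  (expFam_mem le_rfl).restrict _ _ _

/-- The expansion in the double cover: all the marked points except `x_0` are expanded; the point
`a` of the unit sphere goes to the point in the direction of `(a_1, a_1, a_2, a_2, …)`. -/
def expTilFam (n : ℕ) (x : (Fin n → ℝ) × Fam n) : (Fin (2 * n) → ℝ) × Fam (2 * n) :=
  ((√2)⁻¹ • pull n (2 * n) x.1, expFam (Nat.le_succ (2 * n)) x.2)

lemma continuous_expTilFam (n : ℕ) : Continuous (expTilFam n) :=
  Continuous.prodMk
    (((continuous_pull n (2 * n)).comp continuous_fst).const_smul ((√2)⁻¹ : ℝ))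
    ((continuous_expFam (Nat.le_succ (2 * n))).comp continuous_snd)

lemma sum_pull {n : ℕ} (f : ℝ → ℝ) (a : Fin n → ℝ) :
    ∑ j, f (pull n (2 * n) a j) = 2 * ∑ i, f (a i) := by
  have h : ∀ g : Fin (n * 2) → ℝ, ∑ j, g j = ∑ i : Fin n, (g (finProdFinEquiv (i, 0)) +
      g (finProdFinEquiv (i, 1))) := by
    intro g
    rw [← finProdFinEquiv.sum_comp, Fintype.sum_prod_type]
    simp
  rw [← (finCongr (mul_comm n 2)).sum_comp, h, Finset.mul_sum]
  refine Finset.sum_congr rfl fun i _ => ?_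
  have h1 : (1 + 2 * i.1) / 2 = i.1 := by omega
  simp [pull, h1]
  ring

lemma ctr_univ_apply {n : ℕ} (v : Fin n → ℝ) (i : Fin n) :
    (ctr Finset.univ v).1 i = v i - (∑ j, v j) / n := by
  simp [ctr]

lemma expTilFam_mem (n : ℕ) : MapsTo (expTilFam n) (Mtil n) (Mtil (2 * n)) := by
  have h : MapsTo (expTilFam n) {x | (∑ i, x.1 i = 0 ∧ ∑ i, x.1 i ^ 2 = 1) ∧
      ∃ ha : Function.Injective x.1, x.2 = conf x.1 ha} (Mtil (2 * n)) := by
    rintro ⟨a, x⟩ ⟨⟨hs, hq⟩, ha, hx⟩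
    dsimp only at hs hq ha hx
    subst hx
    have hN : 2 * n ≤ 2 * n + 1 := Nat.le_succ _
    have := small_neBot hN ha
    set q : (Fin (2 * n) → ℝ) → ℝ := fun v => ∑ i, (ctr Finset.univ v).1 i ^ 2 with hqdef
    have hv : ∀ e : Small (2 * n) a, approx (2 * n) a e =
        e.1 • (pull n (2 * n) a + e.1 • pairVec n (2 * n)) := by
      intro e
      ext j
      have : ¬ 2 * n ≤ j.1 := by have := j.2; omega
      simp only [approx, lastVec, this, Pi.add_apply, Pi.smul_apply, smul_eq_mul, if_false,
        zero_add]
    set u : ℝ → Fin (2 * n) → ℝ := fun e => pull n (2 * n) a + e • pairVec n (2 * n) with hu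
    set b : ℝ → Fin (2 * n) → ℝ := fun e => (√(q (u e)))⁻¹ • (ctr Finset.univ (u e)).1 with hb
    have hn : 2 ≤ (Finset.univ : Finset (Fin (2 * n))).card := by
      rcases Nat.eq_zero_or_pos n with rfl | hn
      · simp at hq
      · simp; omega
    have huinj : ∀ e : Small (2 * n) a, Function.Injective (u e) := by
      intro e i j hij
      refine e.2.2 ?_
      rw [hv e]
      simp only [Pi.smul_apply]
      rw [show (pull n (2 * n) a + e.1 • pairVec n (2 * n)) i =
        (pull n (2 * n) a + e.1 • pairVec n (2 * n)) j from hij]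
    have hqpos : ∀ e : Small (2 * n) a, 0 < q (u e) := by
      intro e
      have hne := ctr_ne_zero_of_injective (huinj e) ⟨Finset.univ, hn⟩
      have h0 : 0 ≤ q (u e) := Finset.sum_nonneg fun i _ => sq_nonneg _
      refine lt_of_le_of_ne h0 fun h => hne ?_
      have := (Finset.sum_eq_zero_iff_of_nonneg (fun i _ => sq_nonneg _)).1 h.symm
      ext i
      simpa using this i (Finset.mem_univ i)
    have hbi : ∀ e : Small (2 * n) a, ∀ i, b e i = (√(q (u e)))⁻¹ * u e i +
        -((√(q (u e)))⁻¹ * ((∑ j, u e j) / (2 * n : ℕ))) := by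
      intro e i
      have : b e i = (√(q (u e)))⁻¹ * (ctr Finset.univ (u e)).1 i := rfl
      rw [this, ctr_univ_apply]
      ring
    have hsq : ∀ e : Small (2 * n) a, (√(q (u e)))⁻¹ ≠ 0 := fun e =>
      inv_ne_zero (Real.sqrt_pos.2 (hqpos e)).ne'
    have hbinj : ∀ e : Small (2 * n) a, Function.Injective (b e) := by
      intro e i j hij
      rw [hbi, hbi] at hij
      exact huinj e (mul_left_cancel₀ (hsq e) (add_right_cancel hij))
    have hconf : ∀ e : Small (2 * n) a,
        conf (approx (2 * n) a e) e.2.2 = conf (b e) (hbinj e) := by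
      intro e
      funext S
      refine mk_congr _ _ (e.1 * √(q (u e))) ?_
      have h3 : ctr S.1 (b e) = ctr S.1 ((√(q (u e)))⁻¹ • u e) :=
        ctr_congr _ fun i _ => hbi e i
      rw [h3, hv e, map_smul, map_smul, smul_smul, mul_assoc,
        mul_inv_cancel₀ (Real.sqrt_pos.2 (hqpos e)).ne', mul_one]
    have hu0 : u 0 = pull n (2 * n) a := by simp [hu]
    have hsum : ∑ j, pull n (2 * n) a j = 0 := by
      have := sum_pull (fun t => t) a
      simpa [hs] using this
    have hctr0 : (ctr Finset.univ (u 0)).1 = pull n (2 * n) a := by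
      funext i
      rw [ctr_univ_apply, hu0, hsum]
      simp
    have hq0 : q (u 0) = 2 := by
      simp only [hqdef, hctr0]
      rw [sum_pull (fun t => t ^ 2) a, hq]
      norm_num
    have hb0 : b 0 = (√2)⁻¹ • pull n (2 * n) a := by
      simp only [hb, hctr0, hq0]
    have huc : Continuous u := by fun_prop
    have hcc : Continuous fun e => (ctr Finset.univ (u e)).1 :=
      continuous_subtype_val.comp ((continuous_ctr _).comp huc)
    have hqc : Continuous fun e => q (u e) := by
      simp only [hqdef]
      exact continuous_finsetSum _ fun i _ => ((continuous_apply i).comp hcc).pow 2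
    have hbc : ContinuousAt b 0 := by
      refine ContinuousAt.smul (ContinuousAt.inv₀ (hqc.sqrt.continuousAt) ?_) hcc.continuousAt
      rw [hq0]
      positivity
    have hval : Tendsto (Subtype.val : Small (2 * n) a → ℝ) (comap Subtype.val (𝓝 0)) (𝓝 0) := tendsto_comap
    have ht : Tendsto (fun e : Small (2 * n) a => (b e, conf (approx (2 * n) a e) e.2.2))
        (comap Subtype.val (𝓝 0)) (𝓝 (expTilFam n (a, conf a ha))) := by
      refine Tendsto.prodMk_nhds ?_ (tendsto_conf_approx hN ha)
      have := hbc.tendsto.comp hval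
      rwa [hb0] at this
    refine mem_closure_of_tendsto ht (Eventually.of_forall fun e => ⟨⟨?_, ?_⟩, hbinj e, hconf e⟩)
    · have h5 := (ctr Finset.univ (u e)).2.2
      show ∑ i, (√(q (u e)))⁻¹ * (ctr Finset.univ (u e)).1 i = 0
      rw [← Finset.mul_sum, h5, mul_zero]
    · show ∑ i, ((√(q (u e)))⁻¹ * (ctr Finset.univ (u e)).1 i) ^ 2 = 1
      simp only [mul_pow]
      rw [← Finset.mul_sum, inv_pow, Real.sq_sqrt (hqpos e).le]
      exact inv_mul_cancel₀ (hqpos e).ne'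
  have h2 := h.closure (continuous_expTilFam n)
  have h3 : closure (Mtil (2 * n)) = Mtil (2 * n) := closure_closure
  rwa [h3] at h2

/-- The dyadic expansion of the double covers. -/
def expTil (n : ℕ) : Mtil n → Mtil (2 * n) :=
  (expTilFam_mem n).restrict _ _ _

lemma continuous_expBar (n : ℕ) : Continuous (expBar n) :=
  (continuous_expFam _).restrict _

lemma continuous_expTil (n : ℕ) : Continuous (expTil n) :=
  (continuous_expTilFam _).restrict _

/-! ### The towers -/

/-- The levels of the cyclic tower: `2, 5, 11, …`. -/
def levBar : ℕ → ℕ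
  | 0 => 2
  | k + 1 => 2 * levBar k + 1

lemma levBar_add_one (k : ℕ) : levBar k + 1 = 3 * 2 ^ k := by
  induction k with
  | zero => rfl
  | succ k ih => rw [levBar, pow_succ]; omega

/-- The levels of the tower of double covers: `2, 4, 8, …`. -/
def levTil : ℕ → ℕ
  | 0 => 2
  | k + 1 => 2 * levTil k

lemma levTil_eq (k : ℕ) : levTil k = 2 ^ (k + 1) := by
  induction k with
  | zero => rfl
  | succ k ih => rw [levTil, ih, pow_succ 2 (k + 1)]; omega

/-- The inductive system of the spaces of curves with `3 · 2^k` marked points. -/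
def systemBar : ℕ ⥤ TopCat.{0} :=
  Functor.ofSequence (X := fun k => TopCat.of (Mbar (levBar k)))
    fun k => TopCat.ofHom ⟨expBar (levBar k), continuous_expBar _⟩

/-- The inductive system of the double covers, with `2^(k+1) + 1` marked points. -/
def systemTil : ℕ ⥤ TopCat.{0} :=
  Functor.ofSequence (X := fun k => TopCat.of (Mtil (levTil k)))
    fun k => TopCat.ofHom ⟨expTil (levTil k), continuous_expTil _⟩

/-- The cyclic tower: the inductive limit of the spaces of stable curves. -/
abbrev TowerBar : Type := (colimit systemBar : TopCat.{0})

/-- The tower of the double covers. -/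
abbrev TowerTil : Type := (colimit systemTil : TopCat.{0})

/-- The canonical map of the level `k` to the cyclic tower. -/
def toTowerBar (k : ℕ) : Mbar (levBar k) → TowerBar := fun x => (colimit.ι systemBar k).hom x

/-- The canonical map of the level `k` to the tower of the double covers. -/
def toTowerTil (k : ℕ) : Mtil (levTil k) → TowerTil := fun x => (colimit.ι systemTil k).hom x

/-- The images in the tower of the strata of all the levels. -/
def strataTowerBar : Set (Set TowerBar) :=
  {e | ∃ k, ∃ s ∈ strataBar (levBar k), e = toTowerBar k '' s}

/-- The images in the tower of the strata of all the levels. -/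
def strataTowerTil : Set (Set TowerTil) :=
  {e | ∃ k, ∃ s ∈ strataTil (levTil k), e = toTowerTil k '' s}

/-- `X` is a CW complex whose open cells are exactly the members of `E`. -/
def IsCWWithCells (X : Type) [TopologicalSpace X] (E : Set (Set X)) : Prop :=
  T2Space X ∧ ∃ _ : CWComplex (univ : Set X),
    E = {e | ∃ (d : ℕ) (i : RelCWComplex.cell (univ : Set X) d), e = RelCWComplex.openCell d i}

/-- No point has a neighbourhood that meets only finitely many of the cells. -/
def NowhereLocallyFinite {X : Type} [TopologicalSpace X] (E : Set (Set X)) : Prop :=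
  ∀ x : X, ∀ U ∈ 𝓝 x, {e | e ∈ E ∧ (e ∩ U).Nonempty}.Infinite

end RealModuli

end

/-! Everything is reduced to a preorder on each of the spaces. The coordinates of a point of `Mbar
n` are compatible under restriction (`Compat`) and, for some linear order `σ` of the marked points,
all weakly monotone (`IsMono`). In the face order (`FamLE`), `y` is below `x` if each coordinate of
`y` is, up to sign, a weakly increasing function of the same coordinate of `x`; for the double cover
(`TilLE`) the weak order of the entries of the sphere vector is respected too. The closed strata are
the principal lower sets of this preorder, and the strata are its classes of mutually comparable
points.

Cubes. For fixed `σ`, the compatible `σ`-monotone families are parametrised by the matrices of gap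
ratios (`IsRatio`, `exists_chart_eq`), and the face order only asks which entries are `0` or `1`.
Within a column, the earlier columns determine the quotients of the odds `u / (1 - u)` of the
entries that are neither `0` nor `1`. A column with such entries therefore has one degree of
freedom, measured by their average. By `colAvg_injOn` and `exists_of_colAvg` these averages identify
a face with a cube, and `exists_cellular` carries this over to `Mbar n` and `Mtil n`.

Strata. A closed tile is the set of `σ`-monotone points, and the divisor of `S` is the set of points
whose coordinates at sets strictly larger than `S` are constant on `S` (`InTree`). A tile and some
divisors that meet have a largest common point (`exists_largest`): a gap between neighbours
contained in more of the given sets is made infinitely smaller. Conversely the pairs which a point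
collapses can be read off from its tree (`exists_inTree`). This gives `closedStrata_eq`.

Expansion. Forgetting the odd marked points is a continuous left inverse of the expansion, both maps
respect the order, and everything below an expanded curve is itself expanded (`eq_expFam_of_le`,
`mem_range_expTil`). Hence classes are mapped onto classes.

Towers. A sequence of such spaces, each a lower set in the next, has a limit with a preorder of the
same kind (`IsCellTower.cellular_tower`), which is a CW complex by `Cellular.isCWWithCells`; the
forgetful maps extend to the limit and separate its points. An open set that meets only finitely
many cells would lie in a single level, whereas the configurations of distinct points of the next
level are dense there and are never expanded curves. -/

noncomputable section

namespace RealModuli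

section

/-! ### The gap-ratio model of a closed tile -/

/-- If `u i k = (a (k-1) - a i) / (a k - a i)`, then `relPos u i p k = (a p - a i) / (a k - a i)`. -/
def relPos (u : ℕ → ℕ → ℝ) (i p k : ℕ) : ℝ := ∏ l ∈ Finset.Ioc p k, u i l

lemma relPos_self (u : ℕ → ℕ → ℝ) (i k : ℕ) : relPos u i k k = 1 := by simp [relPos]

lemma relPos_succ (u : ℕ → ℕ → ℝ) (i : ℕ) {p k : ℕ} (h : p ≤ k) :
    relPos u i p (k + 1) = relPos u i p k * u i (k + 1) := by
  simp only [relPos]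
  rw [← Finset.insert_Ioc_right_eq_Ioc_add_one h, Finset.prod_insert (by simp), mul_comm]

lemma relPos_mul (u : ℕ → ℕ → ℝ) (i : ℕ) {p q k : ℕ} (h : p ≤ q) (hk : q ≤ k) :
    relPos u i p k = relPos u i p q * relPos u i q k := by
  simp only [relPos]
  rw [Finset.prod_Ioc_consecutive _ h hk]

/-- Matrices of ratios `u i k = (a (k-1) - a i) / (a k - a i)`, `i < k < n`, of increasing
sequences `a 0 < … < a (n-1)`, and their limits. -/
structure IsRatio (n : ℕ) (u : ℕ → ℕ → ℝ) : Prop where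
  nonneg : ∀ i k, 0 ≤ u i k
  le_one : ∀ i k, u i k ≤ 1
  support : ∀ i k, ¬ (i < k ∧ k < n) → u i k = 0
  diag : ∀ i, u i (i + 1) = 0
  rel : ∀ i j k, i < j → j < k → k < n →
    1 - u i k = (1 - u j k) * (1 - relPos u i j k)

namespace IsRatio

variable {n : ℕ} {u u' : ℕ → ℕ → ℝ}

lemma relPos_nonneg (h : IsRatio n u) (i p k : ℕ) : 0 ≤ relPos u i p k :=
  Finset.prod_nonneg fun _ _ => h.nonneg _ _

lemma relPos_le_one (h : IsRatio n u) (i p k : ℕ) : relPos u i p k ≤ 1 :=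
  Finset.prod_le_one (fun _ _ => h.nonneg _ _) fun _ _ => h.le_one _ _

lemma relPos_left (h : IsRatio n u) {i k : ℕ} (hik : i < k) : relPos u i i k = 0 :=
  Finset.prod_eq_zero (i := i + 1) (by simp; omega) (h.diag i)

lemma relPos_mono (h : IsRatio n u) (i : ℕ) {p q : ℕ} (k : ℕ) (hpq : p ≤ q) :
    relPos u i p k ≤ relPos u i q k := by
  rcases le_total q k with hq | hq
  · rw [relPos_mul u i hpq hq]
    exact mul_le_of_le_one_left (h.relPos_nonneg _ _ _) (h.relPos_le_one _ _ _)
  · have : relPos u i q k = 1 := by simp [relPos, Finset.Ioc_eq_empty_of_le hq]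
    rw [this]; exact h.relPos_le_one _ _ _

/-- Restriction of the normalised positions in `[i, k]` to the subinterval `[j, k]`. -/
lemma relPos_sub (h : IsRatio n u) {i j p k : ℕ} (hij : i < j) (hjp : j ≤ p) (hpk : p ≤ k)
    (hk : k < n) (hjk : j < k) :
    relPos u i p k - relPos u i j k = relPos u j p k * (1 - relPos u i j k) := by
  -- Raising `k` by one multiplies both positions on the left by `u i (k + 1)`; the column relation
  -- converts the resulting factor into `u j (k + 1)`.
  induction k, hpk using Nat.le_induction with
  | base => simp [relPos_self]
  | succ k hpk ih =>
    have hr := h.rel i j (k + 1) hij hjk hk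
    rcases eq_or_lt_of_le (hjp.trans hpk) with he | hlt
    · have hpj : p = j := by omega
      subst hpj
      simp [h.relPos_left hjk]
    · have ih := ih (by omega) hlt
      have e1 := relPos_succ u i hpk
      have e2 := relPos_succ u i (hjp.trans hpk)
      have e3 := relPos_succ u j hpk
      rw [e1, e2, e3]
      rw [e2] at hr
      have hr' : u i (k + 1) - relPos u i j k * u i (k + 1)
          = u j (k + 1) * (1 - relPos u i j k * u i (k + 1)) := by linarith
      calc relPos u i p k * u i (k + 1) - relPos u i j k * u i (k + 1)
          = (relPos u i p k - relPos u i j k) * u i (k + 1) := by ring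
        _ = relPos u j p k * (u i (k + 1) - relPos u i j k * u i (k + 1)) := by rw [ih]; ring
        _ = _ := by rw [hr']; ring

/-- The general restriction formula, from `[i, l]` to `[j, k]`. -/
lemma relPos_sub' (h : IsRatio n u) {i j p k l : ℕ} (hij : i ≤ j) (hjp : j ≤ p) (hpk : p ≤ k)
    (hkl : k ≤ l) (hl : l < n) (hjk : j < k) :
    relPos u i p l - relPos u i j l = relPos u j p k * (relPos u i k l - relPos u i j l) := by
  rw [relPos_mul u i hpk hkl, relPos_mul u i (hjp.trans hpk) hkl]
  rcases eq_or_lt_of_le hij with rfl | hlt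
  · rw [h.relPos_left hjk]; ring
  · have := h.relPos_sub hlt hjp hpk (by omega) hjk
    calc _ = (relPos u i p k - relPos u i j k) * relPos u i k l := by ring
      _ = _ := by rw [this]; ring

/-- The column relation in the form of a comparison of odds. -/
lemma col (h : IsRatio n u) {i j k : ℕ} (hij : i < j) (hjk : j ≤ k) (hk : k + 1 < n) :
    (1 - u i (k + 1)) * u j (k + 1)
      = (1 - relPos u i j k) * (1 - u j (k + 1)) * u i (k + 1) := by
  have := h.rel i j (k + 1) hij (by omega) hk
  rw [relPos_succ u i hjk] at this
  linear_combination this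

end IsRatio

lemma rel_of_col {a b r : ℝ} (h : (1 - a) * b = (1 - r) * (1 - b) * a) :
    1 - a = (1 - b) * (1 - r * a) := by
  linear_combination h

/-- The face order on ratio matrices: `u` lies in the smallest face containing `u'`. -/
def FaceLE (u u' : ℕ → ℕ → ℝ) : Prop :=
  ∀ i k, (u' i k = 0 → u i k = 0) ∧ (u' i k = 1 → u i k = 1)

/-- The rows of the column `k` in which the entry is neither `0` nor `1`. -/
def freeRows (u : ℕ → ℕ → ℝ) (k : ℕ) : Finset ℕ :=
  open Classical in (Finset.range k).filter fun i => u i k ≠ 0 ∧ u i k ≠ 1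

lemma mem_freeRows {u : ℕ → ℕ → ℝ} {k i : ℕ} :
    i ∈ freeRows u k ↔ i < k ∧ u i k ≠ 0 ∧ u i k ≠ 1 := by
  simp [freeRows]

lemma freeRows_subset {u u' : ℕ → ℕ → ℝ} (h : FaceLE u u') (k : ℕ) :
    freeRows u k ⊆ freeRows u' k := by
  intro i hi
  rw [mem_freeRows] at hi ⊢
  exact ⟨hi.1, fun e => hi.2.1 ((h i k).1 e), fun e => hi.2.2 ((h i k).2 e)⟩

/-- The free columns below `n`. -/
def freeCols (n : ℕ) (u : ℕ → ℕ → ℝ) : Finset ℕ :=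
  open Classical in (Finset.range n).filter fun k => (freeRows u k).Nonempty

lemma mem_freeCols {n : ℕ} {u : ℕ → ℕ → ℝ} {k : ℕ} :
    k ∈ freeCols n u ↔ k < n ∧ (freeRows u k).Nonempty := by
  simp [freeCols]

/-- The average of the column `k` of `u` over the free rows of `w`. -/
def colAvg (w u : ℕ → ℕ → ℝ) (k : ℕ) : ℝ := (∑ i ∈ freeRows w k, u i k) / (freeRows w k).card

lemma continuous_colAvg (w : ℕ → ℕ → ℝ) (k : ℕ) : Continuous fun u => colAvg w u k := by
  unfold colAvg
  fun_prop

/-- Two solutions of the column relations with the same average agree. -/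
lemma colAvg_injOn {n : ℕ} {w u v : ℕ → ℕ → ℝ} (hu : IsRatio n u) (hv : IsRatio n v)
    (huw : FaceLE u w) (hvw : FaceLE v w)
    (h : ∀ k ∈ freeCols n w, colAvg w u k = colAvg w v k) : u = v := by
  have key : ∀ k, ∀ i, u i k = v i k := by
    intro k
    induction k using Nat.strong_induction_on with
    | _ k ih =>
    by_cases hkn : k < n
    swap
    · intro i; rw [hu.support i k (by omega), hv.support i k (by omega)]
    by_cases hM : (freeRows w k).Nonempty
    swap
    · intro i
      by_cases hik : i < k
      swap
      · rw [hu.support i k (by omega), hv.support i k (by omega)]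
      have : i ∉ freeRows w k := fun hi => hM ⟨i, hi⟩
      rw [mem_freeRows] at this
      by_cases h0 : w i k = 0
      · rw [(huw i k).1 h0, (hvw i k).1 h0]
      · have h1 : w i k = 1 := by by_contra h1; exact this ⟨hik, h0, h1⟩
        rw [(huw i k).2 h1, (hvw i k).2 h1]
    have hs := h k (mem_freeCols.2 ⟨hkn, hM⟩)
    have hc : ((freeRows w k).card : ℝ) ≠ 0 := by exact_mod_cast hM.card_ne_zero
    simp only [colAvg] at hs
    rw [div_left_inj' hc] at hs
    -- comparability
    have comp : ∀ i j, i < j → j < k → (u i k < v i k → u j k ≤ v j k) ∧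
        (v i k < u i k → v j k ≤ u j k) ∧ (u j k < v j k → u i k ≤ v i k) ∧
        (v j k < u j k → v i k ≤ u i k) := by
      intro i j hij hjk
      obtain ⟨k, rfl⟩ : ∃ k', k = k' + 1 := ⟨k - 1, by omega⟩
      have e1 := hu.col hij (by omega : j ≤ k) hkn
      have e2 := hv.col hij (by omega : j ≤ k) hkn
      -- The factor between the odds of two rows involves only earlier columns, where `u` and `v`
      -- agree by induction.
      have er : relPos u i j k = relPos v i j k :=
        Finset.prod_congr rfl fun l hl => ih l (by simp at hl; omega) i
      rw [er] at e1
      have hr0 : 0 ≤ 1 - relPos v i j k := by linarith [hv.relPos_le_one i j k]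
      set r := 1 - relPos v i j k
      have a0 := hu.nonneg i (k+1); have a1 := hu.le_one i (k+1)
      have b0 := hu.nonneg j (k+1); have b1 := hu.le_one j (k+1)
      have c0 := hv.nonneg i (k+1); have c1 := hv.le_one i (k+1)
      have d0 := hv.nonneg j (k+1); have d1 := hv.le_one j (k+1)
      -- The two equations say that the odds of `b` and `d` are `r` times those of `a` and `c`, with
      -- the same `r ≥ 0`. So the two rows cannot move strictly in opposite directions.
      have gen : ∀ a b c d : ℝ, 0 ≤ a → a ≤ 1 → 0 ≤ b → b ≤ 1 → 0 ≤ c → c ≤ 1 → 0 ≤ d → d ≤ 1 →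
          (1 - a) * b = r * (1 - b) * a → (1 - c) * d = r * (1 - d) * c → a < c → d < b →
          False := by
        intro a b c d ha0 ha1 hb0 hb1 hc0 hc1 hd0 hd1 h1 h2 hac hdb
        have hca : 0 < c := by linarith
        have ha' : 0 < 1 - a := by linarith
        have hb' : 0 < b := by linarith
        have hd' : 0 < 1 - d := by linarith
        -- r(1-b)a = (1-a)b > 0 gives r>0
        have p1 : 0 < r * (1 - b) * a := by rw [← h1]; positivity
        have hr : 0 < r := by
          rcases hr0.lt_or_eq with h | h
          · exact h
          · rw [← h] at p1; simp at p1
        have p2 : 0 < (1 - c) * d := by rw [h2]; positivity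
        have hd2 : 0 < d := by
          rcases hd0.lt_or_eq with h | h
          · exact h
          · rw [← h] at p2; simp at p2
        have hb2 : 0 < 1 - b := by
          by_contra hh
          have : 1 - b = 0 := by linarith
          rw [this] at p1; simp at p1
        have q1 : (1 - c) * d < (1 - a) * b := by
          calc (1 - c) * d ≤ (1 - a) * d := by gcongr
            _ < (1 - a) * b := by gcongr
        have q2 : r * (1 - b) * a < r * (1 - d) * c := by
          have : (1 - b) * a < (1 - d) * c := by
            calc (1 - b) * a ≤ (1 - b) * c := by gcongr
              _ < (1 - d) * c := by gcongr
          calc r * (1 - b) * a = r * ((1 - b) * a) := by ring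
            _ < r * ((1 - d) * c) := by gcongr
            _ = _ := by ring
        linarith
      refine ⟨fun hl => ?_, fun hl => ?_, fun hl => ?_, fun hl => ?_⟩ <;> by_contra hh <;>
        push Not at hh
      · exact gen _ _ _ _ a0 a1 b0 b1 c0 c1 d0 d1 e1 e2 hl hh
      · exact gen _ _ _ _ c0 c1 d0 d1 a0 a1 b0 b1 e2 e1 hl hh
      · exact gen _ _ _ _ c0 c1 d0 d1 a0 a1 b0 b1 e2 e1 hh hl
      · exact gen _ _ _ _ a0 a1 b0 b1 c0 c1 d0 d1 e1 e2 hh hl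
    have comp' : ∀ i ∈ freeRows w k, ∀ j ∈ freeRows w k, u i k < v i k → u j k ≤ v j k := by
      intro i hi j hj hl
      rw [mem_freeRows] at hi hj
      rcases lt_trichotomy i j with h | h | h
      · exact (comp i j h hj.1).1 hl
      · subst h; exact hl.le
      · exact (comp j i h hi.1).2.2.1 hl
    -- All differences on the free rows have the same sign and their sum is zero, so each of them
    -- vanishes.
    have all_eq : ∀ i ∈ freeRows w k, u i k = v i k := by
      by_cases hle : ∀ j ∈ freeRows w k, u j k ≤ v j k
      · exact (Finset.sum_eq_sum_iff_of_le hle).1 hs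
      · push Not at hle
        obtain ⟨j, hj, hlt⟩ := hle
        have hge : ∀ i ∈ freeRows w k, v i k ≤ u i k := by
          intro i hi
          by_contra hh
          push Not at hh
          exact absurd (comp' i hi j hj hh) (not_le.2 hlt)
        intro i hi
        exact ((Finset.sum_eq_sum_iff_of_le hge).1 hs.symm i hi).symm
    intro i
    by_cases hi : i ∈ freeRows w k
    · exact all_eq i hi
    by_cases hik : i < k
    swap
    · rw [hu.support i k (by omega), hv.support i k (by omega)]
    rw [mem_freeRows] at hi
    by_cases h0 : w i k = 0
    · rw [(huw i k).1 h0, (hvw i k).1 h0]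
    · have h1 : w i k = 1 := by by_contra h1; exact hi ⟨hik, h0, h1⟩
      rw [(huw i k).2 h1, (hvw i k).2 h1]
  funext i k
  exact key k i

end

/-! ### Interiors of faces: averages strictly between zero and one -/

section

lemma IsRatio.relPos_le (h : IsRatio n u) {i j k l : ℕ} (hj : j < l) (hl : l ≤ k) :
    relPos u i j k ≤ u i l := by
  have hm : l ∈ Finset.Ioc j k := by simp [hj, hl]
  rw [relPos, ← Finset.mul_prod_erase _ _ hm]
  exact mul_le_of_le_one_right (h.nonneg _ _)
    (Finset.prod_le_one (fun _ _ => h.nonneg _ _) fun _ _ => h.le_one _ _)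

lemma IsRatio.relPos_eq_one_iff (h : IsRatio n u) {i j k : ℕ} :
    relPos u i j k = 1 ↔ ∀ l, j < l → l ≤ k → u i l = 1 := by
  constructor
  · intro he l hj hl
    have := h.relPos_le hj hl (i := i)
    linarith [h.le_one i l]
  · intro he
    exact Finset.prod_eq_one fun l hl => by
      simp only [Finset.mem_Ioc] at hl
      exact he l hl.1 hl.2

lemma IsRatio.mem_Ioo {n : ℕ} {w : ℕ → ℕ → ℝ} (hw : IsRatio n w) {i k : ℕ}
    (hi : i ∈ freeRows w k) : 0 < w i k ∧ w i k < 1 := by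
  rw [mem_freeRows] at hi
  exact ⟨(hw.nonneg i k).lt_of_ne' hi.2.1, (hw.le_one i k).lt_of_ne hi.2.2⟩

lemma colAvg_mem_Ioo {w u : ℕ → ℕ → ℝ} {k : ℕ} (hM : (freeRows w k).Nonempty)
    (h : ∀ i ∈ freeRows w k, 0 < u i k ∧ u i k < 1) :
    0 < colAvg w u k ∧ colAvg w u k < 1 := by
  have hc : (0 : ℝ) < (freeRows w k).card := by exact_mod_cast hM.card_pos
  unfold colAvg
  constructor
  · exact div_pos (Finset.sum_pos (fun i hi => (h i hi).1) hM) hc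
  · rw [div_lt_one hc]
    calc ∑ i ∈ freeRows w k, u i k < ∑ i ∈ freeRows w k, (1 : ℝ) :=
          Finset.sum_lt_sum_of_nonempty hM fun i hi => (h i hi).2
      _ = _ := by simp

lemma colAvg_mem_Icc {n : ℕ} {w u : ℕ → ℕ → ℝ} (hu : IsRatio n u) (k : ℕ) :
    0 ≤ colAvg w u k ∧ colAvg w u k ≤ 1 := by
  unfold colAvg
  constructor
  · exact div_nonneg (Finset.sum_nonneg fun i _ => hu.nonneg i k) (Nat.cast_nonneg _)
  · refine div_le_one_of_le₀ ?_ (Nat.cast_nonneg _)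
    calc ∑ i ∈ freeRows w k, u i k ≤ ∑ i ∈ freeRows w k, (1 : ℝ) :=
          Finset.sum_le_sum fun i _ => hu.le_one i k
      _ = _ := by simp

lemma colAvg_const {w u : ℕ → ℕ → ℝ} {k : ℕ} (hM : (freeRows w k).Nonempty) {c : ℝ}
    (h : ∀ i ∈ freeRows w k, u i k = c) : colAvg w u k = c := by
  have hc : ((freeRows w k).card : ℝ) ≠ 0 := by exact_mod_cast hM.card_ne_zero
  unfold colAvg
  rw [Finset.sum_congr rfl h, Finset.sum_const, nsmul_eq_mul]
  field_simp

/-- Between free rows of a column the ratio of odds is positive. -/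
lemma relPos_ne_one_of_free {n : ℕ} {w : ℕ → ℕ → ℝ} (hw : IsRatio n w) {i j k : ℕ}
    (hij : i < j) (hjk : j ≤ k) (hk : k + 1 < n) (hi : i ∈ freeRows w (k + 1))
    (hj : j ∈ freeRows w (k + 1)) : relPos w i j k ≠ 1 := by
  intro h
  have e := hw.col hij hjk hk
  rw [h] at e
  have := hw.mem_Ioo hi
  have := hw.mem_Ioo hj
  have : 0 < (1 - w i (k + 1)) * w j (k + 1) := mul_pos (by linarith) (by linarith)
  simp at e
  rcases e with e | e <;> linarith

/-- The odds of the two entries differ by the factor `1 - relPos u i j k`. Being nonzero, it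
preserves odds equal to zero or infinity. -/
lemma IsRatio.entry_transfer {n : ℕ} {u : ℕ → ℕ → ℝ} (hu : IsRatio n u) {i j k : ℕ}
    (hij : i < j) (hjk : j ≤ k) (hk : k + 1 < n) (hr : relPos u i j k ≠ 1) :
    (u i (k + 1) = 0 ↔ u j (k + 1) = 0) ∧ (u i (k + 1) = 1 ↔ u j (k + 1) = 1) := by
  have e := hu.col hij hjk hk
  have hr' : 1 - relPos u i j k ≠ 0 := sub_ne_zero.2 hr.symm
  refine ⟨⟨fun h => ?_, fun h => ?_⟩, ⟨fun h => ?_, fun h => ?_⟩⟩ <;> rw [h] at e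
  · simpa using e
  · simpa [hr'] using e.symm
  · simp [hr'] at e; linarith
  · simp at e; linarith

/-- Averages strictly between `0` and `1` detect the type of the columns below `m`. -/
lemma type_of_colAvg {n m : ℕ} {w u : ℕ → ℕ → ℝ} (hw : IsRatio n w) (hu : IsRatio n u)
    (huw : FaceLE u w)
    (h : ∀ k ∈ freeCols n w, k < m → 0 < colAvg w u k ∧ colAvg w u k < 1) :
    ∀ k < m, ∀ i, (u i k = 0 → w i k = 0) ∧ (u i k = 1 → w i k = 1) := by
    intro k
    induction k using Nat.strong_induction_on with
    | _ k ih =>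
    intro hkm i
    -- Only the free rows of `w` need an argument: elsewhere the entry of `u` is forced by the face
    -- relation or the support.
    have red : (i ∈ freeRows w k → u i k ≠ 0 ∧ u i k ≠ 1) →
        (u i k = 0 → w i k = 0) ∧ (u i k = 1 → w i k = 1) := by
      intro hf
      by_cases hik : i < k
      swap
      · simp [hu.support i k (by omega), hw.support i k (by omega)]
      by_cases h0 : w i k = 0
      · simp [h0, (huw i k).1 h0]
      by_cases h1 : w i k = 1
      · simp [h1, (huw i k).2 h1]
      have := hf (mem_freeRows.2 ⟨hik, h0, h1⟩)
      exact ⟨fun h => absurd h this.1, fun h => absurd h this.2⟩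
    refine red fun hi => ?_
    have hik := (mem_freeRows.1 hi).1
    obtain ⟨k, rfl⟩ : ∃ k', k = k' + 1 := ⟨k - 1, by omega⟩
    have hkn : k + 1 < n := by
      by_contra hh
      exact (mem_freeRows.1 hi).2.1 (hw.support _ _ (by omega))
    have hM : (freeRows w (k + 1)).Nonempty := ⟨i, hi⟩
    have havg := h (k + 1) (mem_freeCols.2 ⟨hkn, hM⟩) hkm
    have hr : ∀ a ∈ freeRows w (k + 1), ∀ b ∈ freeRows w (k + 1), a < b →
        (u a (k + 1) = 0 ↔ u b (k + 1) = 0) ∧ (u a (k + 1) = 1 ↔ u b (k + 1) = 1) := by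
      intro a ha b hb hab
      have hbk := (mem_freeRows.1 hb).1
      refine hu.entry_transfer hab (by omega) hkn fun hone => ?_
      refine relPos_ne_one_of_free hw hab (by omega) hkn ha hb ?_
      rw [hu.relPos_eq_one_iff] at hone
      rw [hw.relPos_eq_one_iff]
      exact fun l h1 h2 => (ih l (by omega) (by omega) a).2 (hone l h1 h2)
    -- A `0` or `1` in one free row spreads to all of them and would make the average `0` or `1`.
    have hr' : ∀ b ∈ freeRows w (k + 1),
        (u i (k + 1) = 0 → u b (k + 1) = 0) ∧ (u i (k + 1) = 1 → u b (k + 1) = 1) := by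
      intro b hb
      rcases lt_trichotomy i b with hl | hl | hl
      · exact ⟨(hr i hi b hb hl).1.1, (hr i hi b hb hl).2.1⟩
      · subst hl; exact ⟨id, id⟩
      · exact ⟨(hr b hb i hi hl).1.2, (hr b hb i hi hl).2.2⟩
    constructor
    · intro h0
      have := colAvg_const hM (u := u) fun b hb => (hr' b hb).1 h0
      linarith
    · intro h1
      have := colAvg_const hM (u := u) fun b hb => (hr' b hb).2 h1
      linarith

/-- The interior of a face, in terms of the averages. -/
lemma faceLE_of_colAvg {n : ℕ} {w u : ℕ → ℕ → ℝ} (hw : IsRatio n w) (hu : IsRatio n u)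
    (huw : FaceLE u w) (h : ∀ k ∈ freeCols n w, 0 < colAvg w u k ∧ colAvg w u k < 1) :
    FaceLE w u := fun i k =>
  type_of_colAvg (m := k + 1) hw hu huw (fun k hk _ => h k hk) k (Nat.lt_succ_self k) i

lemma faceLE_iff_colAvg {n : ℕ} {w u : ℕ → ℕ → ℝ} (hw : IsRatio n w) (hu : IsRatio n u)
    (huw : FaceLE u w) :
    FaceLE w u ↔ ∀ k ∈ freeCols n w, 0 < colAvg w u k ∧ colAvg w u k < 1 := by
  refine ⟨fun h k hk => ?_, faceLE_of_colAvg hw hu huw⟩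
  refine colAvg_mem_Ioo (mem_freeCols.1 hk).2 fun i hi => ?_
  exact hu.mem_Ioo (freeRows_subset h k hi)

/-- A column `r i * v / (1 - v + r i * v)` with prescribed average. -/
lemma exists_odds {M : Finset ℕ} (hM : M.Nonempty) {r : ℕ → ℝ} (hr : ∀ i ∈ M, 0 < r i)
    {t : ℝ} (ht0 : 0 < t) (ht1 : t < 1) :
    ∃ v, 0 < v ∧ v < 1 ∧ (∑ i ∈ M, r i * v / (1 - v + r i * v)) / M.card = t := by
  have hc : (M.card : ℝ) ≠ 0 := by exact_mod_cast hM.card_ne_zero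
  -- Each summand has odds `r i` times the odds of `v`. In this form it is still defined at `v = 1`,
  -- so the intermediate value theorem applies between `g 0 = 0` and `g 1 = 1`.
  set g : ℝ → ℝ := fun v => (∑ i ∈ M, r i * v / (1 - v + r i * v)) / M.card with hg
  have hden : ∀ i ∈ M, ∀ v ∈ Icc (0 : ℝ) 1, 1 - v + r i * v ≠ 0 := by
    intro i hi v hv
    have h1 := hr i hi
    rcases hv.2.lt_or_eq with h | h
    · have : 0 ≤ r i * v := mul_nonneg h1.le hv.1
      intro h2; linarith
    · subst h; intro h2; simp at h2; linarith
  have hcont : ContinuousOn g (Icc 0 1) := by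
    refine ContinuousOn.div_const (continuousOn_finsetSum _ fun i hi => ?_) _
    exact ContinuousOn.div (by fun_prop) (by fun_prop) (hden i hi)
  have g0 : g 0 = 0 := by simp [hg]
  have g1 : g 1 = 1 := by
    have : ∀ i ∈ M, r i * 1 / (1 - 1 + r i * 1) = 1 := fun i hi => by
      have := (hr i hi).ne'
      simp [this]
    simp only [hg]
    rw [Finset.sum_congr rfl this]
    simp [hc]
  obtain ⟨v, hv, hvt⟩ := intermediate_value_Icc zero_le_one hcont
    (show t ∈ Icc (g 0) (g 1) by rw [g0, g1]; exact ⟨ht0.le, ht1.le⟩)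
  refine ⟨v, hv.1.lt_of_ne ?_, hv.2.lt_of_ne ?_, hvt⟩
  · rintro rfl; rw [g0] at hvt; linarith
  · rintro rfl; rw [g1] at hvt; linarith

lemma relPos_congr {u v : ℕ → ℕ → ℝ} {i j k : ℕ} (h : ∀ l, j < l → l ≤ k → u i l = v i l) :
    relPos u i j k = relPos v i j k :=
  Finset.prod_congr rfl fun l hl => by
    simp only [Finset.mem_Ioc] at hl
    exact h l hl.1 hl.2

/-- Appending a column to a ratio matrix. -/
lemma IsRatio.append {m : ℕ} {u : ℕ → ℕ → ℝ} (hu : IsRatio m u) {c : ℕ → ℝ}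
    (c0 : ∀ i, 0 ≤ c i) (c1 : ∀ i, c i ≤ 1) (cs : ∀ i, m ≤ i + 1 → c i = 0)
    (hc : ∀ i j, i < j → j + 1 ≤ m →
      (1 - c i) * c j = (1 - relPos u i j (m - 1)) * (1 - c j) * c i) :
    IsRatio (m + 1) (fun i k => if k = m then c i else u i k) where
  nonneg i k := by
    show 0 ≤ if k = m then c i else u i k
    split_ifs
    exacts [c0 i, hu.nonneg i k]
  le_one i k := by
    show (if k = m then c i else u i k) ≤ 1
    split_ifs
    exacts [c1 i, hu.le_one i k]
  support i k h := by
    show (if k = m then c i else u i k) = 0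
    split_ifs with hk
    · exact cs i (by omega)
    · exact hu.support i k (by omega)
  diag i := by
    show (if i + 1 = m then c i else u i (i + 1)) = 0
    split_ifs with hk
    · exact cs i (by omega)
    · exact hu.diag i
  rel i j k hij hjk hk := by
    have hP : ∀ k', k' < m → relPos (fun i k => if k = m then c i else u i k) i j k'
        = relPos u i j k' := fun k' hk' =>
      relPos_congr fun l _ h2 => if_neg (by omega)
    by_cases hkm : k = m
    · obtain ⟨m', rfl⟩ : ∃ m', m = m' + 1 := ⟨m - 1, by omega⟩
      subst hkm
      rw [relPos_succ _ _ (by omega), hP _ (by omega)]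
      simp only [if_true]
      exact rel_of_col (hc i j hij (by omega))
    · rw [hP k (by omega)]
      simp only [if_neg hkm]
      exact hu.rel i j k hij hjk (by omega)

/-- The columns are built one after another. Fixed entries are copied from `w`; the free entries of
a new column must have odds in prescribed proportions, and the remaining parameter is tuned by
`exists_odds` to give the required average. -/
lemma exists_of_colAvg {n : ℕ} {w : ℕ → ℕ → ℝ} (hw : IsRatio n w) {t : ℕ → ℝ}
    (ht : ∀ k, 0 < t k ∧ t k < 1) :
    ∃ u, IsRatio n u ∧ FaceLE u w ∧ FaceLE w u ∧
      ∀ k ∈ freeCols n w, colAvg w u k = t k := by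
  have key : ∀ m ≤ n, ∃ u, IsRatio m u ∧
      (∀ i k, k < m → (u i k = 0 ↔ w i k = 0) ∧ (u i k = 1 ↔ w i k = 1)) ∧
      ∀ k < m, (freeRows w k).Nonempty → colAvg w u k = t k := by
    intro m
    induction m with
    | zero =>
      intro _
      exact ⟨fun _ _ => 0, ⟨by simp, by simp, by simp, by simp, fun _ _ _ _ _ h => by omega⟩,
        by simp, by simp⟩
    | succ m ih =>
      intro hm
      obtain ⟨u, hu, hty, hav⟩ := ih (by omega)
      have hP1 : ∀ i j, relPos u i j (m - 1) = 1 ↔ relPos w i j (m - 1) = 1 := by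
        intro i j
        rw [hu.relPos_eq_one_iff, hw.relPos_eq_one_iff]
        by_cases hm0 : m = 0
        · subst hm0; exact ⟨fun _ l h1 h2 => by omega, fun _ l h1 h2 => by omega⟩
        · exact forall_congr' fun l => forall_congr' fun _ => forall_congr' fun h2 =>
            (hty i l (by omega)).2
      have hwcol : ∀ i j, i < j → j + 1 ≤ m →
          (1 - w i m) * w j m = (1 - relPos w i j (m - 1)) * (1 - w j m) * w i m := by
        intro i j hij hj
        obtain ⟨m', rfl⟩ : ∃ m', m = m' + 1 := ⟨m - 1, by omega⟩
        exact hw.col hij (by omega) (by omega)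
      have hne : ∀ i ∈ freeRows w m, ∀ j ∈ freeRows w m, i < j → relPos w i j (m - 1) ≠ 1 := by
        intro i hi j hj hij
        have := (mem_freeRows.1 hj).1
        obtain ⟨m', rfl⟩ : ∃ m', m = m' + 1 := ⟨m - 1, by omega⟩
        exact relPos_ne_one_of_free hw hij (by omega) (by omega) hi hj
      -- it suffices to choose the free part of the column
      suffices hcol : ∃ c : ℕ → ℝ, (∀ i ∈ freeRows w m, 0 < c i ∧ c i < 1) ∧
          (∀ i, i ∉ freeRows w m → c i = w i m) ∧
          (∀ i ∈ freeRows w m, ∀ j ∈ freeRows w m, i < j →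
            (1 - c i) * c j = (1 - relPos u i j (m - 1)) * (1 - c j) * c i) ∧
          ((freeRows w m).Nonempty → (∑ i ∈ freeRows w m, c i) / (freeRows w m).card = t m) by
        obtain ⟨c, hc1, hc2, hc3, hc4⟩ := hcol
        have hfix : ∀ i, i ∉ freeRows w m → w i m = 0 ∨ w i m = 1 := by
          intro i hi
          by_cases him : i < m
          · rw [mem_freeRows] at hi
            by_contra hh
            push Not at hh
            exact hi ⟨him, hh.1, hh.2⟩
          · exact Or.inl (hw.support _ _ (by omega))
        have hty' : ∀ i, (c i = 0 ↔ w i m = 0) ∧ (c i = 1 ↔ w i m = 1) := by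
          intro i
          by_cases hi : i ∈ freeRows w m
          · have h1 := hc1 i hi
            have h2 := hw.mem_Ioo hi
            exact ⟨⟨fun h => by linarith, fun h => by linarith⟩,
              ⟨fun h => by linarith, fun h => by linarith⟩⟩
          · rw [hc2 i hi]; exact ⟨Iff.rfl, Iff.rfl⟩
        refine ⟨fun i k => if k = m then c i else u i k, hu.append ?_ ?_ ?_ ?_, ?_, ?_⟩
        · intro i
          by_cases hi : i ∈ freeRows w m
          · exact (hc1 i hi).1.le
          · rw [hc2 i hi]; exact hw.nonneg _ _
        · intro i
          by_cases hi : i ∈ freeRows w m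
          · exact (hc1 i hi).2.le
          · rw [hc2 i hi]; exact hw.le_one _ _
        · intro i hi
          rw [(hty' i).1]
          by_cases h : i + 1 = m
          · rw [← h]; exact hw.diag i
          · exact hw.support _ _ (by omega)
        · intro i j hij hj
          -- If the factor of the odds vanishes, the relation only says that the upper entry is `1`
          -- or the lower one is `0`, which is inherited from `w`. Otherwise the relation for `w`
          -- rules out one free and one fixed entry, and also two different fixed entries.
          by_cases h1 : relPos w i j (m - 1) = 1
          · have e := hwcol i j hij hj
            rw [(hP1 i j).2 h1]
            rw [h1] at e
            simp only [sub_self, zero_mul, mul_eq_zero] at e ⊢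
            rcases e with e | e
            · left; rw [(hty' i).2.2 (by linarith)]; simp
            · right; exact (hty' j).1.2 e
          · have e := hwcol i j hij hj
            have h1' : 1 - relPos w i j (m - 1) ≠ 0 := sub_ne_zero.2 (Ne.symm h1)
            by_cases hi : i ∈ freeRows w m <;> by_cases hjM : j ∈ freeRows w m
            · exact hc3 i hi j hjM hij
            · exfalso
              have hh := hw.mem_Ioo hi
              rcases hfix j hjM with h0 | h0 <;> rw [h0] at e
              · simp [h1'] at e; linarith
              · simp at e; linarith
            · exfalso
              have hh := hw.mem_Ioo hjM
              rcases hfix i hi with h0 | h0 <;> rw [h0] at e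
              · simp at e; linarith
              · simp [h1'] at e; linarith
            · rw [hc2 i hi, hc2 j hjM]
              rcases hfix i hi with h0 | h0 <;> rcases hfix j hjM with h2 | h2 <;>
                (rw [h0, h2] at e; rw [h0, h2]; simp at e ⊢) <;> exact (h1' e.symm).elim
        · intro i k hk
          by_cases hkm : k = m
          · subst hkm; simpa using hty' i
          · simpa [hkm] using hty i k (by omega)
        · intro k hk hM
          by_cases hkm : k = m
          · subst hkm
            simpa [colAvg] using hc4 hM
          · simpa [colAvg, hkm] using hav k (by omega) hM
      by_cases hM : (freeRows w m).Nonempty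
      swap
      · rw [Finset.not_nonempty_iff_eq_empty] at hM
        exact ⟨fun i => w i m, by simp [hM], by simp, by simp [hM], by simp [hM]⟩
      -- All odds are measured against those of the first free row; `r i` is the resulting factor,
      -- positive because free rows never have normalised position `1` relative to each other.
      set i0 := (freeRows w m).min' hM with hi0
      have hi0M : i0 ∈ freeRows w m := Finset.min'_mem _ _
      have hi0m := (mem_freeRows.1 hi0M).1
      have hi0m' : i0 < m - 1 := by
        by_contra hh
        have : m = i0 + 1 := by omega
        have h2 := (mem_freeRows.1 hi0M).2.1
        rw [this] at h2
        exact h2 (hw.diag i0)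
      set r : ℕ → ℝ := fun i => 1 - relPos u i0 i (m - 1) with hr
      have hlt : ∀ i ∈ freeRows w m, i ≠ i0 → i0 < i := fun i hi h =>
        lt_of_le_of_ne (Finset.min'_le _ _ hi) (Ne.symm h)
      have hrpos : ∀ i ∈ freeRows w m, 0 < r i := by
        intro i hi
        by_cases h : i = i0
        · subst h; simp [hr, hu.relPos_left hi0m']
        · have h1 := hne i0 hi0M i hi (hlt i hi h)
          rw [Ne, ← hP1] at h1
          have := (hu.relPos_le_one i0 i (m - 1)).lt_of_ne h1
          simp only [hr]; linarith
      obtain ⟨v, hv0, hv1, hvt⟩ := exists_odds hM hrpos (ht m).1 (ht m).2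
      have hdpos : ∀ i ∈ freeRows w m, 0 < 1 - v + r i * v := fun i hi => by
        have := mul_pos (hrpos i hi) hv0
        linarith
      classical
      refine ⟨fun i => if i ∈ freeRows w m then r i * v / (1 - v + r i * v) else w i m,
        ?_, ?_, ?_, ?_⟩
      · intro i hi
        have := mul_pos (hrpos i hi) hv0
        simp only [if_pos hi]
        refine ⟨div_pos this (hdpos i hi), ?_⟩
        rw [div_lt_one (hdpos i hi)]
        linarith
      · intro i hi; simp only [if_neg hi]
      · intro i hi j hj hij
        simp only [if_pos hi, if_pos hj]
        -- The factors relative to `i0` are multiplicative by the restriction formula, so the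
        -- relation with `i0` implies the relation between any two free rows.
        have hri : r j = r i * (1 - relPos u i j (m - 1)) := by
          by_cases h : i = i0
          · rw [h]; simp [hr, hu.relPos_left hi0m']
          · have hjm := (mem_freeRows.1 hj).1
            have := hu.relPos_sub (hlt i hi h) hij.le (by omega : j ≤ m - 1) (by omega)
              (by omega : i < m - 1)
            simp only [hr]
            linear_combination (-1 : ℝ) * this
        have h1 := (hdpos i hi).ne'
        have h2 := (hdpos j hj).ne'
        have e1 : 1 - r i * v / (1 - v + r i * v) = (1 - v) / (1 - v + r i * v) := by
          field_simp; ring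
        have e2 : 1 - r j * v / (1 - v + r j * v) = (1 - v) / (1 - v + r j * v) := by
          field_simp; ring
        rw [e1, e2]
        have e3 : r j * v / (1 - v + r j * v)
            = (1 - relPos u i j (m - 1)) * (r i * v) * (1 / (1 - v + r j * v)) := by
          rw [mul_one_div]; congr 1; rw [hri]; ring
        rw [e3]; ring
      · intro _
        rw [← hvt]
        congr 1
        exact Finset.sum_congr rfl fun i hi => if_pos hi
  obtain ⟨u, hu, hty, hav⟩ := key n le_rfl
  have hsup : ∀ i k, ¬ k < n → u i k = 0 ∧ w i k = 0 := fun i k hk =>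
    ⟨hu.support _ _ (by omega), hw.support _ _ (by omega)⟩
  refine ⟨u, hu, fun i k => ?_, fun i k => ?_, fun k hk => ?_⟩
  · by_cases hk : k < n
    · exact ⟨(hty i k hk).1.2, (hty i k hk).2.2⟩
    · simp [hsup i k hk]
  · by_cases hk : k < n
    · exact ⟨(hty i k hk).1.1, (hty i k hk).2.1⟩
    · simp [hsup i k hk]
  · rw [mem_freeCols] at hk
    exact hav k hk.1 hk.2

end

section

/-! ### Faces are cubes -/

/-- `φ` embeds the closed unit cube onto `F` and the open unit cube onto `C`. -/
structure IsCellMap {X : Type*} [TopologicalSpace X] {d : ℕ} (φ : (Fin d → ℝ) → X)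
    (F C : Set X) : Prop where
  continuousOn : ContinuousOn φ (Metric.closedBall 0 1)
  injOn : InjOn φ (Metric.closedBall 0 1)
  image_closedBall : φ '' Metric.closedBall 0 1 = F
  image_ball : φ '' Metric.ball 0 1 = C

lemma IsCellMap.comp {X Y : Type*} [TopologicalSpace X] [TopologicalSpace Y] {d : ℕ}
    {φ : (Fin d → ℝ) → X} {F C : Set X} (h : IsCellMap φ F C) {f : X → Y} (hf : ContinuousOn f F)
    (hi : InjOn f F) : IsCellMap (f ∘ φ) (f '' F) (f '' C) where
  continuousOn := hf.comp h.continuousOn (by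
    rw [← h.image_closedBall]; exact mapsTo_image _ _)
  injOn := hi.comp h.injOn (by rw [← h.image_closedBall]; exact mapsTo_image _ _)
  image_closedBall := by rw [image_comp, h.image_closedBall]
  image_ball := by rw [image_comp, h.image_ball]

lemma IsCellMap.subset {X : Type*} [TopologicalSpace X] {d : ℕ}
    {φ : (Fin d → ℝ) → X} {F C : Set X} (h : IsCellMap φ F C) : C ⊆ F := by
  rw [← h.image_ball, ← h.image_closedBall]
  exact image_mono Metric.ball_subset_closedBall

lemma IsCellMap.isCompact {X : Type*} [TopologicalSpace X] {d : ℕ}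
    {φ : (Fin d → ℝ) → X} {F C : Set X} (h : IsCellMap φ F C) : IsCompact F := by
  rw [← h.image_closedBall]
  exact (isCompact_closedBall _ _).image_of_continuousOn h.continuousOn

lemma IsCellMap.closure_eq {X : Type*} [TopologicalSpace X] [T2Space X] {d : ℕ}
    {φ : (Fin d → ℝ) → X} {F C : Set X} (h : IsCellMap φ F C) : closure C = F := by
  refine Subset.antisymm (closure_minimal h.subset h.isCompact.isClosed) ?_
  rw [← h.image_ball, ← h.image_closedBall, ← closure_ball (0 : Fin d → ℝ) one_ne_zero]
  refine ContinuousOn.image_closure ?_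
  rw [closure_ball _ one_ne_zero]
  exact h.continuousOn

/-- Used for the inverses of cubical charts and for the inverses of the characteristic maps of a CW
complex. -/
lemma continuousOn_invFunOn {X Y : Type*} [TopologicalSpace X] [TopologicalSpace Y] [Nonempty X]
    {F : Set X} {e : X → Y} (he : IsEmbedding (F.domRestrict e)) (hi : InjOn e F) :
    ContinuousOn (Function.invFunOn e F) (e '' F) := by
  have hl : ∀ x ∈ F, Function.invFunOn e F (e x) = x := fun x hx => hi.leftInvOn_invFunOn hx
  rw [continuousOn_iff_continuous_domRestrict]
  have hr2 : e '' F = range (F.domRestrict e) := by rw [range_domRestrict]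
  have h1 := continuous_subtype_val.comp (he.toHomeomorph.symm.continuous)
  have h2 : ∀ z : e '' F, (e '' F).domRestrict (Function.invFunOn e F) z =
      (Subtype.val ∘ he.toHomeomorph.symm) (⟨z.1, hr2 ▸ z.2⟩ :
        range (F.domRestrict e)) := by
    rintro ⟨_, x, hx, rfl⟩
    have : he.toHomeomorph.symm ⟨e x, ⟨⟨x, hx⟩, rfl⟩⟩ = ⟨x, hx⟩ := by
      rw [Homeomorph.symm_apply_eq]; rfl
    simp only [domRestrict_apply, Function.comp_apply, hl x hx]
    rw [this]
  refine Continuous.congr (f := fun z : e '' F => (Subtype.val ∘ he.toHomeomorph.symm)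
    (⟨z.1, hr2 ▸ z.2⟩ : range (F.domRestrict e))) ?_ fun z => (h2 z).symm
  exact h1.comp (by fun_prop)

/-- A continuous injection of a compact set onto the closed cube is inverse to a cell map. -/
lemma IsCellMap.of_chart {X : Type*} [TopologicalSpace X] {d : ℕ} {F : Set X}
    [Nonempty X] (hF : IsCompact F) {e : X → Fin d → ℝ} (he : ContinuousOn e F) (hi : InjOn e F)
    (hr : e '' F = Metric.closedBall 0 1) :
    ∃ φ : (Fin d → ℝ) → X, IsCellMap φ F {x ∈ F | e x ∈ Metric.ball 0 1} := by
  have : CompactSpace F := isCompact_iff_compactSpace.1 hF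
  have hc : Continuous (F.domRestrict e) := continuousOn_iff_continuous_domRestrict.1 he
  have hce : IsClosedEmbedding (F.domRestrict e) :=
    hc.isClosedEmbedding (injOn_iff_injective.1 hi)
  have hl : ∀ x ∈ F, Function.invFunOn e F (e x) = x := fun x hx => hi.leftInvOn_invFunOn hx
  refine ⟨Function.invFunOn e F, ?_, ?_, ?_, ?_⟩
  · rw [← hr]
    exact continuousOn_invFunOn hce.isEmbedding hi
  · rw [← hr]
    rintro _ ⟨x, hx, rfl⟩ _ ⟨y, hy, rfl⟩ h
    rw [hl x hx, hl y hy] at h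
    rw [h]
  · rw [← hr]
    ext y
    constructor
    · rintro ⟨_, ⟨x, hx, rfl⟩, rfl⟩; rwa [hl x hx]
    · exact fun hy => ⟨e y, ⟨y, hy, rfl⟩, hl y hy⟩
  · ext y
    constructor
    · rintro ⟨z, hz, rfl⟩
      have hz' : z ∈ e '' F := by rw [hr]; exact Metric.ball_subset_closedBall hz
      obtain ⟨x, hx, rfl⟩ := hz'
      rw [hl x hx]
      exact ⟨hx, hz⟩
    · rintro ⟨hy, hy2⟩
      exact ⟨e y, hy2, hl y hy⟩

lemma isClosed_setOf_isRatio (n : ℕ) : IsClosed {u | IsRatio n u} := by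
  have : {u | IsRatio n u} = {u : ℕ → ℕ → ℝ | (∀ i k, 0 ≤ u i k) ∧ (∀ i k, u i k ≤ 1) ∧
      (∀ i k, ¬ (i < k ∧ k < n) → u i k = 0) ∧ (∀ i, u i (i + 1) = 0) ∧
      ∀ i j k, i < j → j < k → k < n → 1 - u i k = (1 - u j k) * (1 - relPos u i j k)} := by
    ext u
    exact ⟨fun h => ⟨h.1, h.2, h.3, h.4, h.5⟩, fun h => ⟨h.1, h.2.1, h.2.2.1, h.2.2.2.1, h.2.2.2.2⟩⟩
  rw [this]
  simp only [ofPred_and, ofPred_forall]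
  have hc : ∀ i k, Continuous fun u : ℕ → ℕ → ℝ => u i k := fun i k => by fun_prop
  refine IsClosed.inter ?_ (IsClosed.inter ?_ (IsClosed.inter ?_ (IsClosed.inter ?_ ?_)))
  · exact isClosed_iInter fun i => isClosed_iInter fun k => isClosed_le continuous_const (hc i k)
  · exact isClosed_iInter fun i => isClosed_iInter fun k => isClosed_le (hc i k) continuous_const
  · exact isClosed_iInter fun i => isClosed_iInter fun k => isClosed_iInter fun _ =>
      isClosed_eq (hc i k) continuous_const
  · exact isClosed_iInter fun i => isClosed_eq (hc i _) continuous_const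
  · refine isClosed_iInter fun i => isClosed_iInter fun j => isClosed_iInter fun k =>
      isClosed_iInter fun _ => isClosed_iInter fun _ => isClosed_iInter fun _ => isClosed_eq ?_ ?_
    · fun_prop
    · unfold relPos; fun_prop

lemma isCompact_setOf_isRatio (n : ℕ) : IsCompact {u | IsRatio n u} := by
  have h : IsCompact (univ.pi fun _ : ℕ => univ.pi fun _ : ℕ => Icc (0 : ℝ) 1) :=
    isCompact_univ_pi fun _ => isCompact_univ_pi fun _ => isCompact_Icc
  exact h.of_isClosed_subset (isClosed_setOf_isRatio n) fun u hu i _ k _ =>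
    ⟨hu.nonneg i k, hu.le_one i k⟩

/-- The face of `w`. -/
def ratioFace (n : ℕ) (w : ℕ → ℕ → ℝ) : Set (ℕ → ℕ → ℝ) := {u | IsRatio n u ∧ FaceLE u w}

lemma isCompact_ratioFace (n : ℕ) (w : ℕ → ℕ → ℝ) : IsCompact (ratioFace n w) := by
  refine (isCompact_setOf_isRatio n).inter_right (t := {u | FaceLE u w}) ?_
  simp only [FaceLE, ofPred_forall, ofPred_and]
  exact isClosed_iInter fun i => isClosed_iInter fun k =>
    (isClosed_iInter fun _ => isClosed_eq (by fun_prop) continuous_const).inter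
      (isClosed_iInter fun _ => isClosed_eq (by fun_prop) continuous_const)

/-- The cubical coordinates of a face. -/
def faceCoord (n : ℕ) (w u : ℕ → ℕ → ℝ) : Fin (freeCols n w).card → ℝ :=
  fun a => 2 * colAvg w u ((freeCols n w).equivFin.symm a) - 1

/-- The open cube is attained by `exists_of_colAvg`; the boundary follows since the image of the
compact face is closed. -/
lemma image_faceCoord {n : ℕ} {w : ℕ → ℕ → ℝ} (hw : IsRatio n w) :
    faceCoord n w '' ratioFace n w = Metric.closedBall 0 1 := by
  have hcont : Continuous (faceCoord n w) :=
    continuous_pi fun a => ((continuous_colAvg w _).const_mul 2).sub continuous_const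
  refine Subset.antisymm ?_ ?_
  · rintro _ ⟨u, hu, rfl⟩
    rw [mem_closedBall_zero_iff, pi_norm_le_iff_of_nonneg zero_le_one]
    intro a
    have := colAvg_mem_Icc (w := w) hu.1 ((freeCols n w).equivFin.symm a)
    rw [Real.norm_eq_abs, abs_le, faceCoord]
    constructor <;> linarith
  · rw [← closure_ball (0 : Fin (freeCols n w).card → ℝ) one_ne_zero]
    refine closure_minimal ?_ ((isCompact_ratioFace n w).image hcont).isClosed
    intro z hz
    rw [mem_ball_zero_iff, pi_norm_lt_iff one_pos] at hz
    classical
    obtain ⟨u, hu, h1, -, h2⟩ := exists_of_colAvg hw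
      (t := fun k => if hk : k ∈ freeCols n w then (z ((freeCols n w).equivFin ⟨k, hk⟩) + 1) / 2
        else 1 / 2) (by
      intro k
      split_ifs with hk
      · have := hz ((freeCols n w).equivFin ⟨k, hk⟩)
        rw [Real.norm_eq_abs, abs_lt] at this
        constructor <;> linarith
      · norm_num)
    refine ⟨u, ⟨hu, h1⟩, ?_⟩
    funext a
    rw [faceCoord, h2 _ ((freeCols n w).equivFin.symm a).2, dif_pos ((freeCols n w).equivFin.symm a).2]
    simp only [Subtype.coe_eta, Equiv.apply_symm_apply]
    ring

/-- The extension to averages `0` and `1` is what produces facets. -/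
lemma exists_of_colAvg_Icc {n : ℕ} {w : ℕ → ℕ → ℝ} (hw : IsRatio n w) {t : ℕ → ℝ}
    (ht : ∀ k, 0 ≤ t k ∧ t k ≤ 1) :
    ∃ u, IsRatio n u ∧ FaceLE u w ∧ ∀ k ∈ freeCols n w, colAvg w u k = t k := by
  have hz : (fun a => 2 * t ((freeCols n w).equivFin.symm a) - 1 : Fin (freeCols n w).card → ℝ) ∈
      Metric.closedBall (0 : Fin (freeCols n w).card → ℝ) 1 := by
    rw [mem_closedBall_zero_iff, pi_norm_le_iff_of_nonneg zero_le_one]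
    intro a
    have := ht ((freeCols n w).equivFin.symm a)
    rw [Real.norm_eq_abs, abs_le]
    constructor <;> linarith
  rw [← image_faceCoord hw] at hz
  obtain ⟨u, hu, he⟩ := hz
  refine ⟨u, hu.1, hu.2, fun k hk => ?_⟩
  have := congrFun he ((freeCols n w).equivFin ⟨k, hk⟩)
  simp only [faceCoord, Equiv.symm_apply_apply] at this
  linarith

/-- Faces are cubes, and their interiors are the sets of ratio matrices of a given type. -/
lemma exists_isCellMap_ratioFace {n : ℕ} {w : ℕ → ℕ → ℝ} (hw : IsRatio n w) :
    ∃ φ : (Fin (freeCols n w).card → ℝ) → ℕ → ℕ → ℝ,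
      IsCellMap φ (ratioFace n w) {u ∈ ratioFace n w | FaceLE w u} := by
  have hcont : Continuous (faceCoord n w) :=
    continuous_pi fun a => ((continuous_colAvg w _).const_mul 2).sub continuous_const
  have hinj : InjOn (faceCoord n w) (ratioFace n w) := by
    intro u hu v hv h
    refine colAvg_injOn hu.1 hv.1 hu.2 hv.2 fun k hk => ?_
    have := congrFun h ((freeCols n w).equivFin ⟨k, hk⟩)
    simp only [faceCoord, Equiv.symm_apply_apply] at this
    linarith
  obtain ⟨φ, hφ⟩ := IsCellMap.of_chart (isCompact_ratioFace n w) hcont.continuousOn hinj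
    (image_faceCoord hw)
  refine ⟨φ, ?_⟩
  convert hφ using 1
  ext u
  refine and_congr_right fun hu => ?_
  rw [faceLE_iff_colAvg hw hu.1 hu.2, mem_ball_zero_iff, pi_norm_lt_iff one_pos]
  simp only [Real.norm_eq_abs, abs_lt, faceCoord]
  constructor
  · intro h a
    have := h _ ((freeCols n w).equivFin.symm a).2
    constructor <;> linarith
  · intro h k hk
    have := h ((freeCols n w).equivFin ⟨k, hk⟩)
    simp only [Equiv.symm_apply_apply] at this
    constructor <;> linarith

lemma freeCols_subset {n : ℕ} {u w : ℕ → ℕ → ℝ} (h : FaceLE u w) :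
    freeCols n u ⊆ freeCols n w := by
  intro k hk
  rw [mem_freeCols] at hk ⊢
  exact ⟨hk.1, hk.2.mono (freeRows_subset h k)⟩

/-- If `u` had the same free columns as `w`, each of them would contain an entry of `u` strictly
between `0` and `1` in a free row of `w`. All averages would then be interior, and `u` would lie in
the interior of the face. -/
lemma card_freeCols_lt {n : ℕ} {u w : ℕ → ℕ → ℝ} (hw : IsRatio n w) (hu : IsRatio n u)
    (h : FaceLE u w) (h' : ¬ FaceLE w u) : (freeCols n u).card < (freeCols n w).card := by
  refine Finset.card_lt_card ((freeCols_subset h).ssubset_of_ne fun he => h' ?_)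
  refine faceLE_of_colAvg hw hu h fun k hk => ?_
  have hk' := hk
  rw [← he, mem_freeCols] at hk'
  obtain ⟨i, hi⟩ := hk'.2
  have hiw := freeRows_subset h k hi
  have hio := hu.mem_Ioo hi
  have hc : (0 : ℝ) < (freeRows w k).card := by exact_mod_cast Finset.card_pos.2 ⟨i, hiw⟩
  unfold colAvg
  constructor
  · exact div_pos (Finset.sum_pos' (fun j _ => hu.nonneg j k) ⟨i, hiw, hio.1⟩) hc
  · rw [div_lt_one hc]
    calc ∑ i ∈ freeRows w k, u i k < ∑ i ∈ freeRows w k, (1 : ℝ) :=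
          Finset.sum_lt_sum (fun j _ => hu.le_one j k) ⟨i, hiw, hio.2⟩
      _ = _ := by simp

/-- Every face of positive dimension has a facet. -/
lemma exists_facet {n : ℕ} {w : ℕ → ℕ → ℝ} (hw : IsRatio n w) (h : (freeCols n w).card ≠ 0) :
    ∃ u, IsRatio n u ∧ FaceLE u w ∧ (freeCols n u).card + 1 = (freeCols n w).card := by
  have hne : (freeCols n w).Nonempty := Finset.card_ne_zero.1 h
  set m := (freeCols n w).max' hne with hm
  have hmem : m ∈ freeCols n w := Finset.max'_mem _ _
  -- The last free column is pushed to zero. Choosing the last one matters: the type of a column is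
  -- controlled by the averages up to that column, so all the other free columns stay free.
  obtain ⟨u, hu, huw, ht⟩ := exists_of_colAvg_Icc hw (t := fun k => if k = m then 0 else 1 / 2)
    (fun k => by split_ifs <;> norm_num)
  have hty := type_of_colAvg (m := m) hw hu huw fun k hk hkm => by
    rw [ht k hk, if_neg (by omega)]; norm_num
  refine ⟨u, hu, huw, ?_⟩
  have : freeCols n u = (freeCols n w).erase m := by
    ext k
    rw [Finset.mem_erase]
    constructor
    · intro hk
      refine ⟨?_, freeCols_subset huw hk⟩
      rintro rfl
      obtain ⟨i, hi⟩ := (mem_freeCols.1 hk).2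
      have hiw := freeRows_subset huw _ hi
      have h0 := ht _ hmem
      rw [if_pos rfl, colAvg, div_eq_zero_iff] at h0
      rcases h0 with h0 | h0
      · have := (Finset.sum_eq_zero_iff_of_nonneg fun j _ => hu.nonneg j _).1 h0 i hiw
        exact (mem_freeRows.1 hi).2.1 this
      · exact Finset.card_ne_zero.2 ⟨i, hiw⟩ (by exact_mod_cast h0)
    · rintro ⟨hkm, hk⟩
      have hlt : k < m := lt_of_le_of_ne (Finset.le_max' _ _ hk) hkm
      rw [mem_freeCols] at hk ⊢
      obtain ⟨i, hi⟩ := hk.2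
      rw [mem_freeRows] at hi
      exact ⟨hk.1, i, mem_freeRows.2 ⟨hi.1, fun e => hi.2.1 ((hty k hlt i).1 e),
        fun e => hi.2.2 ((hty k hlt i).2 e)⟩⟩
  rw [this, Finset.card_erase_add_one hmem]

/-! ### Spaces with cells indexed by a preorder -/

/-- The sets `{y | le y x}` are closed cubes of dimension `dim x`, their interiors are the classes
of mutually comparable elements, and `dim` is the height. -/
structure Cellular {X : Type*} [TopologicalSpace X] (le : X → X → Prop) (dim : X → ℕ) : Prop where
  refl : ∀ x, le x x
  trans : ∀ x y z, le x y → le y z → le x z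
  dim_lt : ∀ x y, le y x → ¬ le x y → dim y < dim x
  facet : ∀ x, dim x ≠ 0 → ∃ y, le y x ∧ ¬ le x y ∧ dim y + 1 = dim x
  cell : ∀ x, ∃ φ : (Fin (dim x) → ℝ) → X, IsCellMap φ {y | le y x} {y | le y x ∧ le x y}

/-- A descending chain of facets below `x` is mapped to a strictly descending chain, along which the
dimension drops at every step. -/
lemma Cellular.dim_le_map {X Y : Type*} [TopologicalSpace X] [TopologicalSpace Y]
    {le : X → X → Prop} {dim : X → ℕ} (h : Cellular le dim) {le' : Y → Y → Prop} {dim' : Y → ℕ}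
    (h' : Cellular le' dim') {f : X → Y} (hf : ∀ x y, le' (f x) (f y) ↔ le x y) (x : X) :
    dim x ≤ dim' (f x) := by
  generalize hd : dim x = d
  induction d generalizing x with
  | zero => exact Nat.zero_le _
  | succ d ih =>
    obtain ⟨y, h1, h2, h3⟩ := h.facet x (by omega)
    have := ih y (by omega)
    have := h'.dim_lt (f x) (f y) ((hf _ _).2 h1) fun h => h2 ((hf _ _).1 h)
    omega

/-- When the image is a lower set, chains of facets below `f x` can also be pulled back, which gives
the opposite inequality. -/
lemma Cellular.dim_map {X Y : Type*} [TopologicalSpace X] [TopologicalSpace Y]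
    {le : X → X → Prop} {dim : X → ℕ} (h : Cellular le dim) {le' : Y → Y → Prop} {dim' : Y → ℕ}
    (h' : Cellular le' dim') {f : X → Y} (hf : ∀ x y, le' (f x) (f y) ↔ le x y)
    (hdown : ∀ x z, le' z (f x) → z ∈ range f) (x : X) : dim' (f x) = dim x := by
  refine le_antisymm ?_ (h.dim_le_map h' hf x)
  generalize hd : dim' (f x) = d
  induction d generalizing x with
  | zero => exact Nat.zero_le _
  | succ d ih =>
    obtain ⟨z, h1, h2, h3⟩ := h'.facet (f x) (by omega)
    obtain ⟨y, rfl⟩ := hdown x z h1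
    have := ih y (by omega)
    have := h.dim_lt x y ((hf _ _).1 h1) fun h => h2 ((hf _ _).2 h)
    omega

lemma Cellular.dim_eq {X : Type*} [TopologicalSpace X]
    {le : X → X → Prop} {dim : X → ℕ} (h : Cellular le dim) {x y : X} (h1 : le x y) (h2 : le y x) :
    dim x = dim y := by
  have key : ∀ x y, le x y → dim x ≤ dim y := by
    intro x y hxy
    by_cases hd : dim x = 0
    · omega
    obtain ⟨z, h1, h2, h3⟩ := h.facet x hd
    have := h.dim_lt y z (h.trans _ _ _ h1 hxy) fun h4 => h2 (h.trans _ _ _ hxy h4)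
    omega
  exact le_antisymm (key _ _ h1) (key _ _ h2)

/-- The space of ratio matrices: the model of a closed tile. -/
abbrev Ratios (n : ℕ) := {u : ℕ → ℕ → ℝ // IsRatio n u}

/-- An atlas of closed tiles makes a space cellular. -/
lemma exists_cellular {X ι : Type*} [TopologicalSpace X] {n : ℕ} {le : X → X → Prop}
    (refl : ∀ x, le x x) (trans : ∀ x y z, le x y → le y z → le x z)
    {ψ : ι → Ratios n → X} (hc : ∀ s, Continuous (ψ s)) (hi : ∀ s, Function.Injective (ψ s))
    (hle : ∀ s u v, le (ψ s u) (ψ s v) ↔ FaceLE u.1 v.1)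
    (hdown : ∀ s u y, le y (ψ s u) → y ∈ range (ψ s)) (hcov : ∀ x, ∃ s, x ∈ range (ψ s)) :
    ∃ dim, Cellular le dim := by
  choose s u hu using hcov
  -- The number of free columns does not depend on the chart. A chain of facets in one chart lies
  -- below a common point, hence in the range of the other chart, where the number of free columns
  -- also drops strictly.
  have ineq : ∀ s s' (v v' : Ratios n), ψ s v = ψ s' v' →
      (freeCols n v.1).card ≤ (freeCols n v'.1).card := by
    intro s s' v v' h
    generalize hd : (freeCols n v.1).card = d
    induction d generalizing v v' with
    | zero => exact Nat.zero_le _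
    | succ d ih =>
      obtain ⟨w, hw, hwv, hcard⟩ := exists_facet v.2 (by omega)
      have h1 : le (ψ s ⟨w, hw⟩) (ψ s v) := (hle _ _ _).2 hwv
      have h2 : ¬ le (ψ s v) (ψ s ⟨w, hw⟩) := fun h2 => by
        have h3 := (hle _ _ _).1 h2
        have h4 := Finset.card_le_card (freeCols_subset (n := n) h3)
        dsimp only at h4
        omega
      obtain ⟨w', hw'⟩ := hdown s' v' _ (h ▸ h1)
      have := ih ⟨w, hw⟩ w' hw'.symm (by dsimp only; omega)
      rw [h, ← hw', hle] at h1 h2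
      have := card_freeCols_lt v'.2 w'.2 h1 h2
      omega
  have hdim : ∀ s v, (freeCols n (u (ψ s v)).1).card = (freeCols n v.1).card := fun s v =>
    le_antisymm (ineq _ _ _ _ (hu _)) (ineq _ _ _ _ (hu _).symm)
  refine ⟨fun x => (freeCols n (u x).1).card, refl, trans, ?_, ?_, ?_⟩
  · intro x y h1 h2
    rw [← hu x] at h1 h2
    obtain ⟨v, rfl⟩ := hdown _ _ _ h1
    rw [hle] at h1 h2
    rw [hdim]
    exact card_freeCols_lt (u x).2 v.2 h1 h2
  · intro x hx
    obtain ⟨w, hw, hwv, hcard⟩ := exists_facet (u x).2 hx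
    refine ⟨ψ (s x) ⟨w, hw⟩, ?_, ?_, by rw [hdim, ← hcard]⟩
    · conv => rhs; rw [← hu x]
      exact (hle _ _ _).2 hwv
    · intro h
      have h5 : le (ψ (s x) (u x)) (ψ (s x) ⟨w, hw⟩) := by rwa [hu x]
      have h4 := Finset.card_le_card (freeCols_subset (n := n) ((hle _ _ _).1 h5))
      dsimp only at h4
      omega
  · intro x
    classical
    obtain ⟨φ, hφ⟩ := exists_isCellMap_ratioFace (u x).2
    -- The cube map takes values in arbitrary matrices while the chart is defined on ratio matrices
    -- only; the default value `x` does not occur on the face.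
    have hcont : ContinuousOn (fun v => if h : IsRatio n v then ψ (s x) ⟨v, h⟩ else x)
        (ratioFace n (u x).1) := by
      rw [continuousOn_iff_continuous_domRestrict]
      have : (ratioFace n (u x).1).domRestrict (fun v => if h : IsRatio n v then ψ (s x) ⟨v, h⟩ else x)
          = fun v => ψ (s x) ⟨v.1, v.2.1⟩ := by
        funext v; simp [domRestrict_apply, v.2.1]
      rw [this]
      exact (hc _).comp (by fun_prop)
    have hinj : InjOn (fun v => if h : IsRatio n v then ψ (s x) ⟨v, h⟩ else x)
        (ratioFace n (u x).1) := by
      intro v hv w hw h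
      simp only [dif_pos hv.1, dif_pos hw.1] at h
      exact congrArg Subtype.val (hi _ h)
    have := hφ.comp hcont hinj
    refine ⟨(fun v => if h : IsRatio n v then ψ (s x) ⟨v, h⟩ else x) ∘ φ, ?_⟩
    convert this using 1
    · ext y
      constructor
      · intro hy
        have hy' : le y (ψ (s x) (u x)) := by rw [hu x]; exact hy
        obtain ⟨v, rfl⟩ := hdown _ _ _ hy'
        exact ⟨v.1, ⟨v.2, (hle _ _ _).1 hy'⟩, by simp [v.2]⟩
      · rintro ⟨v, hv, rfl⟩
        simp only [dif_pos hv.1, mem_ofPred_eq]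
        conv => rhs; rw [← hu x]
        exact (hle _ _ _).2 hv.2
    · ext y
      constructor
      · rintro ⟨hy, hy2⟩
        have hy' : le y (ψ (s x) (u x)) := by rw [hu x]; exact hy
        have hy2' : le (ψ (s x) (u x)) y := by rw [hu x]; exact hy2
        obtain ⟨v, rfl⟩ := hdown _ _ _ hy'
        exact ⟨v.1, ⟨⟨v.2, (hle _ _ _).1 hy'⟩, (hle _ _ _).1 hy2'⟩, by simp [v.2]⟩
      · rintro ⟨v, hv, rfl⟩
        simp only [dif_pos hv.1.1, mem_ofPred_eq]
        refine ⟨?_, ?_⟩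
        · conv => rhs; rw [← hu x]
          exact (hle _ _ _).2 hv.1.2
        · conv => lhs; rw [← hu x]
          exact (hle _ _ _).2 hv.2

end

section

/-! ### Coordinates on the projective spaces `P(V S)` -/

lemma ctr_coe {n : ℕ} {S : Finset (Fin n)} (w : V S) : ctr S w.1 = w := by
  obtain ⟨w, h1, h2⟩ := w
  ext i
  by_cases hi : i ∈ S
  · simp [ctr, hi, h2]
  · simp [ctr, hi, h1 i hi]

lemma ctr_sub {n : ℕ} {S : Finset (Fin n)} (v : Fin n → ℝ) {i j : Fin n} (hi : i ∈ S)
    (hj : j ∈ S) : (ctr S v).1 i - (ctr S v).1 j = v i - v j := by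
  simp [ctr, hi, hj]

lemma sum_sq_pos {n : ℕ} {S : Finset (Fin n)} {w : V S} (hw : w ≠ 0) : 0 < ∑ m, w.1 m ^ 2 := by
  refine (Finset.sum_nonneg fun m _ => sq_nonneg _).lt_of_ne fun h => hw ?_
  have := (Finset.sum_eq_zero_iff_of_nonneg fun m _ => sq_nonneg (w.1 m)).1 h.symm
  ext m
  simpa using this m (Finset.mem_univ m)

/-- The normalised products of differences of the coordinates of a point of `P(V S)`. -/
def cross {n : ℕ} {S : Finset (Fin n)} (p : Projectivization ℝ (V S)) (i j k l : Fin n) : ℝ :=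
  (p.rep.1 i - p.rep.1 j) * (p.rep.1 k - p.rep.1 l) / ∑ m, p.rep.1 m ^ 2

/-- Numerator and denominator are both quadratic, so the choice of the representative cancels. This
makes `cross` a continuous function on `P(V S)`. -/
lemma cross_mk {n : ℕ} {S : Finset (Fin n)} (w : V S) (hw : w ≠ 0) (i j k l : Fin n) :
    cross (Projectivization.mk ℝ w hw) i j k l
      = (w.1 i - w.1 j) * (w.1 k - w.1 l) / ∑ m, w.1 m ^ 2 := by
  obtain ⟨a, ha⟩ := Projectivization.exists_smul_eq_mk_rep ℝ w hw
  have ha0 : (a : ℝ) ≠ 0 := a.ne_zero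
  have hr : ∀ m, (Projectivization.mk ℝ w hw).rep.1 m = a * w.1 m := fun m => by
    rw [← ha]; rfl
  simp only [cross, hr, mul_pow, ← Finset.mul_sum]
  rw [show ((a : ℝ) * w.1 i - a * w.1 j) * (a * w.1 k - a * w.1 l)
    = (a : ℝ) ^ 2 * ((w.1 i - w.1 j) * (w.1 k - w.1 l)) by ring]
  exact mul_div_mul_left _ _ (pow_ne_zero 2 ha0)

lemma continuous_cross {n : ℕ} (S : Finset (Fin n)) (i j k l : Fin n) :
    Continuous fun p : Projectivization ℝ (V S) => cross p i j k l := by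
  have hq : IsQuotientMap (Projectivization.mk' ℝ : {w : V S // w ≠ 0} → _) :=
    isQuotientMap_quotient_mk'
  rw [hq.continuous_iff]
  have : (fun p : Projectivization ℝ (V S) => cross p i j k l) ∘ Projectivization.mk' ℝ =
      fun w => (w.1.1 i - w.1.1 j) * (w.1.1 k - w.1.1 l) / ∑ m, w.1.1 m ^ 2 := by
    funext w
    exact cross_mk w.1 w.2 i j k l
  rw [this]
  have hm : ∀ m, Continuous fun w : {w : V S // w ≠ 0} => w.1.1 m := fun m =>
    (continuous_apply m).comp (continuous_subtype_val.comp continuous_subtype_val)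
  exact Continuous.div (((hm i).sub (hm j)).mul ((hm k).sub (hm l)))
    (continuous_finsetSum _ fun m _ => (hm m).pow 2) fun w => (sum_sq_pos w.2).ne'

lemma cross_nonneg_iff {n : ℕ} {S : Finset (Fin n)} (p : Projectivization ℝ (V S))
    (i j k l : Fin n) :
    0 ≤ cross p i j k l ↔ 0 ≤ (p.rep.1 i - p.rep.1 j) * (p.rep.1 k - p.rep.1 l) := by
  have := sum_sq_pos p.rep_nonzero
  rw [cross, le_div_iff₀ this, zero_mul]

lemma cross_mk_ctr_nonneg_iff {n : ℕ} {S : Finset (Fin n)} {v : Fin n → ℝ} (hv : ctr S v ≠ 0)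
    {i j k l : Fin n} (hi : i ∈ S) (hj : j ∈ S) (hk : k ∈ S) (hl : l ∈ S) :
    0 ≤ cross (Projectivization.mk ℝ (ctr S v) hv) i j k l
      ↔ 0 ≤ (v i - v j) * (v k - v l) := by
  have := sum_sq_pos hv
  rw [cross_mk, le_div_iff₀ this, zero_mul, ctr_sub v hi hj, ctr_sub v hk hl]

lemma exists_rep_ne {n : ℕ} {S : Finset (Fin n)} (p : Projectivization ℝ (V S)) :
    ∃ i ∈ S, ∃ j ∈ S, p.rep.1 i ≠ p.rep.1 j := by
  by_contra h
  push Not at h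
  have h0 := (ctr_eq_zero_iff S p.rep.1).2 h
  rw [ctr_coe] at h0
  exact p.rep_nonzero h0

lemma eq_mk_ctr {n : ℕ} {S : Finset (Fin n)} (p : Projectivization ℝ (V S)) {v : Fin n → ℝ}
    (hv : ctr S v ≠ 0) (c : ℝ)
    (h : ∀ i ∈ S, ∀ j ∈ S, p.rep.1 i - p.rep.1 j = c * (v i - v j)) :
    p = Projectivization.mk ℝ (ctr S v) hv := by
  rw [← p.mk_rep]
  refine mk_congr _ _ c ?_
  rw [← ctr_coe p.rep, ← map_smul, ← sub_eq_zero, ← map_sub, ctr_eq_zero_iff]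
  intro i hi j hj
  have := h i hi j hj
  simp only [Pi.sub_apply, Pi.smul_apply, smul_eq_mul]
  linarith

lemma rep_mk_ctr {n : ℕ} {S : Finset (Fin n)} {v : Fin n → ℝ} (hv : ctr S v ≠ 0) :
    ∃ c : ℝ, c ≠ 0 ∧ ∀ i ∈ S, ∀ j ∈ S, (Projectivization.mk ℝ (ctr S v) hv).rep.1 i
      - (Projectivization.mk ℝ (ctr S v) hv).rep.1 j = c * (v i - v j) := by
  obtain ⟨a, ha⟩ := Projectivization.exists_smul_eq_mk_rep ℝ (ctr S v) hv
  refine ⟨a, a.ne_zero, fun i hi j hj => ?_⟩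
  rw [← ha, ← ctr_sub v hi hj, mul_sub]
  rfl

/-- Fix a pair `k`, `l` separated by `p`. The equalities involving this pair express all differences
of `p` as one constant times those of `q`. -/
lemma eq_of_cross {n : ℕ} {S : Finset (Fin n)} {p q : Projectivization ℝ (V S)}
    (h : ∀ i ∈ S, ∀ j ∈ S, ∀ k ∈ S, ∀ l ∈ S, cross p i j k l = cross q i j k l) : p = q := by
  obtain ⟨k, hk, l, hl, hkl⟩ := exists_rep_ne p
  have hp := sum_sq_pos p.rep_nonzero
  have hq := sum_sq_pos q.rep_nonzero
  have hkl' := sub_ne_zero.2 hkl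
  have hqc : ctr S q.rep.1 ≠ 0 := by rw [ctr_coe]; exact q.rep_nonzero
  have e : q = Projectivization.mk ℝ (ctr S q.rep.1) hqc := by
    conv_lhs => rw [← q.mk_rep]
    congr 1
    exact (ctr_coe _).symm
  rw [e]
  refine eq_mk_ctr p hqc ((q.rep.1 k - q.rep.1 l) / (p.rep.1 k - p.rep.1 l) *
    ((∑ m, p.rep.1 m ^ 2) / ∑ m, q.rep.1 m ^ 2)) fun i hi j hj => ?_
  have := h i hi j hj k hk l hl
  simp only [cross] at this
  field_simp at this ⊢
  linarith

instance {n : ℕ} (S : Finset (Fin n)) : T2Space (Projectivization ℝ (V S)) := by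
  refine T2Space.of_injective_continuous
    (f := fun (p : Projectivization ℝ (V S)) (t : Fin n × Fin n × Fin n × Fin n) =>
      cross p t.1 t.2.1 t.2.2.1 t.2.2.2) ?_ ?_
  · intro p q h
    exact eq_of_cross fun i _ j _ k _ l _ => congrFun h (i, j, k, l)
  · exact continuous_pi fun t => continuous_cross S _ _ _ _

instance {n : ℕ} (S : Finset (Fin n)) : CompactSpace (Projectivization ℝ (V S)) := by
  have hc : CompactSpace (Metric.sphere (0 : V S) 1) :=
    isCompact_iff_compactSpace.1 (isCompact_sphere 0 1)
  have hm : Continuous (fun w : {w : V S // w ≠ 0} => Projectivization.mk' ℝ w) :=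
    continuous_quotient_mk'
  have hne : ∀ w : Metric.sphere (0 : V S) 1, w.1 ≠ 0 := fun w h => by
    have := w.2
    simp [h] at this
  have hf : Continuous fun w : Metric.sphere (0 : V S) 1 => Projectivization.mk ℝ w.1 (hne w) :=
    hm.comp (f := fun w : Metric.sphere (0 : V S) 1 => (⟨w.1, hne w⟩ : {w : V S // w ≠ 0}))
      (by fun_prop)
  refine ⟨?_⟩
  have hs : range (fun w : Metric.sphere (0 : V S) 1 => Projectivization.mk ℝ w.1 (hne w))
      = univ := by
    refine eq_univ_of_forall fun p => ?_
    have h0 : ‖p.rep‖ ≠ 0 := norm_ne_zero_iff.2 p.rep_nonzero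
    refine ⟨⟨‖p.rep‖⁻¹ • p.rep, ?_⟩, ?_⟩
    · rw [mem_sphere_zero_iff_norm, norm_smul, norm_inv, norm_norm, inv_mul_cancel₀ h0]
    · conv_rhs => rw [← p.mk_rep]
      exact mk_congr _ _ (‖p.rep‖⁻¹) rfl
  rw [← hs]
  exact isCompact_range hf

/-! ### Compatible families -/

/-- The restriction of the coordinate `T` to `S ⊆ T` is zero or the coordinate `S`. -/
def Compat {n : ℕ} (x : Fam n) : Prop :=
  ∀ S T : Big n, S.1 ⊆ T.1 → ∀ i ∈ S.1, ∀ j ∈ S.1, ∀ k ∈ S.1, ∀ l ∈ S.1,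
    ((x T).rep.1 i - (x T).rep.1 j) * ((x S).rep.1 k - (x S).rep.1 l)
      = ((x T).rep.1 k - (x T).rep.1 l) * ((x S).rep.1 i - (x S).rep.1 j)

/-- The defining equation involves chosen representatives. The square of the difference of its two
sides, divided by the two sums of squares, is a polynomial in values of `cross`, hence continuous.
-/
lemma isClosed_setOf_compat (n : ℕ) : IsClosed {x : Fam n | Compat x} := by
  have hc : ∀ (S : Big n) (i j k l : Fin n), Continuous fun x : Fam n => cross (x S) i j k l :=
    fun S i j k l => (continuous_cross S.1 i j k l).comp (continuous_apply S)
  have : {x : Fam n | Compat x} = ⋂ (S : Big n) (T : Big n) (_ : S.1 ⊆ T.1),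
      ⋂ i ∈ S.1, ⋂ j ∈ S.1, ⋂ k ∈ S.1, ⋂ l ∈ S.1, {x : Fam n |
        cross (x T) i j i j * cross (x S) k l k l
          - 2 * (cross (x T) i j k l * cross (x S) i j k l)
          + cross (x T) k l k l * cross (x S) i j i j = 0} := by
    ext x
    simp only [mem_iInter, mem_ofPred_eq, Compat]
    refine forall_congr' fun S => forall_congr' fun T => forall_congr' fun _ =>
      forall₂_congr fun i _ => forall₂_congr fun j _ => forall₂_congr fun k _ =>
      forall₂_congr fun l _ => ?_
    have h1 := (sum_sq_pos (x T).rep_nonzero).ne'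
    have h2 := (sum_sq_pos (x S).rep_nonzero).ne'
    have e : cross (x T) i j i j * cross (x S) k l k l
          - 2 * (cross (x T) i j k l * cross (x S) i j k l)
          + cross (x T) k l k l * cross (x S) i j i j
        = (((x T).rep.1 i - (x T).rep.1 j) * ((x S).rep.1 k - (x S).rep.1 l)
          - ((x T).rep.1 k - (x T).rep.1 l) * ((x S).rep.1 i - (x S).rep.1 j)) ^ 2
          / ((∑ m, (x T).rep.1 m ^ 2) * ∑ m, (x S).rep.1 m ^ 2) := by
      simp only [cross]
      field_simp
      ring
    rw [e, div_eq_zero_iff, or_iff_left (mul_ne_zero h1 h2), sq_eq_zero_iff, sub_eq_zero]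
  rw [this]
  refine isClosed_iInter fun S => isClosed_iInter fun T => isClosed_iInter fun _ =>
    isClosed_iInter fun i => isClosed_iInter fun _ => isClosed_iInter fun j =>
    isClosed_iInter fun _ => isClosed_iInter fun k => isClosed_iInter fun _ =>
    isClosed_iInter fun l => isClosed_iInter fun _ => isClosed_eq ?_ continuous_const
  exact (((hc _ _ _ _ _).mul (hc _ _ _ _ _)).sub
    (((hc _ _ _ _ _).mul (hc _ _ _ _ _)).const_mul 2)).add ((hc _ _ _ _ _).mul (hc _ _ _ _ _))

/-- Families of classes of functions `v S` such that each restriction of `v T` to `S ⊆ T` is, up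
to a constant, a multiple of `v S`. -/
lemma compat_mk {n : ℕ} (v : Big n → Fin n → ℝ) (hv : ∀ S : Big n, ctr S.1 (v S) ≠ 0)
    (h : ∀ S T : Big n, S.1 ⊆ T.1 → ∃ c : ℝ, ∀ i ∈ S.1, ∀ j ∈ S.1,
      v T i - v T j = c * (v S i - v S j)) :
    Compat fun S => Projectivization.mk ℝ (ctr S.1 (v S)) (hv S) := by
  intro S T hST i hi j hj k hk l hl
  obtain ⟨c, hc⟩ := h S T hST
  obtain ⟨a, -, ha⟩ := rep_mk_ctr (hv S)
  obtain ⟨b, -, hb⟩ := rep_mk_ctr (hv T)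
  rw [ha i hi j hj, ha k hk l hl, hb i (hST hi) j (hST hj), hb k (hST hk) l (hST hl),
    hc i hi j hj, hc k hk l hl]
  ring

lemma compat_conf {n : ℕ} (a : Fin n → ℝ) (ha : Function.Injective a) : Compat (conf a ha) :=
  compat_mk (fun _ => a) _ fun _ _ _ => ⟨1, fun i _ j _ => by rw [one_mul]⟩

/-- The face order: every coordinate of `y` is, up to the sign, a weakly increasing function of the
corresponding coordinate of `x`. -/
def FamLE {n : ℕ} (y x : Fam n) : Prop :=
  ∀ S : Big n, ∀ i ∈ S.1, ∀ j ∈ S.1, ∀ k ∈ S.1, ∀ l ∈ S.1,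
    0 ≤ cross (x S) i j k l → 0 ≤ cross (y S) i j k l

lemma FamLE.refl {n : ℕ} (x : Fam n) : FamLE x x := fun _ _ _ _ _ _ _ _ _ h => h

lemma FamLE.trans {n : ℕ} {x y z : Fam n} (h : FamLE x y) (h' : FamLE y z) : FamLE x z :=
  fun S i hi j hj k hk l hl hz => h S i hi j hj k hk l hl (h' S i hi j hj k hk l hl hz)

/-- All the coordinates are weakly monotone for the linear order given by `σ`. -/
def IsMono {n : ℕ} (σ : Equiv.Perm (Fin n)) (x : Fam n) : Prop :=
  ∀ S : Big n, ∀ i ∈ S.1, ∀ j ∈ S.1, ∀ k ∈ S.1, ∀ l ∈ S.1,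
    σ.symm j ≤ σ.symm i → σ.symm l ≤ σ.symm k → 0 ≤ cross (x S) i j k l

lemma isClosed_setOf_isMono {n : ℕ} (σ : Equiv.Perm (Fin n)) :
    IsClosed {x : Fam n | IsMono σ x} := by
  simp only [IsMono, ofPred_forall]
  refine isClosed_iInter fun S => isClosed_iInter fun i => isClosed_iInter fun _ =>
    isClosed_iInter fun j => isClosed_iInter fun _ => isClosed_iInter fun k =>
    isClosed_iInter fun _ => isClosed_iInter fun l => isClosed_iInter fun _ =>
    isClosed_iInter fun _ => isClosed_iInter fun _ => isClosed_le continuous_const ?_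
  exact (continuous_cross S.1 i j k l).comp (continuous_apply S)

lemma IsMono.of_le {n : ℕ} {σ : Equiv.Perm (Fin n)} {x y : Fam n} (hx : IsMono σ x)
    (h : FamLE y x) : IsMono σ y :=
  fun S i hi j hj k hk l hl h1 h2 => h S i hi j hj k hk l hl (hx S i hi j hj k hk l hl h1 h2)

/-- A monotone representative. -/
lemma IsMono.exists_rep {n : ℕ} {σ : Equiv.Perm (Fin n)} {x : Fam n} (hx : IsMono σ x)
    (S : Big n) : ∃ c : ℝ, c ≠ 0 ∧ ∀ i ∈ S.1, ∀ j ∈ S.1, σ.symm i ≤ σ.symm j →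
      c * (x S).rep.1 i ≤ c * (x S).rep.1 j := by
  obtain ⟨k, hk, l, hl, hkl⟩ := exists_rep_ne (x S)
  wlog hlk : σ.symm l ≤ σ.symm k generalizing k l
  · exact this l hl k hk hkl.symm (le_of_not_ge hlk)
  refine ⟨(x S).rep.1 k - (x S).rep.1 l, sub_ne_zero.2 hkl, fun i hi j hj hij => ?_⟩
  have := hx S j hj i hi k hk l hl hij hlk
  rw [cross_nonneg_iff] at this
  nlinarith

lemma isMono_mk {n : ℕ} {σ : Equiv.Perm (Fin n)} (v : Big n → Fin n → ℝ)
    (hv : ∀ S : Big n, ctr S.1 (v S) ≠ 0)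
    (h : ∀ S : Big n, ∀ i ∈ S.1, ∀ j ∈ S.1, σ.symm i ≤ σ.symm j → v S i ≤ v S j) :
    IsMono σ fun S => Projectivization.mk ℝ (ctr S.1 (v S)) (hv S) := by
  intro S i hi j hj k hk l hl h1 h2
  rw [cross_mk_ctr_nonneg_iff (hv S) hi hj hk hl]
  exact mul_nonneg (sub_nonneg.2 (h S j hj i hi h1)) (sub_nonneg.2 (h S l hl k hk h2))

end

/-! ### Collapsed pairs of points, and the charts of the tiles -/

section

/-- The coordinate `S` of `x` does not separate `i` and `j`. -/
def SameAt {n : ℕ} (x : Fam n) (S : Big n) (i j : Fin n) : Prop :=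
  (x S).rep.1 i = (x S).rep.1 j

lemma sameAt_mk {n : ℕ} {v : Big n → Fin n → ℝ} (hv : ∀ S : Big n, ctr S.1 (v S) ≠ 0) {S : Big n}
    {i j : Fin n} (hi : i ∈ S.1) (hj : j ∈ S.1) :
    SameAt (fun S => Projectivization.mk ℝ (ctr S.1 (v S)) (hv S)) S i j ↔ v S i = v S j := by
  obtain ⟨c, hc, h⟩ := rep_mk_ctr (hv S)
  rw [SameAt, ← sub_eq_zero, h i hi j hj, mul_eq_zero, or_iff_right hc, sub_eq_zero]

/-- Take a pair separated by `y`. If `x` collapses `i` and `j`, its product with this pair is zero,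
so the product for `y` is nonnegative with either sign and must vanish. -/
lemma FamLE.sameAt {n : ℕ} {x y : Fam n} (h : FamLE y x) {S : Big n} {i j : Fin n} (hi : i ∈ S.1)
    (hj : j ∈ S.1) (hx : SameAt x S i j) : SameAt y S i j := by
  obtain ⟨k, hk, l, hl, hkl⟩ := exists_rep_ne (y S)
  have h1 := h S i hi j hj k hk l hl
  have h2 := h S j hj i hi k hk l hl
  simp only [cross_nonneg_iff] at h1 h2
  rw [SameAt] at hx
  rw [hx, sub_self, zero_mul] at h1
  rw [hx, sub_self, zero_mul] at h2
  have h3 : ((y S).rep.1 i - (y S).rep.1 j) * ((y S).rep.1 k - (y S).rep.1 l) = 0 := by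
    linarith [h1 le_rfl, h2 le_rfl]
  rw [mul_eq_zero, or_iff_left (sub_ne_zero.2 hkl), sub_eq_zero] at h3
  exact h3

/-- For families monotone in a common order, the weak sign of each product is dictated by `σ`. The
only additional information in `FamLE` is which products vanish. -/
lemma famLE_of_sameAt {n : ℕ} {σ : Equiv.Perm (Fin n)} {x y : Fam n} (hx : IsMono σ x)
    (hy : IsMono σ y) (h : ∀ S : Big n, ∀ i ∈ S.1, ∀ j ∈ S.1, SameAt x S i j → SameAt y S i j) :
    FamLE y x := by
  intro S i hi j hj k hk l hl hc
  have key : ∀ i ∈ S.1, ∀ j ∈ S.1, ∀ k ∈ S.1, ∀ l ∈ S.1, σ.symm j ≤ σ.symm i →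
      0 ≤ cross (x S) i j k l → 0 ≤ cross (y S) i j k l := by
    intro i hi j hj k hk l hl hij hc
    rcases le_total (σ.symm l) (σ.symm k) with hkl | hkl
    · exact hy S i hi j hj k hk l hl hij hkl
    · have h1 := hx S i hi j hj l hl k hk hij hkl
      rw [cross_nonneg_iff] at h1 hc ⊢
      have h2 : ((x S).rep.1 i - (x S).rep.1 j) * ((x S).rep.1 k - (x S).rep.1 l) = 0 := by
        linarith
      rcases mul_eq_zero.1 h2 with h3 | h3
      · have := h S i hi j hj (sub_eq_zero.1 h3)
        rw [SameAt] at this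
        simp [this]
      · have := h S k hk l hl (sub_eq_zero.1 h3)
        rw [SameAt] at this
        simp [this]
  rcases le_total (σ.symm j) (σ.symm i) with hij | hij
  · exact key i hi j hj k hk l hl hij hc
  · have h1 := key j hj i hi l hl k hk hij
    rw [cross_nonneg_iff] at h1 hc ⊢
    rw [cross_nonneg_iff] at h1
    have := h1 (by linarith)
    linarith

/-! ### The charts -/

variable {n : ℕ} (σ : Equiv.Perm (Fin n))

/-- The positions of the elements of `S`. -/
def positions (S : Big n) : Finset ℕ := S.1.image fun j => (σ.symm j : ℕ)

lemma positions_nonempty (S : Big n) : (positions σ S).Nonempty := by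
  have : S.1.Nonempty := Finset.card_pos.1 (by have := S.2; omega)
  exact this.image _

/-- The first position of an element of `S`. -/
def lo (S : Big n) : ℕ := (positions σ S).min' (positions_nonempty σ S)

/-- The last position of an element of `S`. -/
def hi (S : Big n) : ℕ := (positions σ S).max' (positions_nonempty σ S)

variable {σ}

lemma lo_le {S : Big n} {j : Fin n} (hj : j ∈ S.1) : lo σ S ≤ σ.symm j :=
  Finset.min'_le _ _ (Finset.mem_image_of_mem (fun j => (σ.symm j : ℕ)) hj)

lemma le_hi {S : Big n} {j : Fin n} (hj : j ∈ S.1) : (σ.symm j : ℕ) ≤ hi σ S :=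
  Finset.le_max' _ _ (Finset.mem_image_of_mem (fun j => (σ.symm j : ℕ)) hj)

lemma exists_lo (σ : Equiv.Perm (Fin n)) (S : Big n) : ∃ j ∈ S.1, (σ.symm j : ℕ) = lo σ S := by
  exact Finset.mem_image.1 (Finset.min'_mem _ (positions_nonempty σ S))

lemma exists_hi (σ : Equiv.Perm (Fin n)) (S : Big n) : ∃ j ∈ S.1, (σ.symm j : ℕ) = hi σ S := by
  exact Finset.mem_image.1 (Finset.max'_mem _ (positions_nonempty σ S))

lemma hi_lt (σ : Equiv.Perm (Fin n)) (S : Big n) : hi σ S < n := by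
  obtain ⟨j, -, h⟩ := exists_hi σ S
  rw [← h]; exact (σ.symm j).2

lemma lo_lt_hi (σ : Equiv.Perm (Fin n)) (S : Big n) : lo σ S < hi σ S := by
  obtain ⟨i, hi', j, hj, hij⟩ := Finset.one_lt_card.1 S.2
  have h1 := lo_le (σ := σ) hi'
  have h2 := le_hi (σ := σ) hi'
  have h3 := lo_le (σ := σ) hj
  have h4 := le_hi (σ := σ) hj
  have : (σ.symm i : ℕ) ≠ σ.symm j := fun h => hij (σ.symm.injective (Fin.ext h))
  omega

variable (σ)

/-- The marked points with positions in `[i, k]`. -/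
def interval {i k : ℕ} (h : i < k ∧ k < n) : Big n :=
  ⟨Finset.univ.filter fun j => i ≤ (σ.symm j : ℕ) ∧ (σ.symm j : ℕ) ≤ k, by
    refine Finset.one_lt_card.2 ⟨σ ⟨i, h.1.trans h.2⟩, ?_, σ ⟨k, h.2⟩, ?_, ?_⟩
    · simp [h.1.le]
    · simp [h.1.le]
    · intro he
      have := Fin.ext_iff.1 (σ.injective he)
      dsimp only at this
      omega⟩

variable {σ}

lemma mem_interval {i k : ℕ} {h : i < k ∧ k < n} {j : Fin n} :
    j ∈ (interval σ h).1 ↔ i ≤ (σ.symm j : ℕ) ∧ (σ.symm j : ℕ) ≤ k := by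
  simp [interval]

lemma mem_interval' {i k p : ℕ} {h : i < k ∧ k < n} (hp : p < n) :
    σ ⟨p, hp⟩ ∈ (interval σ h).1 ↔ i ≤ p ∧ p ≤ k := by
  simp [interval]

lemma lo_interval {i k : ℕ} (h : i < k ∧ k < n) : lo σ (interval σ h) = i := by
  refine le_antisymm ?_ ?_
  · have hm : σ ⟨i, by omega⟩ ∈ (interval σ h).1 := (mem_interval' _).2 ⟨le_rfl, h.1.le⟩
    simpa using lo_le (σ := σ) hm
  · obtain ⟨j, hj, he⟩ := exists_lo σ (interval σ h)
    rw [← he]; exact (mem_interval.1 hj).1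

lemma hi_interval {i k : ℕ} (h : i < k ∧ k < n) : hi σ (interval σ h) = k := by
  refine le_antisymm ?_ ?_
  · obtain ⟨j, hj, he⟩ := exists_hi σ (interval σ h)
    rw [← he]; exact (mem_interval.1 hj).2
  · have hm : σ ⟨k, by omega⟩ ∈ (interval σ h).1 := (mem_interval' _).2 ⟨h.1.le, le_rfl⟩
    simpa using le_hi (σ := σ) hm

lemma subset_interval (σ : Equiv.Perm (Fin n)) (S : Big n) :
    S.1 ⊆ (interval σ ⟨lo_lt_hi σ S, hi_lt σ S⟩).1 := fun _ hj =>
  mem_interval.2 ⟨lo_le hj, le_hi hj⟩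

variable (σ)

/-- The normalised increasing representative of the coordinate `S`. -/
def chartVec (u : ℕ → ℕ → ℝ) (S : Big n) (j : Fin n) : ℝ :=
  relPos u (lo σ S) (σ.symm j) (hi σ S)

lemma ctr_chartVec_ne_zero (u : Ratios n) (S : Big n) : ctr S.1 (chartVec σ u.1 S) ≠ 0 := by
  obtain ⟨i, hi', hie⟩ := exists_lo σ S
  obtain ⟨j, hj, hje⟩ := exists_hi σ S
  refine ctr_ne_zero hi' hj ?_
  rw [chartVec, chartVec, hie, hje, relPos_self, u.2.relPos_left (lo_lt_hi σ S)]
  exact zero_ne_one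

/-- The chart of the closed tile of `σ`. -/
def chart (u : Ratios n) : Fam n := fun S =>
  Projectivization.mk ℝ (ctr S.1 (chartVec σ u.1 S)) (ctr_chartVec_ne_zero σ u S)

lemma continuous_chart : Continuous (chart σ) := by
  refine continuous_pi fun S => continuous_iff_continuousAt.2 fun u => ?_
  refine tendsto_mk ?_ _ _
  refine ((continuous_ctr S.1).comp (continuous_pi fun j => ?_)).tendsto u
  unfold chartVec relPos
  exact continuous_finsetProd _ fun l _ =>
    (continuous_apply_apply (lo σ S) l).comp continuous_subtype_val

lemma isMono_chart (u : Ratios n) : IsMono σ (chart σ u) :=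
  isMono_mk _ _ fun _ _ _ _ _ h => u.2.relPos_mono _ _ h

variable {σ} in
lemma relPos_sub_of_mem {u : ℕ → ℕ → ℝ} (hu : IsRatio n u) {S T : Big n} (h : S.1 ⊆ T.1)
    {i : Fin n} (hi' : i ∈ S.1) :
    chartVec σ u T i - relPos u (lo σ T) (lo σ S) (hi σ T) = chartVec σ u S i *
      (relPos u (lo σ T) (hi σ S) (hi σ T) - relPos u (lo σ T) (lo σ S) (hi σ T)) := by
  obtain ⟨a, ha, hae⟩ := exists_lo σ S
  obtain ⟨b, hb, hbe⟩ := exists_hi σ S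
  refine hu.relPos_sub' ?_ (lo_le hi') (le_hi hi') ?_ (hi_lt σ T) (lo_lt_hi σ S)
  · rw [← hae]; exact lo_le (h ha)
  · rw [← hbe]; exact le_hi (h hb)

lemma compat_chart (u : Ratios n) : Compat (chart σ u) := by
  refine compat_mk _ _ fun S T hST => ⟨relPos u.1 (lo σ T) (hi σ S) (hi σ T)
    - relPos u.1 (lo σ T) (lo σ S) (hi σ T), fun i hi' j hj => ?_⟩
  have h1 := relPos_sub_of_mem u.2 (σ := σ) hST hi'
  have h2 := relPos_sub_of_mem u.2 (σ := σ) hST hj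
  linear_combination h1 - h2

lemma sameAt_chart (u : Ratios n) {S : Big n} {i j : Fin n} (hi' : i ∈ S.1) (hj : j ∈ S.1) :
    SameAt (chart σ u) S i j ↔ chartVec σ u.1 S i = chartVec σ u.1 S j :=
  sameAt_mk (ctr_chartVec_ne_zero σ u) hi' hj

lemma relPos_eq_zero_iff {u : ℕ → ℕ → ℝ} {i p k : ℕ} :
    relPos u i p k = 0 ↔ ∃ l, p < l ∧ l ≤ k ∧ u i l = 0 := by
  simp [relPos, Finset.prod_eq_zero_iff, and_assoc]

/-- Two positions coincide either because some later entry is `0` or because all the entries between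
them are `1`. Both reasons persist on passing to a face. -/
lemma IsRatio.relPos_eq_of_faceLE {n : ℕ} {u w : ℕ → ℕ → ℝ} (hu : IsRatio n u) (hw : IsRatio n w)
    (h : FaceLE u w) {i p q k : ℕ} (hpq : p ≤ q) (hqk : q ≤ k)
    (he : relPos w i p k = relPos w i q k) : relPos u i p k = relPos u i q k := by
  rw [relPos_mul _ _ hpq hqk] at he ⊢
  by_cases h0 : relPos w i q k = 0
  · obtain ⟨l, h1, h2, h3⟩ := relPos_eq_zero_iff.1 h0
    have : relPos u i q k = 0 := relPos_eq_zero_iff.2 ⟨l, h1, h2, (h i l).1 h3⟩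
    simp [this]
  · have h1 : relPos w i p q = 1 := by
      have : (relPos w i p q - 1) * relPos w i q k = 0 := by linear_combination he
      rcases mul_eq_zero.1 this with h | h
      · linarith
      · exact absurd h h0
    rw [hw.relPos_eq_one_iff] at h1
    have : relPos u i p q = 1 := hu.relPos_eq_one_iff.2 fun l a b => (h i l).2 (h1 l a b)
    rw [this, one_mul]

lemma chartVec_interval (u : ℕ → ℕ → ℝ) {i k p : ℕ} (h : i < k ∧ k < n) (hp : p < n) :
    chartVec σ u (interval σ h) (σ ⟨p, hp⟩) = relPos u i p k := by
  rw [chartVec, lo_interval, hi_interval]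
  simp

lemma relPos_pred {u : ℕ → ℕ → ℝ} {i k : ℕ} (h : i < k) : relPos u i (k - 1) k = u i k := by
  obtain ⟨k, rfl⟩ : ∃ k', k = k' + 1 := ⟨k - 1, by omega⟩
  rw [Nat.add_sub_cancel, relPos_succ _ _ le_rfl, relPos_self, one_mul]

/-- In the coordinate of the interval `[i, k]`, the entry `u i k` is the normalised position of `k -
1`. It is `0` or `1` exactly when `k - 1` collides with `i` or with `k`. -/
lemma famLE_chart_iff (u w : Ratios n) : FamLE (chart σ u) (chart σ w) ↔ FaceLE u.1 w.1 := by
  constructor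
  · intro h i k
    by_cases hik : i < k ∧ k < n
    swap
    · simp [u.2.support i k hik, w.2.support i k hik]
    have hkey : ∀ p q, i ≤ p → p ≤ k → i ≤ q → q ≤ k →
        relPos w.1 i p k = relPos w.1 i q k → relPos u.1 i p k = relPos u.1 i q k := by
      intro p q h1 h2 h3 h4 he
      have hp : σ ⟨p, by omega⟩ ∈ (interval σ hik).1 := (mem_interval' _).2 ⟨h1, h2⟩
      have hq : σ ⟨q, by omega⟩ ∈ (interval σ hik).1 := (mem_interval' _).2 ⟨h3, h4⟩
      have := h.sameAt hp hq
      rw [sameAt_chart σ _ hp hq, sameAt_chart σ _ hp hq] at this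
      simp only [chartVec_interval] at this
      exact this he
    have h0 := hkey (k - 1) i (by omega) (by omega) le_rfl hik.1.le
    have h1 := hkey (k - 1) k (by omega) (by omega) hik.1.le le_rfl
    rw [relPos_pred hik.1, relPos_pred hik.1, u.2.relPos_left hik.1, w.2.relPos_left hik.1] at h0
    rw [relPos_pred hik.1, relPos_pred hik.1, relPos_self, relPos_self] at h1
    exact ⟨h0, h1⟩
  · intro h
    refine famLE_of_sameAt (isMono_chart σ w) (isMono_chart σ u) fun S i hi' j hj => ?_
    rw [sameAt_chart σ _ hi' hj, sameAt_chart σ _ hi' hj]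
    intro he
    rcases le_total (σ.symm i) (σ.symm j) with hij | hij
    · exact u.2.relPos_eq_of_faceLE w.2 h hij (le_hi hj) he
    · exact (u.2.relPos_eq_of_faceLE w.2 h hij (le_hi hi') he.symm).symm

/-- The entry `u i k` is recovered as a quotient of differences in the coordinate of the interval
`[i, k]`. -/
lemma chart_injective : Function.Injective (chart σ) := by
  intro u w h
  have key : ∀ i k, u.1 i k = w.1 i k := by
    intro i k
    by_cases hik : i < k ∧ k < n
    swap
    · rw [u.2.support i k hik, w.2.support i k hik]
    have e := congrFun h (interval σ hik)
    obtain ⟨a, -, ha⟩ := rep_mk_ctr (ctr_chartVec_ne_zero σ u (interval σ hik))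
    obtain ⟨b, hb0, hb⟩ := rep_mk_ctr (ctr_chartVec_ne_zero σ w (interval σ hik))
    have h1 : σ ⟨i, by omega⟩ ∈ (interval σ hik).1 := (mem_interval' _).2 ⟨le_rfl, hik.1.le⟩
    have h2 : σ ⟨k, by omega⟩ ∈ (interval σ hik).1 := (mem_interval' _).2 ⟨hik.1.le, le_rfl⟩
    have h3 : σ ⟨k - 1, by omega⟩ ∈ (interval σ hik).1 := (mem_interval' _).2 ⟨by omega, by omega⟩
    have a1 := ha _ h2 _ h1
    have a2 := ha _ h3 _ h1
    have b1 := hb _ h2 _ h1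
    have b2 := hb _ h3 _ h1
    change Projectivization.mk ℝ _ _ = Projectivization.mk ℝ _ _ at e
    rw [← e] at b1 b2
    simp only [chartVec_interval, relPos_self, relPos_pred hik.1, u.2.relPos_left hik.1,
      w.2.relPos_left hik.1] at a1 a2 b1 b2
    have : b * (u.1 i k - w.1 i k) = 0 := by
      have : a = b := by linarith
      subst this
      linarith
    rcases mul_eq_zero.1 this with h | h
    · exact absurd h hb0
    · linarith
  exact Subtype.ext (funext fun i => funext fun k => key i k)

/-! ### The image of a chart -/

/-- Ratio matrices from compatible normalised positions. -/
lemma isRatio_of_positions {g : ℕ → ℕ → ℕ → ℝ}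
    (g0 : ∀ i k, i < k → k < n → g i i k = 0) (g1 : ∀ i k, i < k → k < n → g i k k = 1)
    (hg0 : ∀ i p k, i ≤ p → p ≤ k → i < k → k < n → 0 ≤ g i p k)
    (hg1 : ∀ i p k, i ≤ p → p ≤ k → i < k → k < n → g i p k ≤ 1)
    (hg : ∀ i j p l k, i ≤ j → j ≤ p → p ≤ l → l ≤ k → j < l → k < n →
      g i p k - g i j k = g j p l * (g i l k - g i j k)) :
    ∃ u, IsRatio n u ∧ ∀ i p k, i ≤ p → p ≤ k → i < k → k < n → relPos u i p k = g i p k := by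
  classical
  set u : ℕ → ℕ → ℝ := fun i k => if i < k ∧ k < n then g i (k - 1) k else 0 with hu
  have hupos : ∀ i k, i < k → k < n → u i k = g i (k - 1) k := fun i k h1 h2 => if_pos ⟨h1, h2⟩
  have hdiag : ∀ i, u i (i + 1) = 0 := by
    intro i
    by_cases h : i + 1 < n
    · rw [hupos i _ (by omega) h, Nat.add_sub_cancel, g0 i _ (by omega) h]
    · exact if_neg (by omega)
  have hrel : ∀ i p k, i ≤ p → p ≤ k → i < k → k < n → relPos u i p k = g i p k := by
    intro i p k hip hpk hik hk
    rcases hip.eq_or_lt with rfl | hip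
    · rw [g0 i k hik hk]
      exact relPos_eq_zero_iff.2 ⟨i + 1, by omega, by omega, hdiag i⟩
    clear hik
    induction k, hpk using Nat.le_induction with
    | base => rw [relPos_self, g1 i p hip hk]
    | succ k hpk ih =>
      rw [relPos_succ _ _ hpk, ih (by omega), hupos i (k + 1) (by omega) hk, Nat.add_sub_cancel]
      have := hg i i p k (k + 1) le_rfl hip.le hpk (by omega) (by omega) hk
      rw [g0 i (k + 1) (by omega) hk] at this
      linarith
  refine ⟨u, ⟨?_, ?_, ?_, hdiag, ?_⟩, hrel⟩
  · intro i k
    by_cases h : i < k ∧ k < n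
    · rw [hupos i k h.1 h.2]; exact hg0 _ _ _ (by omega) (by omega) h.1 h.2
    · exact (if_neg h).ge
  · intro i k
    by_cases h : i < k ∧ k < n
    · rw [hupos i k h.1 h.2]; exact hg1 _ _ _ (by omega) (by omega) h.1 h.2
    · exact (if_neg h).le.trans zero_le_one
  · exact fun i k h => if_neg h
  · intro i j k hij hjk hk
    rw [hrel i j k hij.le hjk.le (by omega) hk, hupos i k (by omega) hk, hupos j k hjk hk]
    have := hg i j (k - 1) k k hij.le (by omega) (by omega) le_rfl hjk hk
    rw [g1 i k (by omega) hk] at this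
    linear_combination (-1 : ℝ) * this

variable {σ}

/-- The normalised positions in the interval coordinates form a ratio matrix: monotonicity places
them in `[0, 1]`, and compatibility gives the restriction identities. Every other coordinate is the
restriction of an interval coordinate. -/
lemma exists_chart_eq {x : Fam n} (hx : Compat x) (hm : IsMono σ x) : ∃ u, chart σ u = x := by
  classical
  set v : ℕ → ℕ → ℕ → ℝ := fun i p k => if h : (i < k ∧ k < n) ∧ p < n then
    (x (interval σ h.1)).rep.1 (σ ⟨p, h.2⟩) else 0 with hv
  have hvpos : ∀ i p k (h : i < k ∧ k < n) (hp : p < n),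
      v i p k = (x (interval σ h)).rep.1 (σ ⟨p, hp⟩) := fun i p k h hp => dif_pos ⟨h, hp⟩
  have hne : ∀ i k, i < k → k < n → v i k k - v i i k ≠ 0 ∧ ∀ p q, i ≤ p → p ≤ q → q ≤ k →
      0 ≤ (v i q k - v i p k) / (v i k k - v i i k) := by
    intro i k hik hk
    obtain ⟨c, hc, hmono⟩ := hm.exists_rep (interval σ ⟨hik, hk⟩)
    have hcm : ∀ p q, i ≤ p → p ≤ q → q ≤ k → c * v i p k ≤ c * v i q k := by
      intro p q h1 h2 h3
      rw [hvpos i p k ⟨hik, hk⟩ (by omega), hvpos i q k ⟨hik, hk⟩ (by omega)]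
      refine hmono _ ((mem_interval' _).2 ⟨h1, by omega⟩) _ ((mem_interval' _).2 ⟨by omega, h3⟩) ?_
      simpa using h2
    -- If the two ends of the interval collided, monotonicity would collapse everything in between,
    -- but no coordinate is constant.
    have h0 : v i k k - v i i k ≠ 0 := by
      intro h0
      obtain ⟨a, ha, b, hb, hab⟩ := exists_rep_ne (x (interval σ ⟨hik, hk⟩))
      have hh : ∀ a ∈ (interval σ ⟨hik, hk⟩).1,
          (x (interval σ ⟨hik, hk⟩)).rep.1 a = v i i k := by
        intro a ha
        have ha' := mem_interval.1 ha
        have e1 := hcm i _ le_rfl ha'.1 ha'.2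
        have e2 := hcm _ k ha'.1 ha'.2 le_rfl
        have e3 : v i (σ.symm a) k = (x (interval σ ⟨hik, hk⟩)).rep.1 a := by
          rw [hvpos i _ k ⟨hik, hk⟩ (σ.symm a).2]; simp
        rw [← e3]
        have e4 : v i k k = v i i k := by linarith
        rw [e4] at e2
        exact mul_left_cancel₀ hc (le_antisymm e2 e1)
      exact hab ((hh a ha).trans (hh b hb).symm)
    refine ⟨h0, fun p q h1 h2 h3 => ?_⟩
    have e1 := hcm p q h1 h2 h3
    have e2 := hcm i k le_rfl hik.le le_rfl
    rw [← mul_div_mul_left _ _ hc]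
    exact div_nonneg (by linarith) (by linarith)
  have hcomp : ∀ i j l k, i ≤ j → j < l → l ≤ k → k < n → ∀ p q r s, j ≤ p → p ≤ l → j ≤ q →
      q ≤ l → j ≤ r → r ≤ l → j ≤ s → s ≤ l →
      (v i p k - v i q k) * (v j r l - v j s l) = (v i r k - v i s k) * (v j p l - v j q l) := by
    intro i j l k hij hjl hlk hk p q r s hp hp' hq hq' hr hr' hs hs'
    have hm' : ∀ p (h : j ≤ p) (h' : p ≤ l),
        σ ⟨p, by omega⟩ ∈ (interval σ (⟨hjl, by omega⟩ : j < l ∧ l < n)).1 :=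
      fun p h h' => (mem_interval' _).2 ⟨h, h'⟩
    have := hx (interval σ (⟨hjl, by omega⟩ : j < l ∧ l < n)) (interval σ (⟨by omega, hk⟩ : i < k ∧ k < n))
      (fun a ha => by
        rw [mem_interval] at ha ⊢
        omega) _ (hm' p hp hp') _ (hm' q hq hq') _ (hm' r hr hr') _ (hm' s hs hs')
    rw [hvpos i p k ⟨by omega, hk⟩ (by omega), hvpos i q k ⟨by omega, hk⟩ (by omega),
      hvpos i r k ⟨by omega, hk⟩ (by omega), hvpos i s k ⟨by omega, hk⟩ (by omega),
      hvpos j p l ⟨by omega, by omega⟩ (by omega), hvpos j q l ⟨by omega, by omega⟩ (by omega),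
      hvpos j r l ⟨by omega, by omega⟩ (by omega), hvpos j s l ⟨by omega, by omega⟩ (by omega)]
    exact this
  obtain ⟨u, hu, hrel⟩ := isRatio_of_positions (n := n)
    (g := fun i p k => (v i p k - v i i k) / (v i k k - v i i k))
    (fun i k _ _ => by simp) (fun i k h1 h2 => div_self (hne i k h1 h2).1)
    (fun i p k h1 h2 h3 h4 => (hne i k h3 h4).2 i p le_rfl h1 h2)
    (fun i p k h1 h2 h3 h4 => by
      have h0 := (hne i k h3 h4).1
      have := (hne i k h3 h4).2 p k h1 h2 le_rfl
      have e : (v i p k - v i i k) / (v i k k - v i i k)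
        = 1 - (v i k k - v i p k) / (v i k k - v i i k) := by field_simp; ring
      rw [e]; linarith)
    (fun i j p l k h1 h2 h3 h4 h5 h6 => by
      have h0 := (hne i k (by omega) h6).1
      have h0' := (hne j l h5 (by omega)).1
      have := hcomp i j l k h1 h5 h4 h6 p j l j h2 h3 le_rfl h5.le h5.le le_rfl le_rfl h5.le
      field_simp
      linear_combination this)
  refine ⟨⟨u, hu⟩, funext fun S => ?_⟩
  symm
  have hS := subset_interval σ S
  obtain ⟨a, ha, hae⟩ := exists_lo σ S
  obtain ⟨b, hb, hbe⟩ := exists_hi σ S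
  -- The smallest interval containing `S` has its ends in `S` and separates them, so its restriction
  -- to `S` is not constant and determines the coordinate `S`.
  set T := interval σ ⟨lo_lt_hi σ S, hi_lt σ S⟩ with hT
  have hvT : ∀ c, v (lo σ S) (σ.symm c) (hi σ S) = (x T).rep.1 c := by
    intro c
    rw [hvpos _ _ _ ⟨lo_lt_hi σ S, hi_lt σ S⟩ (σ.symm c).2]
    simp only [Fin.eta, Equiv.apply_symm_apply]
    rfl
  have h0 := (hne _ _ (lo_lt_hi σ S) (hi_lt σ S)).1
  have hvec : ∀ c ∈ S.1, chartVec σ u S c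
      = ((x T).rep.1 c - (x T).rep.1 a) / ((x T).rep.1 b - (x T).rep.1 a) := by
    intro c hc
    rw [chartVec, hrel _ _ _ (lo_le hc) (le_hi hc) (lo_lt_hi σ S) (hi_lt σ S), hvT]
    rw [← hae, ← hbe, hae, hbe]
    have ea := hvT a
    have eb := hvT b
    rw [hae] at ea
    rw [hbe] at eb
    rw [ea, eb]
  rw [← hvT a, ← hvT b, hae, hbe] at hvec
  refine eq_mk_ctr (x S) _ ((x S).rep.1 b - (x S).rep.1 a) fun i hi' j hj => ?_
  have := hx S T hS i hi' j hj b hb a ha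
  rw [hvec i hi', hvec j hj]
  have ea := hvT a
  have eb := hvT b
  rw [hae] at ea
  rw [hbe] at eb
  rw [ea, eb] at h0 ⊢
  field_simp
  linear_combination (-1 : ℝ) * this

end

section

/-! ### The closed tiles of `Mbar n` -/

/-- The ratio matrices of strictly increasing sequences. -/
def IsGeneric (n : ℕ) (u : ℕ → ℕ → ℝ) : Prop :=
  ∀ i k, i + 1 < k → k < n → 0 < u i k ∧ u i k < 1

/-- The ratio matrix of the sequence `0, 1, 2, …`. Its free entries are all the entries that are not
forced to vanish, so its face is the whole space. -/
lemma exists_generic (n : ℕ) :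
    ∃ w, IsRatio n w ∧ IsGeneric n w ∧ ∀ u, IsRatio n u → FaceLE u w := by
  have hpos : ∀ i k : ℕ, i < k → (0 : ℝ) < (k : ℝ) - i := fun i k h => by
    have : (i : ℝ) < k := by exact_mod_cast h
    linarith
  obtain ⟨w, hw, hg⟩ := isRatio_of_positions (n := n)
    (g := fun i p k => ((p : ℝ) - i) / ((k : ℝ) - i)) (fun i k _ _ => by simp)
    (fun i k h _ => div_self (hpos i k h).ne')
    (fun i p k h _ h' _ => div_nonneg (sub_nonneg.2 (by exact_mod_cast h)) (hpos i k h').le)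
    (fun i p k _ h h' _ => by
      rw [div_le_one (hpos i k h')]
      have : (p : ℝ) ≤ k := by exact_mod_cast h
      linarith)
    (fun i j p l k h1 h2 h3 h4 h5 h6 => by
      have e1 := (hpos i k (by omega)).ne'
      have e2 := (hpos j l h5).ne'
      field_simp
      ring)
  have hgen : IsGeneric n w := by
    intro i k hik hk
    rw [← relPos_pred (u := w) (by omega : i < k), hg i (k - 1) k (by omega) (by omega) (by omega) hk]
    have h1 := hpos i k (by omega)
    have h2 := hpos i (k - 1) (by omega)
    refine ⟨div_pos h2 h1, ?_⟩
    rw [div_lt_one h1, Nat.cast_sub (by omega)]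
    push_cast
    linarith
  refine ⟨w, hw, hgen, fun u hu i k => ?_⟩
  by_cases h : i + 1 < k ∧ k < n
  · have := hgen i k h.1 h.2
    exact ⟨fun e => by linarith, fun e => by linarith⟩
  · have hz : ∀ v, IsRatio n v → v i k = 0 := by
      intro v hv
      by_cases h1 : k = i + 1
      · rw [h1]; exact hv.diag i
      · exact hv.support i k (by omega)
    rw [hz u hu, hz w hw]
    exact ⟨id, id⟩

/-- Generic ratio matrices are dense. -/
lemma Ratios.mem_of_generic {n : ℕ} {p : Set (Ratios n)} (hp : IsClosed p)
    (h : ∀ u : Ratios n, IsGeneric n u.1 → u ∈ p) (u : Ratios n) : u ∈ p := by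
  obtain ⟨w, hw, hgen, hmax⟩ := exists_generic n
  obtain ⟨φ, hφ⟩ := exists_isCellMap_ratioFace hw
  have hcl : IsClosed (Subtype.val '' p : Set (ℕ → ℕ → ℝ)) :=
    (isClosed_setOf_isRatio n).isClosedEmbedding_subtypeVal.isClosedMap p hp
  have hsub : {u ∈ ratioFace n w | FaceLE w u} ⊆ (Subtype.val '' p : Set (ℕ → ℕ → ℝ)) := by
    rintro v ⟨⟨hv, -⟩, hv2⟩
    refine ⟨⟨v, hv⟩, h _ fun i k hik hk => ?_, rfl⟩
    have := hgen i k hik hk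
    exact ⟨(hv.nonneg i k).lt_of_ne' fun e => this.1.ne' ((hv2 i k).1 e),
      (hv.le_one i k).lt_of_ne fun e => this.2.ne ((hv2 i k).2 e)⟩
  have := closure_minimal hsub hcl
  rw [hφ.closure_eq] at this
  obtain ⟨v, hv, he⟩ := this ⟨u.2, hmax u.1 u.2⟩
  rwa [Subtype.ext he] at hv

lemma relPos_lt_of_generic {n : ℕ} {u : ℕ → ℕ → ℝ} (hu : IsRatio n u) (hg : IsGeneric n u)
    {p q : ℕ} (hpq : p < q) (hq : q < n) : relPos u 0 p (n - 1) < relPos u 0 q (n - 1) := by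
  rw [relPos_mul u 0 hpq.le (by omega)]
  have h1 : 0 < relPos u 0 q (n - 1) := Finset.prod_pos fun l hl => by
    simp only [Finset.mem_Ioc] at hl
    exact (hg 0 l (by omega) (by omega)).1
  have h2 : relPos u 0 p q < 1 := by
    refine (hu.relPos_le hpq le_rfl).trans_lt ?_
    by_cases h : q = 1
    · rw [h, hu.diag 0]; exact zero_lt_one
    · exact (hg 0 q (by omega) hq).2
  exact mul_lt_of_lt_one_left h1 h2

variable {n : ℕ} (σ : Equiv.Perm (Fin n))

/-- The increasing sequence attached to a ratio matrix. -/
def globalVec (u : ℕ → ℕ → ℝ) (j : Fin n) : ℝ := relPos u 0 (σ.symm j) (n - 1)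

lemma globalVec_injective {u : ℕ → ℕ → ℝ} (hu : IsRatio n u) (hg : IsGeneric n u) :
    Function.Injective (globalVec σ u) := by
  intro i j h
  have hs : StrictMono fun p : Fin n => relPos u 0 p (n - 1) := fun p q hpq =>
    relPos_lt_of_generic hu hg hpq q.2
  exact σ.symm.injective (hs.injective h)

/-- For generic ratios, the positions in the full interval are distinct numbers, and each coordinate
of the chart is an affine rescaling of them. -/
lemma chart_eq_conf (u : Ratios n) (hg : IsGeneric n u.1) :
    chart σ u = conf (globalVec σ u.1) (globalVec_injective σ u.2 hg) := by
  funext S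
  symm
  refine mk_congr _ _ (relPos u.1 0 (hi σ S) (n - 1) - relPos u.1 0 (lo σ S) (n - 1)) ?_
  rw [← map_smul]
  refine ctr_congr (relPos u.1 0 (lo σ S) (n - 1)) fun i hi' => ?_
  have hlt := hi_lt σ S
  have := u.2.relPos_sub' (Nat.zero_le (lo σ S)) (lo_le hi') (le_hi hi')
    (by omega : hi σ S ≤ n - 1) (by omega) (lo_lt_hi σ S)
  simp only [globalVec, Pi.smul_apply, smul_eq_mul, chartVec]
  linear_combination this

lemma chart_mem_Mbar (u : Ratios n) : chart σ u ∈ Mbar n :=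
  Ratios.mem_of_generic (p := {u | chart σ u ∈ Mbar n})
    (isClosed_closure.preimage (continuous_chart σ))
    (fun u hg => subset_closure ⟨_, _, chart_eq_conf σ u hg⟩) u

lemma exists_strictMono {a : Fin n → ℝ} (ha : Function.Injective a) :
    ∃ σ : Equiv.Perm (Fin n), StrictMono (a ∘ σ) :=
  ⟨Tuple.sort a, (Tuple.monotone_sort a).strictMono_of_injective
    (ha.comp (Tuple.sort a).injective)⟩

lemma isMono_conf {σ : Equiv.Perm (Fin n)} {a : Fin n → ℝ} (ha : Function.Injective a)
    (h : StrictMono (a ∘ σ)) : IsMono σ (conf a ha) :=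
  isMono_mk (fun _ => a) _ fun _ i _ j _ hij => by
    have := h.monotone hij
    simpa using this

lemma compat_of_mem_Mbar {x : Fam n} (hx : x ∈ Mbar n) : Compat x := by
  refine closure_minimal (t := {x | Compat x}) ?_ (isClosed_setOf_compat n) hx
  rintro _ ⟨a, ha, rfl⟩
  exact compat_conf a ha

/-- The finitely many closed conditions `IsMono σ` cover the dense set of configurations, hence its
closure. -/
lemma exists_isMono {x : Fam n} (hx : x ∈ Mbar n) : ∃ σ, IsMono σ x := by
  have hcl : IsClosed (⋃ σ : Equiv.Perm (Fin n), {x : Fam n | IsMono σ x}) :=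
    isClosed_iUnion_of_finite fun σ => isClosed_setOf_isMono σ
  have := closure_minimal ?_ hcl hx
  · simpa using this
  · rintro _ ⟨a, ha, rfl⟩
    obtain ⟨σ, hσ⟩ := exists_strictMono ha
    exact mem_iUnion.2 ⟨σ, isMono_conf ha hσ⟩

/-- The chart of the closed tile of `σ`, with values in `Mbar n`. -/
def chartBar (u : Ratios n) : Mbar n := ⟨chart σ u, chart_mem_Mbar σ u⟩

/-- The face order of `Mbar n`. -/
def BarLE (y x : Mbar n) : Prop := FamLE y.1 x.1

variable {σ}

lemma mem_range_chartBar_iff {x : Mbar n} : x ∈ range (chartBar σ) ↔ IsMono σ x.1 := by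
  constructor
  · rintro ⟨u, rfl⟩; exact isMono_chart σ u
  · intro h
    obtain ⟨u, hu⟩ := exists_chart_eq (compat_of_mem_Mbar x.2) h
    exact ⟨u, Subtype.ext hu⟩

lemma exists_cellular_bar (n : ℕ) : ∃ dim, Cellular (BarLE (n := n)) dim :=
  exists_cellular (n := n) (fun x => FamLE.refl x.1) (fun _ _ _ h h' => FamLE.trans h h')
    (ψ := chartBar) (fun σ => (continuous_chart σ).subtype_mk _)
    (fun σ _ _ h => chart_injective σ (congrArg Subtype.val h))
    (fun σ u v => famLE_chart_iff σ u v)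
    (fun _ _ _ h => mem_range_chartBar_iff.2 (IsMono.of_le (isMono_chart _ _) h))
    (fun x => (exists_isMono x.2).imp fun _ h => mem_range_chartBar_iff.2 h)

instance : CompactSpace (Mbar n) := isCompact_iff_compactSpace.1 isClosed_closure.isCompact

/-! ### The closed tiles of `Mtil n` -/

/-- The full index set. -/
def univBig (hn : 2 ≤ n) : Big n := ⟨Finset.univ, by simpa using hn⟩

lemma lo_univBig (σ : Equiv.Perm (Fin n)) (hn : 2 ≤ n) : lo σ (univBig hn) = 0 := by
  have := lo_le (σ := σ) (S := univBig hn) (j := σ ⟨0, by omega⟩) (Finset.mem_univ _)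
  simpa using this

lemma hi_univBig (σ : Equiv.Perm (Fin n)) (hn : 2 ≤ n) : hi σ (univBig hn) = n - 1 := by
  have := le_hi (σ := σ) (S := univBig hn) (j := σ ⟨n - 1, by omega⟩) (Finset.mem_univ _)
  simp only [Equiv.symm_apply_apply] at this
  have := hi_lt σ (univBig hn)
  omega

lemma chartVec_univBig (σ : Equiv.Perm (Fin n)) (hn : 2 ≤ n) (u : ℕ → ℕ → ℝ) :
    chartVec σ u (univBig hn) = globalVec σ u := by
  funext j
  rw [chartVec, lo_univBig, hi_univBig, globalVec]

/-- The point of the unit sphere of `{a | ∑ a i = 0}` in the direction of `v`. -/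
def sph (v : Fin n → ℝ) : Fin n → ℝ :=
  (√(∑ m, (ctr Finset.univ v).1 m ^ 2))⁻¹ • (ctr Finset.univ v).1

lemma sph_apply (v : Fin n → ℝ) (i : Fin n) : sph v i =
    (√(∑ m, (ctr Finset.univ v).1 m ^ 2))⁻¹ * (v i - (∑ j, v j) / n) := by
  rw [← ctr_univ_apply]; rfl

lemma sum_sph (v : Fin n → ℝ) : ∑ i, sph v i = 0 := by
  have := (ctr Finset.univ v).2.2
  simp only [sph, Pi.smul_apply, smul_eq_mul, ← Finset.mul_sum]
  rw [this, mul_zero]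

lemma sum_sq_sph {v : Fin n → ℝ} (hv : ctr Finset.univ v ≠ 0) : ∑ i, sph v i ^ 2 = 1 := by
  have := sum_sq_pos hv
  simp only [sph, Pi.smul_apply, smul_eq_mul, mul_pow, ← Finset.mul_sum]
  rw [inv_pow, Real.sq_sqrt this.le, inv_mul_cancel₀ this.ne']

lemma sph_factor_pos {v : Fin n → ℝ} (hv : ctr Finset.univ v ≠ 0) :
    0 < (√(∑ m, (ctr Finset.univ v).1 m ^ 2))⁻¹ :=
  inv_pos.2 (Real.sqrt_pos.2 (sum_sq_pos hv))

lemma sph_le_iff {v : Fin n → ℝ} (hv : ctr Finset.univ v ≠ 0) (i j : Fin n) :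
    sph v i ≤ sph v j ↔ v i ≤ v j := by
  rw [sph_apply, sph_apply, mul_le_mul_iff_right₀ (sph_factor_pos hv), sub_le_sub_iff_right]

lemma conf_affine {a w : Fin n → ℝ} (ha : Function.Injective a) (hw : Function.Injective w)
    (c d : ℝ) (h : ∀ i, a i = c * w i + d) : conf a ha = conf w hw := by
  funext S
  refine mk_congr _ _ c ?_
  rw [← map_smul]
  exact ctr_congr d fun i _ => h i

/-- On the unit sphere the denominator of `cross` is `1`, so the last condition says that the sphere
vector and the full coordinate of the family agree up to sign. -/
lemma isClosed_Mtil_rel (hn : 2 ≤ n) : IsClosed {x : (Fin n → ℝ) × Fam n |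
    ∑ i, x.1 i = 0 ∧ ∑ i, x.1 i ^ 2 = 1 ∧ x.2 ∈ Mbar n ∧ ∀ i j k l,
      cross (x.2 (univBig hn)) i j k l = (x.1 i - x.1 j) * (x.1 k - x.1 l)} := by
  have hc : ∀ i, Continuous fun x : (Fin n → ℝ) × Fam n => x.1 i := fun i => by fun_prop
  refine IsClosed.inter (isClosed_eq (by fun_prop) continuous_const) (IsClosed.inter
    (isClosed_eq (by fun_prop) continuous_const) (IsClosed.inter
    (isClosed_closure.preimage continuous_snd) ?_))
  change IsClosed {x : (Fin n → ℝ) × Fam n | ∀ i j k l,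
    cross (x.2 (univBig hn)) i j k l = (x.1 i - x.1 j) * (x.1 k - x.1 l)}
  simp only [ofPred_forall]
  refine isClosed_iInter fun i => isClosed_iInter fun j => isClosed_iInter fun k =>
    isClosed_iInter fun l => isClosed_eq ?_ (by fun_prop)
  exact (continuous_cross (univBig hn).1 i j k l).comp ((continuous_apply _).comp continuous_snd)

lemma Mtil_rel (hn : 2 ≤ n) {x : (Fin n → ℝ) × Fam n} (hx : x ∈ Mtil n) :
    ∑ i, x.1 i = 0 ∧ ∑ i, x.1 i ^ 2 = 1 ∧ x.2 ∈ Mbar n ∧ ∀ i j k l,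
      cross (x.2 (univBig hn)) i j k l = (x.1 i - x.1 j) * (x.1 k - x.1 l) := by
  refine closure_minimal ?_ (isClosed_Mtil_rel hn) hx
  rintro ⟨a, y⟩ ⟨⟨h1, h2⟩, ha, h3⟩
  dsimp only at h1 h2 ha h3
  subst h3
  refine ⟨h1, h2, subset_closure ⟨a, ha, rfl⟩, fun i j k l => ?_⟩
  have hu : ∀ i, (ctr Finset.univ a).1 i = a i := fun i => by
    rw [ctr_univ_apply, h1]; simp
  refine (cross_mk (ctr Finset.univ a) _ i j k l).trans ?_
  simp only [hu, h2, div_one]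

/-- The chart of the closed tile of `σ` in the double cover. -/
def chartTilFam (σ : Equiv.Perm (Fin n)) (u : Ratios n) : (Fin n → ℝ) × Fam n :=
  (sph (globalVec σ u.1), chart σ u)

lemma ctr_globalVec_ne_zero (σ : Equiv.Perm (Fin n)) (hn : 2 ≤ n) (u : Ratios n) :
    ctr Finset.univ (globalVec σ u.1) ≠ 0 := by
  have := ctr_chartVec_ne_zero σ u (univBig hn)
  rwa [chartVec_univBig] at this

lemma continuous_chartTilFam (σ : Equiv.Perm (Fin n)) (hn : 2 ≤ n) :
    Continuous (chartTilFam σ) := by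
  refine Continuous.prodMk ?_ (continuous_chart σ)
  have hg : Continuous fun u : Ratios n => globalVec σ u.1 := by
    refine continuous_pi fun j => ?_
    unfold globalVec relPos
    exact continuous_finsetProd _ fun l _ =>
      (continuous_apply_apply 0 l).comp continuous_subtype_val
  have hcc : Continuous fun u : Ratios n => (ctr Finset.univ (globalVec σ u.1)).1 :=
    continuous_subtype_val.comp ((continuous_ctr _).comp hg)
  refine Continuous.smul (Continuous.inv₀ (Continuous.sqrt ?_) fun u => ?_) hcc
  · exact continuous_finsetSum _ fun i _ => ((continuous_apply i).comp hcc).pow 2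
  · exact (Real.sqrt_pos.2 (sum_sq_pos (ctr_globalVec_ne_zero σ hn u))).ne'

lemma chartTilFam_mem (σ : Equiv.Perm (Fin n)) (hn : 2 ≤ n) (u : Ratios n) :
    chartTilFam σ u ∈ Mtil n := by
  refine Ratios.mem_of_generic (p := {u | chartTilFam σ u ∈ Mtil n})
    (isClosed_closure.preimage (continuous_chartTilFam σ hn)) (fun u hg => subset_closure ?_) u
  have hv := ctr_globalVec_ne_zero σ hn u
  have hinj := globalVec_injective σ u.2 hg
  have hs : Function.Injective (sph (globalVec σ u.1)) := fun i j h =>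
    hinj (le_antisymm ((sph_le_iff hv i j).1 h.le) ((sph_le_iff hv j i).1 h.ge))
  refine ⟨⟨sum_sph _, sum_sq_sph hv⟩, hs, ?_⟩
  refine (chart_eq_conf σ u hg).trans (Eq.symm ?_)
  refine conf_affine hs hinj
    (√(∑ m, (ctr Finset.univ (globalVec σ u.1)).1 m ^ 2))⁻¹ (-((√(∑ m, (ctr Finset.univ (globalVec σ u.1)).1 m ^ 2))⁻¹ *
    ((∑ j, globalVec σ u.1 j) / n))) fun i => ?_
  exact (sph_apply _ i).trans (by ring)

/-- Monotone centred vectors are determined by the products of their differences. -/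
lemma eq_of_products {a b : Fin n → ℝ} (ha : ∑ i, a i = 0) (hb : ∑ i, b i = 0)
    (h : ∀ i j, (a i - a j) * (a i - a j) = (b i - b j) * (b i - b j))
    (hma : ∀ i j, σ.symm i ≤ σ.symm j → a i ≤ a j) (hmb : ∀ i j, σ.symm i ≤ σ.symm j → b i ≤ b j) :
    a = b := by
  have key : ∀ i j, a i - a j = b i - b j := by
    have key' : ∀ i j, σ.symm j ≤ σ.symm i → a i - a j = b i - b j := fun i j hij => by
      have h1 := sub_nonneg.2 (hma j i hij)
      have h2 := sub_nonneg.2 (hmb j i hij)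
      exact (mul_self_inj h1 h2).1 (h i j)
    intro i j
    rcases le_total (σ.symm j) (σ.symm i) with hij | hij
    · exact key' i j hij
    · linarith [key' j i hij]
  funext i
  have h1 : ∑ j, (a i - a j) = ∑ j, (b i - b j) := Finset.sum_congr rfl fun j _ => key i j
  simp only [Finset.sum_sub_distrib, ha, hb, sub_zero, Finset.sum_const, nsmul_eq_mul] at h1
  have hn : (Finset.univ : Finset (Fin n)).card ≠ 0 := Finset.card_ne_zero.2 ⟨i, Finset.mem_univ i⟩
  exact mul_left_cancel₀ (by exact_mod_cast hn) h1

/-- Weak monotonicity of both parts of a point of the double cover. -/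
def IsMonoTil (σ : Equiv.Perm (Fin n)) (x : (Fin n → ℝ) × Fam n) : Prop :=
  IsMono σ x.2 ∧ ∀ i j, σ.symm i ≤ σ.symm j → x.1 i ≤ x.1 j

lemma isClosed_setOf_isMonoTil (σ : Equiv.Perm (Fin n)) :
    IsClosed {x : (Fin n → ℝ) × Fam n | IsMonoTil σ x} := by
  refine ((isClosed_setOf_isMono σ).preimage continuous_snd).inter ?_
  change IsClosed {x : (Fin n → ℝ) × Fam n | ∀ i j, σ.symm i ≤ σ.symm j → x.1 i ≤ x.1 j}
  simp only [ofPred_forall]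
  exact isClosed_iInter fun i => isClosed_iInter fun j => isClosed_iInter fun _ =>
    isClosed_le (by fun_prop) (by fun_prop)

/-- The face order of the double cover. -/
def TilLE (y x : Mtil n) : Prop :=
  FamLE y.1.2 x.1.2 ∧ ∀ i j, x.1.1 i ≤ x.1.1 j → y.1.1 i ≤ y.1.1 j

lemma exists_isMonoTil {x : (Fin n → ℝ) × Fam n} (hx : x ∈ Mtil n) : ∃ σ, IsMonoTil σ x := by
  have hcl : IsClosed (⋃ σ : Equiv.Perm (Fin n), {x : (Fin n → ℝ) × Fam n | IsMonoTil σ x}) :=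
    isClosed_iUnion_of_finite fun σ => isClosed_setOf_isMonoTil σ
  have := closure_minimal ?_ hcl hx
  · simpa using this
  · rintro ⟨a, y⟩ ⟨-, ha, h3⟩
    dsimp only at ha h3
    subst h3
    obtain ⟨σ, hσ⟩ := exists_strictMono ha
    refine mem_iUnion.2 ⟨σ, isMono_conf ha hσ, fun i j hij => ?_⟩
    simpa using hσ.monotone hij

/-- The chart of the closed tile of `σ`, with values in `Mtil n`. -/
def chartTil (hn : 2 ≤ n) (σ : Equiv.Perm (Fin n)) (u : Ratios n) : Mtil n :=
  ⟨chartTilFam σ u, chartTilFam_mem σ hn u⟩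

lemma isMonoTil_chartTil (hn : 2 ≤ n) (u : Ratios n) : IsMonoTil σ (chartTil hn σ u).1 :=
  ⟨isMono_chart σ u, fun i j hij => (sph_le_iff (ctr_globalVec_ne_zero σ hn u) i j).2
    (u.2.relPos_mono _ _ hij)⟩

/-- The family determines the sphere vector up to sign, and the sign is fixed because both vectors
increase along `σ`. -/
lemma chartTil_eq (hn : 2 ≤ n) {x : Mtil n} (hx : IsMonoTil σ x.1) {u : Ratios n}
    (hu : chart σ u = x.1.2) : chartTil hn σ u = x := by
  obtain ⟨h1, h2, h3, h4⟩ := Mtil_rel hn x.2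
  obtain ⟨k1, k2, k3, k4⟩ := Mtil_rel hn (chartTil hn σ u).2
  refine Subtype.ext (Prod.ext ?_ hu)
  refine eq_of_products k1 h1 (fun i j => ?_) (isMonoTil_chartTil hn u).2 hx.2
  rw [← h4, ← k4, ← hu]
  rfl

lemma mem_range_chartTil_iff (hn : 2 ≤ n) {x : Mtil n} :
    x ∈ range (chartTil hn σ) ↔ IsMonoTil σ x.1 := by
  constructor
  · rintro ⟨u, rfl⟩; exact isMonoTil_chartTil hn u
  · intro h
    obtain ⟨u, hu⟩ := exists_chart_eq (compat_of_mem_Mbar (Mtil_rel hn x.2).2.2.1) h.1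
    exact ⟨u, chartTil_eq hn h hu⟩

lemma tilLE_chartTil_iff (hn : 2 ≤ n) (u w : Ratios n) :
    TilLE (chartTil hn σ u) (chartTil hn σ w) ↔ FaceLE u.1 w.1 := by
  constructor
  · exact fun h => (famLE_chart_iff σ u w).1 h.1
  · intro h
    refine ⟨(famLE_chart_iff σ u w).2 h, fun i j hij => ?_⟩
    change sph _ i ≤ sph _ j at hij
    change sph _ i ≤ sph _ j
    rw [sph_le_iff (ctr_globalVec_ne_zero σ hn _)] at hij ⊢
    rcases le_total (σ.symm i) (σ.symm j) with hs | hs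
    · exact u.2.relPos_mono _ _ hs
    · have := w.2.relPos_mono 0 (n - 1) hs
      have hj : (σ.symm i : ℕ) ≤ n - 1 := by have := (σ.symm i).2; omega
      exact (u.2.relPos_eq_of_faceLE w.2 h hs hj (le_antisymm this hij)).ge

lemma TilLE.refl (x : Mtil n) : TilLE x x := ⟨FamLE.refl _, fun _ _ h => h⟩

lemma TilLE.trans {x y z : Mtil n} (h : TilLE x y) (h' : TilLE y z) : TilLE x z :=
  ⟨h.1.trans h'.1, fun i j hij => h.2 i j (h'.2 i j hij)⟩

lemma IsMonoTil.of_le {x y : Mtil n} (hx : IsMonoTil σ x.1) (h : TilLE y x) : IsMonoTil σ y.1 :=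
  ⟨hx.1.of_le h.1, fun i j hij => h.2 i j (hx.2 i j hij)⟩

lemma exists_cellular_til (hn : 2 ≤ n) : ∃ dim, Cellular (TilLE (n := n)) dim :=
  exists_cellular (n := n) TilLE.refl (fun _ _ _ h h' => h.trans h')
    (ψ := chartTil hn) (fun s => (continuous_chartTilFam s hn).subtype_mk _)
    (fun s _ _ h => chart_injective s (congrArg (fun x => x.1.2) h))
    (fun _ u v => tilLE_chartTil_iff hn u v)
    (fun _ _ _ h => (mem_range_chartTil_iff hn).2 ((isMonoTil_chartTil hn _).of_le h))
    (fun x => (exists_isMonoTil x.2).imp fun _ h => (mem_range_chartTil_iff hn).2 h)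

end

section

/-! ### Trees of compatible families -/

variable {n : ℕ} {σ : Equiv.Perm (Fin n)}

/-- The set `S` is collapsed by all the coordinates indexed by strictly larger sets: the curve has
a node separating `S` from the other marked points. -/
def InTree (x : Fam n) (S : Finset (Fin n)) : Prop :=
  ∀ T : Big n, S ⊂ T.1 → ∀ p ∈ S, ∀ q ∈ S, SameAt x T p q

lemma sameAt_iff_cross {x : Fam n} {S : Big n} {p q : Fin n} :
    SameAt x S p q ↔ cross (x S) p q p q = 0 := by
  rw [cross, div_eq_zero_iff, or_iff_left (sum_sq_pos (x S).rep_nonzero).ne', mul_self_eq_zero,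
    sub_eq_zero]
  rfl

lemma isClosed_setOf_inTree (S : Finset (Fin n)) : IsClosed {x : Fam n | InTree x S} := by
  simp only [InTree, sameAt_iff_cross, ofPred_forall]
  refine isClosed_iInter fun T => isClosed_iInter fun _ => isClosed_iInter fun p =>
    isClosed_iInter fun _ => isClosed_iInter fun q => isClosed_iInter fun _ =>
    isClosed_eq ?_ continuous_const
  exact (continuous_cross T.1 p q p q).comp (continuous_apply T)

lemma InTree.of_le {x y : Fam n} {S : Finset (Fin n)} (h : InTree x S) (hyx : FamLE y x) :
    InTree y S := fun T hT p hp q hq => hyx.sameAt (hT.1 hp) (hT.1 hq) (h T hT p hp q hq)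

lemma exists_not_sameAt (x : Fam n) (S : Big n) : ∃ i ∈ S.1, ∃ j ∈ S.1, ¬ SameAt x S i j :=
  exists_rep_ne (x S)

/-- The restriction of the coordinate `T` to `S` is a multiple of the coordinate `S`, and the
multiple is nonzero once `T` separates two points of `S`. In the other direction,
`Compat.sameAt_up`, a zero multiple does no harm. -/
lemma Compat.sameAt_down {x : Fam n} (hx : Compat x) {S T : Big n} (hST : S.1 ⊆ T.1)
    {p q r s : Fin n} (hp : p ∈ S.1) (hq : q ∈ S.1) (hr : r ∈ S.1) (hs : s ∈ S.1)
    (hrs : ¬ SameAt x T r s) (hpq : SameAt x T p q) : SameAt x S p q := by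
  have := hx S T hST r hr s hs p hp q hq
  rw [SameAt] at hpq hrs ⊢
  rw [hpq, sub_self, zero_mul, mul_eq_zero, or_iff_right (sub_ne_zero.2 hrs), sub_eq_zero] at this
  exact this

lemma Compat.sameAt_up {x : Fam n} (hx : Compat x) {S T : Big n} (hST : S.1 ⊆ T.1)
    {p q : Fin n} (hp : p ∈ S.1) (hq : q ∈ S.1) (hpq : SameAt x S p q) : SameAt x T p q := by
  obtain ⟨r, hr, s, hs, hrs⟩ := exists_not_sameAt x S
  have := hx S T hST p hp q hq r hr s hs
  rw [SameAt] at hpq hrs ⊢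
  rw [hpq, sub_self, mul_zero, mul_eq_zero, or_iff_left (sub_ne_zero.2 hrs), sub_eq_zero] at this
  exact this

/-- The union of two big sets. -/
def bigUnion (S T : Big n) : Big n :=
  ⟨S.1 ∪ T.1, S.2.trans (Finset.card_le_card Finset.subset_union_left)⟩

/-- Two overlapping collapsed sets would make the coordinate of their union constant. -/
lemma not_sameAt_of_union {x : Fam n} {S T : Big n} {c : Fin n} (hcS : c ∈ S.1) (hcT : c ∈ T.1)
    (hS : ∀ p ∈ S.1, ∀ q ∈ S.1, SameAt x (bigUnion S T) p q)
    (hT : ∀ p ∈ T.1, ∀ q ∈ T.1, SameAt x (bigUnion S T) p q) : False := by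
  obtain ⟨i, hi', j, hj, hij⟩ := exists_not_sameAt x (bigUnion S T)
  have key : ∀ i ∈ (bigUnion S T).1, SameAt x (bigUnion S T) i c := fun i hi' => by
    rcases Finset.mem_union.1 hi' with h | h
    · exact hS i h c hcS
    · exact hT i h c hcT
  exact hij ((key i hi').trans (key j hj).symm)

lemma ssubset_bigUnion_left {S T : Big n} (h : ¬ T.1 ⊆ S.1) : S.1 ⊂ (bigUnion S T).1 :=
  ⟨Finset.subset_union_left, fun h' => h (Finset.subset_union_right.trans h')⟩

lemma ssubset_bigUnion_right {S T : Big n} (h : ¬ S.1 ⊆ T.1) : T.1 ⊂ (bigUnion S T).1 :=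
  ⟨Finset.subset_union_right, fun h' => h (Finset.subset_union_left.trans h')⟩

/-- A member of the tree is collapsed by all the coordinates whose index sets it does not
contain. -/
lemma InTree.sameAt {x : Fam n} (hx : Compat x) {S I : Big n} (hS : InTree x S.1)
    (hI : ¬ I.1 ⊆ S.1) {p q : Fin n} (hp : p ∈ S.1) (hq : q ∈ S.1) (hp' : p ∈ I.1)
    (hq' : q ∈ I.1) : SameAt x I p q := by
  have hSU := hS _ (ssubset_bigUnion_left hI)
  by_cases h : ∀ r ∈ I.1, ∀ s ∈ I.1, SameAt x (bigUnion S I) r s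
  · exact (not_sameAt_of_union hp hp' hSU h).elim
  · push Not at h
    obtain ⟨r, hr, s, hs, hrs⟩ := h
    exact hx.sameAt_down Finset.subset_union_right hp' hq' hr hs hrs (hSU p hp q hq)

/-- Overlapping members of the tree are nested: otherwise both are strictly contained in their
union, whose coordinate would collapse each of them. -/
lemma InTree.laminar {x : Fam n} {S T : Big n} (hS : InTree x S.1) (hT : InTree x T.1)
    {c : Fin n} (hcS : c ∈ S.1) (hcT : c ∈ T.1) (h : ¬ T.1 ⊆ S.1) : S.1 ⊆ T.1 := by
  by_contra h'
  exact not_sameAt_of_union hcS hcT (hS _ (ssubset_bigUnion_left h))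
    (hT _ (ssubset_bigUnion_right h'))

/-- Points that a coordinate does not separate lie in a member of the tree. -/
lemma exists_inTree {x : Fam n} (hx : Compat x) {I : Big n} {p q : Fin n} (hp : p ∈ I.1)
    (hq : q ∈ I.1) (hpq : p ≠ q) (h : SameAt x I p q) :
    ∃ S : Center n, InTree x S.1 ∧ p ∈ S.1 ∧ q ∈ S.1 ∧ ¬ I.1 ⊆ S.1 := by
  classical
  -- The node is found by enlarging `{p, q}` as long as the set stays collapsed at its union with
  -- `I` and does not contain `I`. A set of maximal cardinality among these is a member of the tree.
  set 𝒮 : Finset (Finset (Fin n)) := Finset.univ.filter fun T => p ∈ T ∧ q ∈ T ∧ ¬ I.1 ⊆ T ∧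
    ∀ U : Big n, U.1 = T ∪ I.1 → ∀ r ∈ T, ∀ s ∈ T, SameAt x U r s with h𝒮
  have hmem : ∀ T, T ∈ 𝒮 ↔ p ∈ T ∧ q ∈ T ∧ ¬ I.1 ⊆ T ∧
    ∀ U : Big n, U.1 = T ∪ I.1 → ∀ r ∈ T, ∀ s ∈ T, SameAt x U r s := fun T => by simp [h𝒮]
  have hpair : ∀ r ∈ ({p, q} : Finset (Fin n)), ∀ s ∈ ({p, q} : Finset (Fin n)),
      SameAt x I r s := by
    intro r hr s hs
    simp only [Finset.mem_insert, Finset.mem_singleton] at hr hs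
    rcases hr with rfl | rfl <;> rcases hs with rfl | rfl
    · rfl
    · exact h
    · exact h.symm
    · rfl
  have hne : 𝒮.Nonempty := by
    refine ⟨{p, q}, (hmem _).2 ⟨by simp, by simp, fun hI => ?_, fun U hU r hr s hs => ?_⟩⟩
    · obtain ⟨i, hi', j, hj, hij⟩ := exists_not_sameAt x I
      exact hij (hpair i (hI hi') j (hI hj))
    · have : U = I := by
        refine Subtype.ext (hU.trans (Finset.union_eq_right.2 ?_))
        intro a ha
        simp only [Finset.mem_insert, Finset.mem_singleton] at ha
        rcases ha with rfl | rfl <;> assumption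
      rw [this]; exact hpair r hr s hs
  obtain ⟨T, hT, hmax⟩ := Finset.exists_max_image 𝒮 Finset.card hne
  obtain ⟨hpT, hqT, hIT, hsame⟩ := (hmem T).1 hT
  have hT2 : 2 ≤ T.card := Finset.one_lt_card.2 ⟨p, hpT, q, hqT, hpq⟩
  refine ⟨⟨T, hT2, fun he => hIT (by rw [he]; exact Finset.subset_univ _)⟩, ?_, hpT, hqT, hIT⟩
  intro T' hTT' a ha b hb
  by_contra hab
  -- the coordinate of `T' ∪ I` collapses `T`, hence `T'`
  set U := bigUnion T' I with hU
  have hUT : ∀ r ∈ T, ∀ s ∈ T, SameAt x U r s := by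
    intro r hr s hs
    have hsub : (bigUnion ⟨T, hT2⟩ I).1 ⊆ U.1 := Finset.union_subset_union_left hTT'.1
    exact hx.sameAt_up hsub (Finset.mem_union_left _ hr) (Finset.mem_union_left _ hs)
      (hsame _ rfl r hr s hs)
  have hUT' : ∀ r ∈ T'.1, ∀ s ∈ T'.1, SameAt x U r s := by
    by_contra hc
    push Not at hc
    obtain ⟨r, hr, s, hs, hrs⟩ := hc
    exact hab (hx.sameAt_down Finset.subset_union_left (hTT'.1 ha) (hTT'.1 hb) hr hs hrs
      (hUT a ha b hb))
  have hIT' : ¬ I.1 ⊆ T'.1 := fun hc => by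
    have : U = T' := Subtype.ext (Finset.union_eq_left.2 hc)
    obtain ⟨i, hi', j, hj, hij⟩ := exists_not_sameAt x T'
    exact hij (this ▸ hUT' i hi' j hj)
  -- A larger set that fails to collapse `T` would itself belong to `𝒮`, against maximality.
  have hT'mem : T'.1 ∈ 𝒮 := (hmem _).2 ⟨hTT'.1 hpT, hTT'.1 hqT, hIT', fun W hW r hr s hs => by
    have : W = U := Subtype.ext hW
    rw [this]; exact hUT' r hr s hs⟩
  have := hmax _ hT'mem
  exact absurd (Finset.card_lt_card hTT') (not_lt.2 this)

lemma IsMono.sameAt_between {x : Fam n} (hm : IsMono σ x) {S : Big n} {a b c : Fin n}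
    (ha : a ∈ S.1) (hb : b ∈ S.1) (hc : c ∈ S.1) (hab : σ.symm a ≤ σ.symm b)
    (hbc : σ.symm b ≤ σ.symm c) (h : SameAt x S a c) : SameAt x S a b := by
  obtain ⟨k, hk, hmono⟩ := hm.exists_rep S
  have h1 := hmono a ha b hb hab
  have h2 := hmono b hb c hc hbc
  rw [SameAt] at h ⊢
  rw [← h] at h2
  exact mul_left_cancel₀ hk (le_antisymm h1 h2)

lemma IsMono.not_sameAt_ends {x : Fam n} (hm : IsMono σ x) {S : Big n} {a b : Fin n}
    (ha : a ∈ S.1) (hb : b ∈ S.1) (hae : (σ.symm a : ℕ) = lo σ S) (hbe : (σ.symm b : ℕ) = hi σ S) :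
    ¬ SameAt x S a b := by
  intro h
  obtain ⟨i, hi', j, hj, hij⟩ := exists_not_sameAt x S
  have key : ∀ i ∈ S.1, SameAt x S a i := fun i hi' =>
    hm.sameAt_between ha hi' hb (by rw [Fin.le_def, hae]; exact lo_le hi')
      (by rw [Fin.le_def, hbe]; exact le_hi hi') h
  exact hij ((key i hi').symm.trans (key j hj))

/-- The members of the tree are intervals for every order in which the family is monotone. -/
lemma InTree.ordConnected {x : Fam n} (hm : IsMono σ x) {S : Finset (Fin n)} (hS : InTree x S)
    {a b c : Fin n} (ha : a ∈ S) (hc : c ∈ S) (hab : σ.symm a ≤ σ.symm b)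
    (hbc : σ.symm b ≤ σ.symm c) : b ∈ S := by
  classical
  by_contra hb
  have h2 : 2 ≤ (insert b S).card := Finset.one_lt_card.2
    ⟨a, Finset.mem_insert_of_mem ha, b, Finset.mem_insert_self _ _, fun h => hb (h ▸ ha)⟩
  have hss : S ⊂ insert b S := Finset.ssubset_insert hb
  have hsame := hS ⟨insert b S, h2⟩ hss
  have hab' := hm.sameAt_between (S := ⟨insert b S, h2⟩) (hss.1 ha) (Finset.mem_insert_self _ _)
    (hss.1 hc) hab hbc (hsame a ha c hc)
  obtain ⟨i, hi', j, hj, hij⟩ := exists_not_sameAt x ⟨insert b S, h2⟩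
  have key : ∀ i ∈ insert b S, SameAt x ⟨insert b S, h2⟩ a i := fun i hi' => by
    rcases Finset.mem_insert.1 hi' with rfl | h
    · exact hab'
    · exact hsame a ha i h
  exact hij ((key i hi').symm.trans (key j hj))

/-! ### A family with prescribed tree -/

section Depth

variable (m : ℕ → ℕ) (σ)

/-- The least depth of a gap in the range of `S`. -/
def minDepth (S : Big n) : ℕ :=
  ((Finset.Ico (lo σ S) (hi σ S)).image m).min' (by
    rw [Finset.image_nonempty, Finset.nonempty_Ico]; exact lo_lt_hi σ S)

lemma minDepth_le {S : Big n} {l : ℕ} (h1 : lo σ S ≤ l) (h2 : l < hi σ S) : minDepth σ m S ≤ m l :=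
  Finset.min'_le _ _ (Finset.mem_image_of_mem _ (Finset.mem_Ico.2 ⟨h1, h2⟩))

lemma exists_minDepth (S : Big n) : ∃ l, lo σ S ≤ l ∧ l < hi σ S ∧ m l = minDepth σ m S := by
  obtain ⟨l, hl, he⟩ := Finset.mem_image.1 (Finset.min'_mem
    ((Finset.Ico (lo σ S) (hi σ S)).image m) (by
      rw [Finset.image_nonempty, Finset.nonempty_Ico]; exact lo_lt_hi σ S))
  rw [Finset.mem_Ico] at hl
  exact ⟨l, hl.1, hl.2, he⟩

/-- The number of the gaps of depth `c` in `[a, b)`. -/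
def gapCount (c a b : ℕ) : ℝ := ∑ l ∈ Finset.Ico a b, if m l = c then 1 else 0

lemma gapCount_add (c : ℕ) {a b d : ℕ} (h1 : a ≤ b) (h2 : b ≤ d) :
    gapCount m c a d = gapCount m c a b + gapCount m c b d :=
  (Finset.sum_Ico_consecutive _ h1 h2).symm

lemma gapCount_nonneg (c a b : ℕ) : 0 ≤ gapCount m c a b :=
  Finset.sum_nonneg fun l _ => by split_ifs <;> norm_num

lemma gapCount_eq_zero_iff (c a b : ℕ) : gapCount m c a b = 0 ↔ ∀ l, a ≤ l → l < b → m l ≠ c := by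
  rw [gapCount, Finset.sum_eq_zero_iff_of_nonneg fun l _ => by split_ifs <;> norm_num]
  simp only [Finset.mem_Ico, and_imp, ite_eq_right_iff, one_ne_zero, imp_false]

/-- A monotone family in which the gaps of greater depth are infinitesimally small. -/
lemma exists_depth : ∃ x : Fam n, Compat x ∧ IsMono σ x ∧ ∀ S : Big n, ∀ i ∈ S.1, ∀ j ∈ S.1,
    σ.symm i ≤ σ.symm j → (SameAt x S i j ↔ ∀ l, (σ.symm i : ℕ) ≤ l → l < σ.symm j →
      ∃ l', lo σ S ≤ l' ∧ l' < hi σ S ∧ m l' < m l) := by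
  -- At the scale of `S` only the gaps of least depth in its range are visible; each of them gets
  -- length `1`, the others length `0`.
  set w : Big n → Fin n → ℝ := fun S j => gapCount m (minDepth σ m S) (lo σ S) (σ.symm j) with hw
  have hsub : ∀ S : Big n, ∀ i ∈ S.1, ∀ j ∈ S.1, σ.symm i ≤ σ.symm j →
      w S j = w S i + gapCount m (minDepth σ m S) (σ.symm i) (σ.symm j) := fun S i hi' j hj hij =>
    gapCount_add m _ (lo_le hi') hij
  have hzero : ∀ S : Big n, ∀ i ∈ S.1, ∀ j ∈ S.1, σ.symm i ≤ σ.symm j →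
      (w S i = w S j ↔ ∀ l, (σ.symm i : ℕ) ≤ l → l < σ.symm j →
      ∃ l', lo σ S ≤ l' ∧ l' < hi σ S ∧ m l' < m l) := by
    intro S i hi' j hj hij
    rw [hsub S i hi' j hj hij, left_eq_add, gapCount_eq_zero_iff]
    refine forall_congr' fun l => forall_congr' fun h1 => forall_congr' fun h2 => ?_
    have hl1 := lo_le (σ := σ) hi'
    have hl2 := le_hi (σ := σ) hj
    constructor
    · intro h
      obtain ⟨l', h3, h4, h5⟩ := exists_minDepth σ m S
      exact ⟨l', h3, h4, by
        rw [h5]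
        exact lt_of_le_of_ne (minDepth_le σ m (by omega) (by omega)) (Ne.symm h)⟩
    · rintro ⟨l', h3, h4, h5⟩
      have := minDepth_le σ m h3 h4
      omega
  have hne : ∀ S : Big n, ctr S.1 (w S) ≠ 0 := by
    intro S
    obtain ⟨a, ha, hae⟩ := exists_lo σ S
    obtain ⟨b, hb, hbe⟩ := exists_hi σ S
    refine ctr_ne_zero ha hb ?_
    have hab : σ.symm a ≤ σ.symm b := by rw [Fin.le_def, hae]; exact lo_le hb
    rw [Ne, hzero S a ha b hb hab]
    intro h
    obtain ⟨l, h3, h4, h5⟩ := exists_minDepth σ m S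
    obtain ⟨l', h6, h7, h8⟩ := h l (by omega) (by omega)
    have := minDepth_le σ m h6 h7
    omega
  refine ⟨fun S => Projectivization.mk ℝ (ctr S.1 (w S)) (hne S), ?_, ?_, ?_⟩
  · refine compat_mk w hne fun S T hST => ?_
    obtain ⟨a, ha, hae⟩ := exists_lo σ S
    have hlo : lo σ T ≤ lo σ S := by rw [← hae]; exact lo_le (hST ha)
    have e : ∀ i ∈ S.1, w T i = gapCount m (minDepth σ m T) (lo σ T) (lo σ S) +
        gapCount m (minDepth σ m T) (lo σ S) (σ.symm i) := fun i hi' =>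
      gapCount_add m _ hlo (lo_le hi')
    -- If the least depths agree, the two coordinates measure the same gaps and differ by a constant
    -- on `S`. If `T` has a smaller least depth, none of its visible gaps lies in the range of `S`,
    -- and it is constant there.
    by_cases hd : minDepth σ m T = minDepth σ m S
    · refine ⟨1, fun i hi' j hj => ?_⟩
      rw [e i hi', e j hj, hd]
      simp [hw]
    · refine ⟨0, fun i hi' j hj => ?_⟩
      have hz : ∀ i ∈ S.1, gapCount m (minDepth σ m T) (lo σ S) (σ.symm i) = 0 := by
        intro i hi'
        rw [gapCount_eq_zero_iff]
        intro l h1 h2 h3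
        obtain ⟨b, hb, hbe⟩ := exists_hi σ S
        have h4 := le_hi (σ := σ) hi'
        have h5 := le_hi (σ := σ) (hST hb)
        have h6 := minDepth_le σ m h1 (by omega : l < hi σ S)
        obtain ⟨l', h7, h8, h9⟩ := exists_minDepth σ m S
        have h10 := minDepth_le σ m (by omega : lo σ T ≤ l') (by omega : l' < hi σ T)
        omega
      rw [e i hi', e j hj, hz i hi', hz j hj]
      ring
  · refine isMono_mk w hne fun S i hi' j hj hij => ?_
    rw [hsub S i hi' j hj hij]
    linarith [gapCount_nonneg m (minDepth σ m S) (σ.symm i) (σ.symm j)]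
  · intro S i hi' j hj hij
    rw [sameAt_mk hne hi' hj]
    exact hzero S i hi' j hj hij

end Depth

/-- The number of the members of `B` that contain both ends of the gap `l`. -/
def gapDepth (σ : Equiv.Perm (Fin n)) (B : Set (Center n)) (l : ℕ) : ℕ :=
  open Classical in
  (Finset.univ.filter fun T : Center n => T ∈ B ∧ ∃ h : l + 1 < n,
    σ ⟨l, by omega⟩ ∈ T.1 ∧ σ ⟨l + 1, h⟩ ∈ T.1).card

lemma exists_of_gapDepth_lt {B : Set (Center n)} {l l' : ℕ}
    (h : gapDepth σ B l' < gapDepth σ B l) : ∃ T ∈ B, (∃ h : l + 1 < n,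
    σ ⟨l, by omega⟩ ∈ T.1 ∧ σ ⟨l + 1, h⟩ ∈ T.1) ∧ ¬ ∃ h : l' + 1 < n,
    σ ⟨l', by omega⟩ ∈ T.1 ∧ σ ⟨l' + 1, h⟩ ∈ T.1 := by
  classical
  by_contra hc
  push Not at hc
  refine absurd h (not_lt.2 (Finset.card_le_card fun T hT => ?_))
  simp only [Finset.mem_filter, Finset.mem_univ, true_and] at hT ⊢
  refine ⟨hT.1, ?_⟩
  exact hc T hT.1 hT.2

/-- Every member that contains the gap `l'` contains `S` and hence the gap `l`, while `S` itself
contributes to `l` only. -/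
lemma gapDepth_lt {B : Set (Center n)} {l l' : ℕ} {S : Center n} (hS : S ∈ B)
    (hl : ∃ h : l + 1 < n, σ ⟨l, by omega⟩ ∈ S.1 ∧ σ ⟨l + 1, h⟩ ∈ S.1)
    (hl' : ¬ ∃ h : l' + 1 < n, σ ⟨l', by omega⟩ ∈ S.1 ∧ σ ⟨l' + 1, h⟩ ∈ S.1)
    (h : ∀ T ∈ B, (∃ h : l' + 1 < n, σ ⟨l', by omega⟩ ∈ T.1 ∧ σ ⟨l' + 1, h⟩ ∈ T.1) → S.1 ⊆ T.1) :
    gapDepth σ B l' < gapDepth σ B l := by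
  classical
  refine Finset.card_lt_card (Finset.ssubset_iff_of_subset ?_ |>.2 ⟨S, ?_, ?_⟩)
  · intro T hT
    simp only [Finset.mem_filter, Finset.mem_univ, true_and] at hT ⊢
    obtain ⟨h1, h2, h3⟩ := hl
    have := h T hT.1 hT.2
    exact ⟨hT.1, h1, this h2, this h3⟩
  · simpa using ⟨hS, hl⟩
  · simp only [Finset.mem_filter, Finset.mem_univ, true_and, not_and]
    exact fun _ => hl'

/-- The largest family that is monotone for `σ` and has the members of `B` in its tree. -/
lemma exists_largest (B : Set (Center n)) {y : Fam n} (hym : IsMono σ y)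
    (hyB : ∀ S ∈ B, InTree y S.1) : ∃ x : Fam n, Compat x ∧ IsMono σ x ∧ (∀ S ∈ B, InTree x S.1) ∧
      (∀ z, Compat z → IsMono σ z → (∀ S ∈ B, InTree z S.1) → FamLE z x) ∧
      ∀ U : Big n, ∀ i ∈ U.1, ∀ j ∈ U.1, SameAt x U i j → i = j ∨
        ((∃ T ∈ B, i ∈ T.1) ∧ ∃ T ∈ B, j ∈ T.1) := by
  -- The more members of `B` a gap lies in, the smaller the scale on which it is opened.
  obtain ⟨x, hx, hxm, hlev⟩ := exists_depth σ (gapDepth σ B)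
  have hgap : ∀ i j : Fin n, (∀ l, (σ.symm i : ℕ) ≤ l → l < σ.symm j → ∃ T ∈ B, ∃ h : l + 1 < n,
      σ ⟨l, by omega⟩ ∈ T.1 ∧ σ ⟨l + 1, h⟩ ∈ T.1) → σ.symm i < σ.symm j →
      (∃ T ∈ B, i ∈ T.1) ∧ ∃ T ∈ B, j ∈ T.1 := by
    intro i j h hij
    constructor
    · obtain ⟨T, hT, h1, h2, h3⟩ := h (σ.symm i) le_rfl hij
      exact ⟨T, hT, by simpa using h2⟩
    · obtain ⟨T, hT, h1, h2, h3⟩ := h ((σ.symm j : ℕ) - 1) (by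
        rw [Fin.lt_def] at hij; omega) (by rw [Fin.lt_def] at hij; omega)
      refine ⟨T, hT, ?_⟩
      have e : (⟨(σ.symm j : ℕ) - 1 + 1, h1⟩ : Fin n) = σ.symm j := by
        rw [Fin.lt_def] at hij
        refine Fin.ext ?_
        dsimp only
        omega
      rw [e] at h3
      simpa using h3
  refine ⟨x, hx, hxm, ?_, ?_, ?_⟩
  · intro S hS T hST p hp q hq
    wlog hpq : σ.symm p ≤ σ.symm q generalizing p q
    · exact (this q hq p hp (le_of_not_ge hpq)).symm
    rw [hlev T p (hST.1 hp) q (hST.1 hq) hpq]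
    intro l h1 h2
    have hSB : 2 ≤ S.1.card := S.2.1
    have hord := fun (a b c : Fin n) => (hyB S hS).ordConnected (a := a) (b := b) (c := c) hym
    have hq' := (σ.symm q).2
    have hlS : ∃ h : l + 1 < n, σ ⟨l, by omega⟩ ∈ S.1 ∧ σ ⟨l + 1, h⟩ ∈ S.1 := by
      refine ⟨by omega, hord p _ q hp hq ?_ ?_, hord p _ q hp hq ?_ ?_⟩ <;>
        simp only [Equiv.symm_apply_apply, Fin.le_def] <;> omega
    obtain ⟨t, htT, htS⟩ := Finset.exists_of_ssubset hST
    obtain ⟨a, ha, hae⟩ := exists_lo σ ⟨S.1, hSB⟩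
    obtain ⟨b, hb, hbe⟩ := exists_hi σ ⟨S.1, hSB⟩
    -- As `S` is an interval, a point `t` of `T` outside `S` lies on one side of it. The gap just
    -- outside `S` on that side is in the range of `T` and, by laminarity, less deep than every gap
    -- inside `S`.
    have hcase : (σ.symm b : ℕ) < σ.symm t ∨ (σ.symm t : ℕ) < σ.symm a := by
      by_contra hc
      push Not at hc
      exact htS (hord a t b ha hb hc.2 hc.1)
    have hab : (σ.symm a : ℕ) ≤ σ.symm b := by rw [hae]; exact lo_le (S := ⟨S.1, hSB⟩) hb
    have hTt1 := lo_le (σ := σ) htT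
    have hTt2 := le_hi (σ := σ) htT
    have hTa := lo_le (σ := σ) (hST.1 ha)
    have hTb := le_hi (σ := σ) (hST.1 hb)
    have ht' := (σ.symm t).2
    have hlam : ∀ T ∈ B, ∀ c d, c ∈ S.1 → c ∈ T.1 → d ∈ T.1 → d ∉ S.1 → S.1 ⊆ T.1 := by
      intro T hT c d h1 h2 h3 h4
      exact InTree.laminar (S := ⟨S.1, hSB⟩) (T := ⟨T.1, T.2.1⟩) (hyB S hS) (hyB T hT) h1 h2
        fun h => h4 (h h3)
    rcases hcase with hc | hc
    · have hout : σ ⟨(σ.symm b : ℕ) + 1, by omega⟩ ∉ S.1 := fun h => by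
        have := le_hi (σ := σ) (S := ⟨S.1, hSB⟩) h
        rw [← hbe] at this
        simp at this
      refine ⟨σ.symm b, by omega, by omega, gapDepth_lt hS hlS ?_ fun T hT h => ?_⟩
      · rintro ⟨h3, -, h4⟩; exact hout h4
      · obtain ⟨h3, h4, h5⟩ := h
        exact hlam T hT b _ hb (by simpa using h4) h5 hout
    · have hout : σ ⟨(σ.symm a : ℕ) - 1, by omega⟩ ∉ S.1 := fun h => by
        have := lo_le (σ := σ) (S := ⟨S.1, hSB⟩) h
        rw [← hae] at this
        simp at this
        omega
      refine ⟨(σ.symm a : ℕ) - 1, by omega, by omega, gapDepth_lt hS hlS ?_ fun T hT h => ?_⟩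
      · rintro ⟨h3, h4, -⟩; exact hout h4
      · obtain ⟨h3, h4, h5⟩ := h
        have e : (⟨(σ.symm a : ℕ) - 1 + 1, h3⟩ : Fin n) = σ.symm a := by
          refine Fin.ext ?_
          dsimp only
          omega
        rw [e] at h5
        exact hlam T hT a _ ha (by simpa using h5) h4 hout
  · intro z hz hzm hzB
    refine famLE_of_sameAt hxm hzm fun S i hi' j hj => ?_
    intro hsame
    wlog hij : σ.symm i ≤ σ.symm j generalizing i j
    · exact (this j hj i hi' hsame.symm (le_of_not_ge hij)).symm
    rw [hlev S i hi' j hj hij] at hsame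
    set I := interval σ ⟨lo_lt_hi σ S, hi_lt σ S⟩ with hI
    have hSI : S.1 ⊆ I.1 := subset_interval σ S
    have hIm : ∀ l (h : l < n), lo σ S ≤ l → l ≤ hi σ S → σ ⟨l, h⟩ ∈ I.1 := fun l h h1 h2 =>
      (mem_interval' h).2 ⟨h1, h2⟩
    have hlo := lo_le (σ := σ) hi'
    have hhi := le_hi (σ := σ) hj
    have hjn := (σ.symm j).2
    have hhin := hi_lt σ S
    -- Each gap between `i` and `j` is deeper than some gap in the range of `S`. It therefore lies
    -- in a member of `B` that does not contain `I`, and `z` collapses that member at `I`.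
    have step : ∀ l (h : l < n), (σ.symm i : ℕ) ≤ l → l ≤ σ.symm j → SameAt z I i (σ ⟨l, h⟩) := by
      intro l h h1 h2
      induction l, h1 using Nat.le_induction with
      | base => simp [SameAt]
      | succ l h1 ih =>
        refine (ih (by omega) (by omega)).trans ?_
        obtain ⟨l', h3, h4, h5⟩ := hsame l h1 (by omega)
        obtain ⟨T, hT, ⟨h6, h7, h8⟩, h9⟩ := exists_of_gapDepth_lt h5
        refine InTree.sameAt (S := ⟨T.1, T.2.1⟩) hz (hzB T hT) (fun hc => h9 ?_) h7 h8
          (hIm _ _ (by omega) (by omega)) (hIm _ _ (by omega) (by omega))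
        exact ⟨by omega, hc (hIm _ _ h3 h4.le), hc (hIm _ _ (by omega) h4)⟩
    have hfin := step (σ.symm j) hjn hij le_rfl
    simp only [Fin.eta, Equiv.apply_symm_apply] at hfin
    obtain ⟨a, ha, hae⟩ := exists_lo σ S
    obtain ⟨b, hb, hbe⟩ := exists_hi σ S
    refine hz.sameAt_down hSI hi' hj ha hb (hzm.not_sameAt_ends (hSI ha) (hSI hb) ?_ ?_) hfin
    · rw [hae, hI, lo_interval]
    · rw [hbe, hI, hi_interval]
  · intro U i hi' j hj hsame
    by_cases hne : i = j
    · exact Or.inl hne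
    right
    have hdep : ∀ i ∈ U.1, ∀ j ∈ U.1, SameAt x U i j → σ.symm i < σ.symm j →
        (∃ T ∈ B, i ∈ T.1) ∧ ∃ T ∈ B, j ∈ T.1 := by
      intro i hi' j hj hsame hij
      rw [hlev U i hi' j hj hij.le] at hsame
      refine hgap i j (fun l h1 h2 => ?_) hij
      obtain ⟨l', -, -, h5⟩ := hsame l h1 h2
      obtain ⟨T, hT, h6, -⟩ := exists_of_gapDepth_lt h5
      exact ⟨T, hT, h6⟩
    rcases lt_trichotomy (σ.symm i) (σ.symm j) with h | h | h
    · exact hdep i hi' j hj hsame h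
    · exact absurd (σ.symm.injective h) hne
    · exact (hdep j hj i hi' hsame.symm h).symm

end

section

/-! ### Cellular spaces are stratified -/

lemma IsCellMap.isEmbedding {X : Type*} [TopologicalSpace X] [T2Space X] {d : ℕ}
    {φ : (Fin d → ℝ) → X} {F C : Set X} (h : IsCellMap φ F C) :
    IsEmbedding ((Metric.ball (0 : Fin d → ℝ) 1).domRestrict φ) := by
  have : CompactSpace (Metric.closedBall (0 : Fin d → ℝ) 1) :=
    isCompact_iff_compactSpace.1 (isCompact_closedBall _ _)
  have h1 : IsEmbedding ((Metric.closedBall (0 : Fin d → ℝ) 1).domRestrict φ) :=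
    ((continuousOn_iff_continuous_domRestrict.1 h.continuousOn).isClosedEmbedding
      (injOn_iff_injective.1 h.injOn)).isEmbedding
  exact h1.comp (IsEmbedding.inclusion Metric.ball_subset_closedBall)

lemma IsCellMap.nonempty_homeomorph {X : Type*} [TopologicalSpace X] [T2Space X] {d : ℕ}
    {φ : (Fin d → ℝ) → X} {F C : Set X} (h : IsCellMap φ F C) :
    Nonempty (C ≃ₜ EuclideanSpace ℝ (Fin d)) := by
  have e1 := h.isEmbedding.toHomeomorph
  have hr : range ((Metric.ball (0 : Fin d → ℝ) 1).domRestrict φ) = C := by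
    rw [range_domRestrict, h.image_ball]
  have e2 : (Fin d → ℝ) ≃ₜ Metric.ball (0 : Fin d → ℝ) 1 := Homeomorph.unitBall
  have e3 : EuclideanSpace ℝ (Fin d) ≃ₜ (Fin d → ℝ) :=
    (EuclideanSpace.equiv (Fin d) ℝ).toHomeomorph
  exact ⟨(Homeomorph.setCongr hr).symm.trans (e1.symm.trans (e2.symm.trans e3.symm))⟩

section Order

variable {X : Type*} [TopologicalSpace X] {le : X → X → Prop} {dim : X → ℕ}

/-- The class of the elements mutually comparable with `x`. -/
def cls (le : X → X → Prop) (x : X) : Set X := {y | le y x ∧ le x y}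

lemma Cellular.isClosed [T2Space X] (h : Cellular le dim) (x : X) : IsClosed {y | le y x} := by
  obtain ⟨φ, hφ⟩ := h.cell x
  exact hφ.isCompact.isClosed

lemma Cellular.closure_cls [T2Space X] (h : Cellular le dim) (x : X) :
    closure (cls le x) = {y | le y x} := by
  obtain ⟨φ, hφ⟩ := h.cell x
  exact hφ.closure_eq

lemma Cellular.cls_eq (h : Cellular le dim) {x y : X} (hy : y ∈ cls le x) : cls le y = cls le x := by
  ext z
  exact ⟨fun hz => ⟨h.trans _ _ _ hz.1 hy.1, h.trans _ _ _ hy.2 hz.2⟩,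
    fun hz => ⟨h.trans _ _ _ hz.1 hy.2, h.trans _ _ _ hy.1 hz.2⟩⟩

lemma Cellular.mem_cls (h : Cellular le dim) (x : X) : x ∈ cls le x := ⟨h.refl x, h.refl x⟩

lemma Cellular.isStratification [T2Space X] (h : Cellular le dim) (hfin : (range (cls le)).Finite) :
    IsStratification (range (cls le)) where
  finite := hfin
  nonempty := by
    rintro _ ⟨x, rfl⟩
    exact ⟨x, h.mem_cls x⟩
  disjoint := by
    rintro _ ⟨x, rfl⟩ _ ⟨y, rfl⟩ hne
    refine Set.disjoint_left.2 fun z hz hz' => hne ?_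
    dsimp only [id] at hz hz'
    rw [← h.cls_eq hz, ← h.cls_eq hz']
  cover := eq_univ_of_forall fun x => ⟨_, ⟨x, rfl⟩, h.mem_cls x⟩
  isLocallyClosed := by
    rintro _ ⟨x, rfl⟩
    -- The class of `x` is its closed lower set minus the closures of the strictly smaller classes,
    -- of which there are finitely many.
    have hU : IsClosed (⋃₀ {F | ∃ s ∈ range (cls le), F = closure s ∧ ∀ y ∈ F, le y x ∧ ¬ le x y}) := by
      rw [sUnion_eq_biUnion]
      refine Set.Finite.isClosed_biUnion ?_ ?_
      · refine (hfin.image closure).subset ?_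
        rintro F ⟨s, hs, rfl, -⟩
        exact ⟨s, hs, rfl⟩
      · rintro F ⟨s, hs, rfl, -⟩
        exact isClosed_closure
    have : cls le x = {y | le y x} ∩
        (⋃₀ {F | ∃ s ∈ range (cls le), F = closure s ∧ ∀ y ∈ F, le y x ∧ ¬ le x y})ᶜ := by
      ext y
      constructor
      · rintro ⟨h1, h2⟩
        refine ⟨h1, ?_⟩
        rintro ⟨F, ⟨s, hs, rfl, hF⟩, hy⟩
        exact (hF y hy).2 h2
      · rintro ⟨h1, h2⟩
        refine ⟨h1, ?_⟩
        by_contra h3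
        refine h2 ⟨closure (cls le y), ⟨_, ⟨y, rfl⟩, rfl, fun z hz => ?_⟩,
          subset_closure (h.mem_cls y)⟩
        rw [h.closure_cls] at hz
        exact ⟨h.trans _ _ _ hz h1, fun h4 => h3 (h.trans _ _ _ h4 hz)⟩
    rw [this]
    exact (h.isClosed x).isLocallyClosed.inter hU.isOpen_compl.isLocallyClosed
  frontier := by
    rintro _ ⟨x, rfl⟩ _ ⟨y, rfl⟩ ⟨z, hz, hz'⟩
    rw [h.closure_cls] at hz' ⊢
    exact fun w hw => h.trans _ _ _ hw.1 (h.trans _ _ _ hz.2 hz')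
  cell := by
    rintro _ ⟨x, rfl⟩
    obtain ⟨φ, hφ⟩ := h.cell x
    exact ⟨dim x, hφ.nonempty_homeomorph⟩

end Order

lemma openStrata_eq {X : Type*} {le : X → X → Prop} (refl : ∀ x, le x x)
    (trans : ∀ x y z, le x y → le y z → le x z) :
    openStrata {F | ∃ x, F = {y | le y x}} = range (cls le) := by
  have key : ∀ x, {y | le y x} \ ⋃₀ {F' | F' ∈ {F | ∃ x, F = {y | le y x}} ∧ F' ⊂ {y | le y x}}
      = cls le x := by
    intro x
    ext y
    constructor
    · rintro ⟨h1, h2⟩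
      refine ⟨h1, ?_⟩
      by_contra h3
      refine h2 ⟨{z | le z y}, ⟨⟨y, rfl⟩, fun z hz => trans _ _ _ hz h1, fun h4 => h3 ?_⟩, refl y⟩
      exact h4 (refl x)
    · rintro ⟨h1, h2⟩
      refine ⟨h1, ?_⟩
      rintro ⟨_, ⟨⟨w, rfl⟩, hss⟩, hw⟩
      exact hss.2 fun z hz => trans _ _ _ hz (trans _ _ _ h2 hw)
  ext s
  constructor
  · rintro ⟨_, ⟨x, rfl⟩, rfl⟩
    exact ⟨x, (key x).symm⟩
  · rintro ⟨x, rfl⟩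
    exact ⟨_, ⟨x, rfl⟩, (key x).symm⟩

/-! ### The closed strata -/

lemma finite_openStrata_closedStrata {X α β : Type*} [Finite α] [Finite β] (t : α → Set X)
    (d : β → Set X) : (openStrata (closedStrata t d)).Finite := by
  have h1 : (closedStrata t d).Finite := by
    refine (finite_range fun p : α × Set β => t p.1 ∩ ⋂ S ∈ p.2, d S).subset ?_
    rintro F ⟨-, σ, B, rfl⟩
    exact ⟨(σ, B), rfl⟩
  refine (h1.image fun F => F \ ⋃₀ {F' | F' ∈ closedStrata t d ∧ F' ⊂ F}).subset ?_
  rintro s ⟨F, hF, rfl⟩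
  exact ⟨F, hF, rfl⟩

variable {n : ℕ}

/-- The closed strata are the principal lower sets of the face order. -/
lemma closedStrata_eq {X : Type*} [TopologicalSpace X] [T2Space X] {le : X → X → Prop}
    {dim : X → ℕ} (hcell : Cellular le dim) {pr : X → Fam n} (hpr : Continuous pr)
    (hle : ∀ x y, le y x → FamLE (pr y) (pr x)) (hcompat : ∀ x, Compat (pr x))
    {M : Equiv.Perm (Fin n) → Set X} (hMdown : ∀ σ x y, x ∈ M σ → le y x → y ∈ M σ)
    (hMcov : ∀ x, ∃ σ, x ∈ M σ) (hM : ∀ σ, ∀ x ∈ M σ, IsMono σ (pr x))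
    (hMle : ∀ σ, ∀ x ∈ M σ, ∀ y ∈ M σ, FamLE (pr y) (pr x) → le y x)
    (hlift : ∀ σ x, Compat x → IsMono σ x → ∃ y ∈ M σ, pr y = x)
    {G : Equiv.Perm (Fin n) → Set X} (hGM : ∀ σ, G σ ⊆ M σ)
    (hG : ∀ σ, ∀ x ∈ M σ, (∀ S : Big n, ∀ i ∈ S.1, ∀ j ∈ S.1, SameAt (pr x) S i j → i = j) →
      x ∈ G σ)
    {H : Center n → Set X} (hHD : ∀ S, H S ⊆ {x | InTree (pr x) S.1})
    (hH : ∀ (S : Center n) (x : X), InTree (pr x) S.1 → (∀ U : Big n, U.1 = Finset.univ →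
      ∀ i j, SameAt (pr x) U i j → i = j ∨ (i ∈ S.1 ∧ j ∈ S.1)) → x ∈ H S) :
    closedStrata (fun σ => closure (G σ)) (fun S => closure (H S)) = {F | ∃ x, F = {y | le y x}} := by
  -- the largest element of a tile and some divisors
  have large : ∀ σ (B : Set (Center n)) (y : X), y ∈ M σ → (∀ S ∈ B, InTree (pr y) S.1) →
      ∃ x ∈ M σ, M σ ∩ ⋂ S ∈ B, {x | InTree (pr x) S.1} = {y | le y x} ∧
        ∀ U : Big n, ∀ i ∈ U.1, ∀ j ∈ U.1, SameAt (pr x) U i j → i = j ∨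
          ((∃ T ∈ B, i ∈ T.1) ∧ ∃ T ∈ B, j ∈ T.1) := by
    intro σ B y hy hyB
    obtain ⟨x, h1, h2, h3, h4, h5⟩ := exists_largest B (hM σ y hy) hyB
    obtain ⟨x, hx, rfl⟩ := hlift σ x h1 h2
    refine ⟨x, hx, ?_, h5⟩
    ext z
    simp only [mem_inter_iff, mem_iInter, mem_ofPred_eq]
    constructor
    · rintro ⟨hz, hzB⟩
      exact hMle σ x hx z hz (h4 _ (hcompat z) (hM σ z hz) hzB)
    · intro hz
      exact ⟨hMdown σ x z hx hz, fun S hS => (h3 S hS).of_le (hle x z hz)⟩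
  have hne : ∀ σ, ∃ y, y ∈ M σ := by
    intro σ
    obtain ⟨w, hw, -⟩ := exists_generic n
    obtain ⟨y, hy, -⟩ := hlift σ _ (compat_chart σ ⟨w, hw⟩) (isMono_chart σ ⟨w, hw⟩)
    exact ⟨y, hy⟩
  -- With no divisors prescribed, the largest point of the tile separates all marked points. Its
  -- class lies in the open chamber and is dense in the tile.
  have tile : ∀ σ, closure (G σ) = M σ := by
    intro σ
    obtain ⟨y, hy⟩ := hne σ
    obtain ⟨x, hx, hF, hlev⟩ := large σ ∅ y hy (by simp)
    have hF' : M σ = {y | le y x} := by simpa using hF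
    refine Subset.antisymm ?_ ?_
    · refine closure_minimal (hGM σ) ?_
      rw [hF']; exact hcell.isClosed x
    · rw [hF', ← hcell.closure_cls]
      refine closure_mono fun z hz => ?_
      have hzM : z ∈ M σ := hMdown σ x z hx hz.1
      refine hG σ z hzM fun S i hi' j hj hij => ?_
      rcases hlev S i hi' j hj ((hle z x hz.2).sameAt hi' hj hij) with h | ⟨⟨T, hT, -⟩, -⟩
      · exact h
      · exact hT.elim
  -- A point of the divisor lies below the largest point of some tile with `S` in its tree. The
  -- class of that point maps to the generic part of `L_S`, since it collapses only pairs inside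
  -- `S`.
  have div : ∀ S, closure (H S) = {x | InTree (pr x) S.1} := by
    intro S
    refine Subset.antisymm (closure_minimal (hHD S) ((isClosed_setOf_inTree S.1).preimage hpr)) ?_
    intro y hy
    obtain ⟨σ, hyM⟩ := hMcov y
    obtain ⟨x, hx, hF, hlev⟩ := large σ {S} y hyM (by simpa using hy)
    have hyx : y ∈ {y | le y x} := by rw [← hF]; simpa using ⟨hyM, hy⟩
    have hxS : InTree (pr x) S.1 := by
      have : x ∈ {y | le y x} := hcell.refl x
      rw [← hF] at this
      simpa using this.2
    rw [← hcell.closure_cls] at hyx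
    refine closure_mono (fun z hz => ?_) hyx
    refine hH S z (hxS.of_le (hle x z hz.1)) fun U hU i j hij => ?_
    have hi' : i ∈ U.1 := by rw [hU]; exact Finset.mem_univ i
    have hj : j ∈ U.1 := by rw [hU]; exact Finset.mem_univ j
    simpa using hlev U i hi' j hj ((hle z x hz.2).sameAt hi' hj hij)
  simp only [closedStrata, tile, div]
  ext F
  constructor
  · rintro ⟨⟨y, hy⟩, σ, B, rfl⟩
    simp only [mem_inter_iff, mem_iInter] at hy
    obtain ⟨x, hx, hF, -⟩ := large σ B y hy.1 hy.2
    exact ⟨x, hF⟩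
  · rintro ⟨x, rfl⟩
    refine ⟨⟨x, hcell.refl x⟩, ?_⟩
    obtain ⟨σ, hσ⟩ := hMcov x
    -- The divisors to intersect are all those containing `x`. A pair collapsed by `x` lies in a
    -- member of its tree, so any point of the intersection collapses it as well.
    refine ⟨σ, {S | InTree (pr x) S.1}, ?_⟩
    ext z
    simp only [mem_inter_iff, mem_iInter, mem_ofPred_eq]
    constructor
    · intro hz
      exact ⟨hMdown σ x z hσ hz, fun S hS => InTree.of_le hS (hle x z hz)⟩
    · rintro ⟨hz, hzB⟩
      refine hMle σ x hσ z hz (famLE_of_sameAt (hM σ x hσ) (hM σ z hz) fun I i hi' j hj hij => ?_)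
      by_cases hne : i = j
      · rw [hne]; rfl
      obtain ⟨S, hS, hiS, hjS, hIS⟩ := exists_inTree (hcompat x) hi' hj hne hij
      exact InTree.sameAt (S := ⟨S.1, S.2.1⟩) (hcompat z) (hzB S hS) hIS hiS hjS hi' hj

lemma sameAt_of_eq_mk {x : Fam n} {U : Big n} {a : Fin n → ℝ} {ha : ctr U.1 a ≠ 0}
    (h : x U = Projectivization.mk ℝ (ctr U.1 a) ha) {i j : Fin n} (hi' : i ∈ U.1) (hj : j ∈ U.1) :
    SameAt x U i j ↔ a i = a j := by
  obtain ⟨c, hc, h1⟩ := rep_mk_ctr ha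
  rw [SameAt, h, ← sub_eq_zero, h1 i hi' j hj, mul_eq_zero, or_iff_right hc, sub_eq_zero]

/-- Sets collapsed by the coordinate of the full index set, but by no larger level set. -/
lemma inTree_of_univ (hn : 2 ≤ n) {x : Fam n} (hx : Compat x) {S : Center n}
    (h : ∀ i j, SameAt x (univBig hn) i j ↔ i = j ∨ (i ∈ S.1 ∧ j ∈ S.1)) : InTree x S.1 := by
  intro T hST p hp q hq
  obtain ⟨t, ht, htS⟩ := Finset.exists_of_ssubset hST
  refine hx.sameAt_down (T := univBig hn) (Finset.subset_univ _) (hST.1 hp) (hST.1 hq) (hST.1 hp) ht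
    ?_ ((h p q).2 (Or.inr ⟨hp, hq⟩))
  rw [h]
  rintro (rfl | h)
  · exact htS hp
  · exact htS h.2

lemma strataBar_eq (hn : 2 ≤ n) : strataBar n = range (cls (BarLE (n := n))) := by
  obtain ⟨dim, hcell⟩ := exists_cellular_bar n
  have hc : ∀ x : Mbar n, Compat x.1 := fun x => compat_of_mem_Mbar x.2
  have hov : ∀ (x : Mbar n) (a : Fin n → ℝ), LiesOver x a → ∀ i j,
      SameAt x.1 (univBig hn) i j ↔ a i = a j := fun x a h i j => by
    obtain ⟨ha, he⟩ := h (univBig hn).2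
    exact sameAt_of_eq_mk (U := univBig hn) he (Finset.mem_univ i) (Finset.mem_univ j)
  have hlies : ∀ (x : Mbar n) (c : ℝ), c ≠ 0 → LiesOver x (c • (x.1 (univBig hn)).rep.1) := by
    intro x c hc0 h
    have hu : ctr Finset.univ (c • (x.1 (univBig hn)).rep.1) = c • (x.1 (univBig hn)).rep := by
      rw [map_smul]
      congr 1
      exact ctr_coe (S := Finset.univ) (x.1 (univBig hn)).rep
    have h0 : ctr Finset.univ (c • (x.1 (univBig hn)).rep.1) ≠ 0 := by
      rw [hu]; exact smul_ne_zero hc0 (x.1 (univBig hn)).rep_nonzero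
    refine ⟨h0, ?_⟩
    refine eq_mk_ctr (S := Finset.univ) (x.1 (univBig hn)) h0 c⁻¹ fun i _ j _ => ?_
    simp only [Pi.smul_apply, smul_eq_mul]
    field_simp
    rfl
  have := closedStrata_eq (n := n) hcell (pr := Subtype.val) continuous_subtype_val
    (fun _ _ h => h) hc (M := fun σ => {x | IsMono σ x.1}) (fun _ _ _ hx h => hx.of_le h)
    (fun x => exists_isMono x.2) (fun _ _ h => h) (fun _ _ _ _ _ h => h)
    (fun σ x h1 h2 => by
      obtain ⟨u, rfl⟩ := exists_chart_eq h1 h2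
      exact ⟨⟨_, chart_mem_Mbar σ u⟩, h2, rfl⟩)
    (G := fun σ => {x | ∃ a : Fin n → ℝ, StrictMono (a ∘ σ) ∧ LiesOver x a})
    (fun σ x ⟨a, ha, hx⟩ => by
      have hainj : Function.Injective a := by
        have := ha.injective.comp σ.symm.injective
        simpa [Function.comp_assoc] using this
      obtain ⟨h0, hU⟩ := hx (univBig hn).2
      -- The full coordinate separates all marked points, so compatibility makes every other
      -- coordinate its restriction.
      have hxa : x.1 = conf a hainj := by
        funext S
        obtain ⟨i, hi', j, hj, hij⟩ := Finset.one_lt_card.1 S.2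
        obtain ⟨c, hc0, hrep⟩ := rep_mk_ctr h0
        have hrep' : ∀ i j, (x.1 (univBig hn)).rep.1 i - (x.1 (univBig hn)).rep.1 j
            = c * (a i - a j) := fun i j => by
          have : x.1 (univBig hn) = Projectivization.mk ℝ (ctr Finset.univ a) h0 := hU
          rw [this]
          exact hrep i (Finset.mem_univ i) j (Finset.mem_univ j)
        have hd : a i - a j ≠ 0 := sub_ne_zero.2 fun h => hij (hainj h)
        refine eq_mk_ctr (x.1 S) _ (((x.1 S).rep.1 i - (x.1 S).rep.1 j) / (a i - a j))
          fun k hk l hl => ?_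
        have := hc x S (univBig hn) (Finset.subset_univ _) k hk l hl i hi' j hj
        rw [hrep', hrep', mul_assoc, mul_assoc] at this
        have := mul_left_cancel₀ hc0 this
        field_simp
        linarith
      show IsMono σ x.1
      rw [hxa]
      exact isMono_conf hainj ha)
    (fun σ x hx hsep => by
      obtain ⟨c, hc0, hmono⟩ := IsMono.exists_rep hx (univBig hn)
      refine ⟨c • (x.1 (univBig hn)).rep.1, ?_, hlies x c hc0⟩
      refine Monotone.strictMono_of_injective (fun i j hij => ?_) fun i j hij => ?_
      · exact hmono (σ i) (Finset.mem_univ _) (σ j) (Finset.mem_univ _) (by simpa using hij)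
      · refine σ.injective (hsep (univBig hn) _ (Finset.mem_univ _) _ (Finset.mem_univ _) ?_)
        exact mul_left_cancel₀ hc0 hij)
    (H := fun S => {x | ∃ a : Fin n → ℝ, (∀ i j, a i = a j ↔ i = j ∨ (i ∈ S.1 ∧ j ∈ S.1)) ∧
      LiesOver x a})
    (fun S x ⟨a, ha, hx⟩ => inTree_of_univ hn (hc x) fun i j => by rw [hov x a hx, ha])
    (fun S x hS hsep => by
      refine ⟨(1 : ℝ) • (x.1 (univBig hn)).rep.1, fun i j => ?_, hlies x 1 one_ne_zero⟩
      rw [← hov x _ (hlies x 1 one_ne_zero)]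
      refine ⟨hsep (univBig hn) rfl i j, ?_⟩
      rintro (rfl | ⟨h1, h2⟩)
      · rfl
      · exact hS _ (Finset.ssubset_univ_iff.2 S.2.2) i h1 j h2)
  rw [strataBar, ← openStrata_eq (le := BarLE (n := n)) (fun x => FamLE.refl x.1)
    (fun _ _ _ h h' => FamLE.trans h h'), ← this]
  rfl

lemma strataTil_eq (hn : 2 ≤ n) : strataTil n = range (cls (TilLE (n := n))) := by
  obtain ⟨dim, hcell⟩ := exists_cellular_til hn
  have hc : ∀ x : Mtil n, Compat x.1.2 := fun x => compat_of_mem_Mbar (Mtil_rel hn x.2).2.2.1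
  have hov : ∀ (x : Mtil n) i j, SameAt x.1.2 (univBig hn) i j ↔ x.1.1 i = x.1.1 j := by
    intro x i j
    rw [sameAt_iff_cross, (Mtil_rel hn x.2).2.2.2, mul_self_eq_zero, sub_eq_zero]
  have := closedStrata_eq (n := n) hcell (pr := fun x : Mtil n => x.1.2)
    (continuous_snd.comp continuous_subtype_val)
    (fun _ _ h => h.1) hc (M := fun σ => {x | IsMonoTil σ x.1}) (fun _ _ _ hx h => hx.of_le h)
    (fun x => exists_isMonoTil x.2) (fun _ _ h => h.1)
    (fun σ x hx y hy h => by
      refine ⟨h, fun i j hij => ?_⟩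
      rcases le_total (σ.symm i) (σ.symm j) with hs | hs
      · exact hy.2 i j hs
      · have e := le_antisymm hij (hx.2 j i hs)
        exact ((hov y i j).1 (h.sameAt (Finset.mem_univ i) (Finset.mem_univ j)
          ((hov x i j).2 e))).le)
    (fun σ x h1 h2 => by
      obtain ⟨u, rfl⟩ := exists_chart_eq h1 h2
      exact ⟨chartTil hn σ u, isMonoTil_chartTil hn u, rfl⟩)
    (G := fun σ => {x | StrictMono (x.1.1 ∘ σ)})
    (fun σ x hx => by
      obtain ⟨τ, hτ⟩ := exists_isMonoTil x.2
      have hinj : Function.Injective x.1.1 := by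
        have := hx.injective.comp σ.symm.injective
        simpa [Function.comp_assoc] using this
      -- An injective vector is sorted by only one permutation.
      have : τ = σ := by
        have h1 : Monotone (x.1.1 ∘ τ) := fun i j hij => hτ.2 _ _ (by simpa using hij)
        have h2 := (h1.strictMono_of_injective (hinj.comp τ.injective))
        have h3 := Tuple.unique_monotone h1 hx.monotone
        exact Equiv.ext fun i => hinj (congrFun h3 i)
      exact this ▸ hτ)
    (fun σ x hx hsep => by
      refine Monotone.strictMono_of_injective (fun i j hij => hx.2 _ _ (by simpa using hij))
        fun i j hij => ?_
      exact σ.injective (hsep (univBig hn) _ (Finset.mem_univ _) _ (Finset.mem_univ _)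
        ((hov x _ _).2 hij)))
    (H := fun S => {x | ∀ i j, x.1.1 i = x.1.1 j ↔ i = j ∨ (i ∈ S.1 ∧ j ∈ S.1)})
    (fun S x hx => inTree_of_univ hn (hc x) fun i j => by rw [hov x, hx])
    (fun S x hS hsep => by
      intro i j
      rw [← hov x]
      refine ⟨hsep (univBig hn) rfl i j, ?_⟩
      rintro (rfl | ⟨h1, h2⟩)
      · rfl
      · exact hS _ (Finset.ssubset_univ_iff.2 S.2.2) i h1 j h2)
  rw [strataTil, ← openStrata_eq (le := TilLE (n := n)) TilLE.refl (fun _ _ _ h h' => TilLE.trans h h'),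
    ← this]
  rfl

lemma isStratification_bar (hn : 2 ≤ n) : IsStratification (strataBar n) := by
  have hfin : (strataBar n).Finite := finite_openStrata_closedStrata _ _
  obtain ⟨dim, hcell⟩ := exists_cellular_bar n
  rw [strataBar_eq hn] at hfin ⊢
  exact hcell.isStratification hfin

lemma isStratification_til (hn : 2 ≤ n) : IsStratification (strataTil n) := by
  have hfin : (strataTil n).Finite := finite_openStrata_closedStrata _ _
  obtain ⟨dim, hcell⟩ := exists_cellular_til hn
  rw [strataTil_eq hn] at hfin ⊢
  exact hcell.isStratification hfin

end

section

/-! ### Forgetting the odd marked points -/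

lemma eq_of_diff {n : ℕ} {S : Finset (Fin n)} {p q : Projectivization ℝ (V S)} (c : ℝ)
    (h : ∀ i ∈ S, ∀ j ∈ S, p.rep.1 i - p.rep.1 j = c * (q.rep.1 i - q.rep.1 j)) : p = q := by
  have hq : ctr S q.rep.1 ≠ 0 := by rw [ctr_coe]; exact q.rep_nonzero
  rw [eq_mk_ctr p hq c h]
  simp only [ctr_coe, Projectivization.mk_rep]

lemma cross_nonneg_iff_of_diff {n : ℕ} {S : Finset (Fin n)} {p : Projectivization ℝ (V S)}
    {v : Fin n → ℝ} {c : ℝ} (hc : c ≠ 0)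
    (h : ∀ i ∈ S, ∀ j ∈ S, p.rep.1 i - p.rep.1 j = c * (v i - v j)) {i j k l : Fin n} (hi : i ∈ S)
    (hj : j ∈ S) (hk : k ∈ S) (hl : l ∈ S) :
    0 ≤ cross p i j k l ↔ 0 ≤ (v i - v j) * (v k - v l) := by
  have : 0 < c ^ 2 := by positivity
  rw [cross_nonneg_iff, h i hi j hj, h k hk l hl,
    show c * (v i - v j) * (c * (v k - v l)) = c ^ 2 * ((v i - v j) * (v k - v l)) by ring,
    mul_nonneg_iff_of_pos_left this]

lemma rep_map {n m : ℕ} {S : Finset (Fin n)} {T : Finset (Fin m)} (f : V S →ₗ[ℝ] V T)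
    (hf : Function.Injective f) (p : Projectivization ℝ (V S)) :
    ∃ c : ℝ, c ≠ 0 ∧ (Projectivization.map f hf p).rep = c • f p.rep := by
  have hne : f p.rep ≠ 0 := (map_ne_zero_iff f hf).2 p.rep_nonzero
  have h : Projectivization.map f hf p = Projectivization.mk ℝ (f p.rep) hne := by
    conv_lhs => rw [← p.mk_rep]
    rw [Projectivization.map_mk]
  obtain ⟨a, ha⟩ := Projectivization.exists_smul_eq_mk_rep ℝ (f p.rep) hne
  exact ⟨a, a.ne_zero, by rw [h, ← ha]; rfl⟩

/-- Once `T` separates two points of `S`, its restriction determines the coordinate `S`. -/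
lemma Compat.exists_diff {n : ℕ} {x : Fam n} (hx : Compat x) {S T : Big n} (hST : S.1 ⊆ T.1)
    {k l : Fin n} (hk : k ∈ S.1) (hl : l ∈ S.1) (hkl : (x T).rep.1 k ≠ (x T).rep.1 l) :
    ∃ c : ℝ, c ≠ 0 ∧ ∀ i ∈ S.1, ∀ j ∈ S.1,
      (x S).rep.1 i - (x S).rep.1 j = c * ((x T).rep.1 i - (x T).rep.1 j) := by
  have h0 := sub_ne_zero.2 hkl
  have key : ∀ i ∈ S.1, ∀ j ∈ S.1, (x S).rep.1 i - (x S).rep.1 j =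
      ((x S).rep.1 k - (x S).rep.1 l) / ((x T).rep.1 k - (x T).rep.1 l) *
        ((x T).rep.1 i - (x T).rep.1 j) := by
    intro i hi j hj
    have := hx S T hST i hi j hj k hk l hl
    rw [div_mul_eq_mul_div, eq_div_iff h0]
    linarith
  refine ⟨_, fun hc => ?_, key⟩
  obtain ⟨i, hi, j, hj, hij⟩ := exists_rep_ne (x S)
  have := key i hi j hj
  rw [hc, zero_mul, sub_eq_zero] at this
  exact hij this

variable {n N : ℕ}

/-- The first of the two marked points which replace the marked point of index `i`. -/
def evenPt (h : 2 * n ≤ N) (i : Fin n) : Fin N := ⟨2 * i.1, by omega⟩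

lemma evenPt_injective (h : 2 * n ≤ N) : Function.Injective (evenPt h) := by
  intro i j hij
  have := congrArg Fin.val hij
  simp only [evenPt] at this
  exact Fin.ext (by omega)

/-- The set of first points which replace the points of `S`. -/
def evenSet (h : 2 * n ≤ N) (S : Finset (Fin n)) : Finset (Fin N) :=
  S.map ⟨evenPt h, evenPt_injective h⟩

lemma evenPt_mem_evenSet {h : 2 * n ≤ N} {S : Finset (Fin n)} {i : Fin n} :
    evenPt h i ∈ evenSet h S ↔ i ∈ S := by
  simp [evenSet]

lemma mem_evenSet {h : 2 * n ≤ N} {S : Finset (Fin n)} {k : Fin N} :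
    k ∈ evenSet h S ↔ ∃ i ∈ S, evenPt h i = k := by
  simp [evenSet]

/-- The set of first points which replace the points of `S`. -/
def evenBig (h : 2 * n ≤ N) (S : Big n) : Big N := ⟨evenSet h S.1, by simpa [evenSet] using S.2⟩

/-- The restriction of configurations to the first points. -/
def evenRestr (h : 2 * n ≤ N) (S : Finset (Fin n)) : V (evenSet h S) →ₗ[ℝ] V S :=
  (ctr S).comp ((LinearMap.funLeft ℝ ℝ (evenPt h)).comp (V (evenSet h S)).subtype)

lemma evenRestr_injective (h : 2 * n ≤ N) (S : Finset (Fin n)) :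
    Function.Injective (evenRestr h S) := by
  rw [← LinearMap.ker_eq_bot, LinearMap.ker_eq_bot']
  intro w hw
  have hw' := (ctr_eq_zero_iff _ _).1 hw
  rw [← ctr_coe w, ctr_eq_zero_iff]
  intro i hi j hj
  obtain ⟨i, hi', rfl⟩ := mem_evenSet.1 hi
  obtain ⟨j, hj', rfl⟩ := mem_evenSet.1 hj
  exact hw' i hi' j hj'

lemma continuous_evenRestr (h : 2 * n ≤ N) (S : Finset (Fin n)) : Continuous (evenRestr h S) :=
  LinearMap.continuous_of_finiteDimensional _

/-- The stable curve from which the odd marked points have been removed. -/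
def forgetOdd (h : 2 * n ≤ N) (z : Fam N) : Fam n := fun S =>
  Projectivization.map (evenRestr h S.1) (evenRestr_injective h S.1) (z (evenBig h S))

lemma continuous_forget (h : 2 * n ≤ N) : Continuous (forgetOdd h) :=
  continuous_pi fun S => (continuous_map _ _ (continuous_evenRestr h S.1)).comp
    (continuous_apply (evenBig h S))

lemma forget_diff (h : 2 * n ≤ N) (z : Fam N) (S : Big n) :
    ∃ c : ℝ, c ≠ 0 ∧ ∀ i ∈ S.1, ∀ j ∈ S.1, (forgetOdd h z S).rep.1 i - (forgetOdd h z S).rep.1 j =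
      c * ((z (evenBig h S)).rep.1 (evenPt h i) - (z (evenBig h S)).rep.1 (evenPt h j)) := by
  obtain ⟨c, hc, h1⟩ := rep_map (evenRestr h S.1) (evenRestr_injective h S.1) (z (evenBig h S))
  refine ⟨c, hc, fun i hi j hj => ?_⟩
  rw [forgetOdd, h1]
  have := ctr_sub (S := S.1) (fun i => (z (evenBig h S)).rep.1 (evenPt h i)) hi hj
  rw [← this]
  exact (mul_sub c _ _).symm

lemma cross_forget_nonneg_iff (h : 2 * n ≤ N) (z : Fam N) {S : Big n} {i j k l : Fin n}
    (hi : i ∈ S.1) (hj : j ∈ S.1) (hk : k ∈ S.1) (hl : l ∈ S.1) :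
    0 ≤ cross (forgetOdd h z S) i j k l ↔
      0 ≤ cross (z (evenBig h S)) (evenPt h i) (evenPt h j) (evenPt h k) (evenPt h l) := by
  obtain ⟨c, hc, h1⟩ := forget_diff h z S
  rw [cross_nonneg_iff_of_diff (v := fun i => (z (evenBig h S)).rep.1 (evenPt h i)) hc h1 hi hj hk
    hl, cross_nonneg_iff]

lemma FamLE.forgetOdd (h : 2 * n ≤ N) {y x : Fam N} (hyx : FamLE y x) :
    FamLE (forgetOdd h y) (forgetOdd h x) := by
  intro S i hi j hj k hk l hl
  rw [cross_forget_nonneg_iff h x hi hj hk hl, cross_forget_nonneg_iff h y hi hj hk hl]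
  exact hyx _ _ (evenPt_mem_evenSet.2 hi) _ (evenPt_mem_evenSet.2 hj) _ (evenPt_mem_evenSet.2 hk) _
    (evenPt_mem_evenSet.2 hl)

lemma IsMono.forgetOdd (h : 2 * n ≤ N) {σ : Equiv.Perm (Fin n)} {τ : Equiv.Perm (Fin N)}
    (hστ : ∀ i j, σ.symm i ≤ σ.symm j → τ.symm (evenPt h i) ≤ τ.symm (evenPt h j)) {z : Fam N}
    (hz : IsMono τ z) : IsMono σ (forgetOdd h z) := by
  intro S i hi j hj k hk l hl h1 h2
  rw [cross_forget_nonneg_iff h z hi hj hk hl]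
  exact hz _ _ (evenPt_mem_evenSet.2 hi) _ (evenPt_mem_evenSet.2 hj) _ (evenPt_mem_evenSet.2 hk) _
    (evenPt_mem_evenSet.2 hl) (hστ _ _ h1) (hστ _ _ h2)

lemma forget_conf (h : 2 * n ≤ N) {b : Fin N → ℝ} (hb : Function.Injective b) :
    forgetOdd h (conf b hb) = conf (b ∘ evenPt h) (hb.comp (evenPt_injective h)) := by
  funext S
  obtain ⟨c, -, h1⟩ := forget_diff h (conf b hb) S
  obtain ⟨d, -, h2⟩ := rep_mk_ctr (ctr_ne_zero_of_injective hb (evenBig h S))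
  refine eq_mk_ctr _ _ (c * d) fun i hi j hj => ?_
  have h3 := h2 _ (evenPt_mem_evenSet.2 hi) _ (evenPt_mem_evenSet.2 hj)
  rw [h1 i hi j hj, mul_assoc]
  exact congrArg (c * ·) h3

lemma forget_mem (h : 2 * n ≤ N) : MapsTo (forgetOdd h) (Mbar N) (Mbar n) := by
  have h1 : MapsTo (forgetOdd h) {x | ∃ (a : Fin N → ℝ) (ha : Function.Injective a), x = conf a ha}
      (Mbar n) := by
    rintro _ ⟨b, hb, rfl⟩
    exact subset_closure ⟨_, _, forget_conf h hb⟩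
  have h2 := h1.closure (continuous_forget h)
  rwa [show closure (Mbar n) = Mbar n from closure_closure] at h2

/-! ### Expansion and the face order -/

/-- A representative of the coordinate `S` of the expanded curve. -/
def expVec (n : ℕ) (x : Fam n) (S : Big N) : Fin N → ℝ :=
  open Classical in
  if ∃ j ∈ S.1, 2 * n ≤ j.1 then lastVec n N
  else if h2 : 2 ≤ (base n S.1).card then pull n N (x ⟨base n S.1, h2⟩).rep.1
  else pairVec n N

lemma expFam_diff (hN : N ≤ 2 * n + 1) (x : Fam n) (S : Big N) :
    ∃ c : ℝ, c ≠ 0 ∧ ∀ i ∈ S.1, ∀ j ∈ S.1, (expFam hN x S).rep.1 i - (expFam hN x S).rep.1 j =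
      c * (expVec n x S i - expVec n x S j) := by
  by_cases h1 : ∃ j ∈ S.1, 2 * n ≤ j.1
  · simp only [expFam, expVec, dif_pos h1, if_pos h1]
    exact rep_mk_ctr _
  by_cases h2 : 2 ≤ (base n S.1).card
  · simp only [expFam, expVec, dif_neg h1, if_neg h1, dif_pos h2]
    obtain ⟨c, hc, h⟩ := rep_map (dup n S.1) dup_injective (x ⟨base n S.1, h2⟩)
    refine ⟨c, hc, fun i hi j hj => ?_⟩
    rw [h, ← ctr_sub (pull n N (x ⟨base n S.1, h2⟩).rep.1) hi hj]
    exact (mul_sub c _ _).symm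
  · simp only [expFam, expVec, dif_neg h1, if_neg h1, dif_neg h2]
    exact rep_mk_ctr _

lemma cross_expFam_nonneg_iff (hN : N ≤ 2 * n + 1) (x : Fam n) {S : Big N} {i j k l : Fin N}
    (hi : i ∈ S.1) (hj : j ∈ S.1) (hk : k ∈ S.1) (hl : l ∈ S.1) :
    0 ≤ cross (expFam hN x S) i j k l ↔
      0 ≤ (expVec n x S i - expVec n x S j) * (expVec n x S k - expVec n x S l) := by
  obtain ⟨c, hc, h1⟩ := expFam_diff hN x S
  exact cross_nonneg_iff_of_diff hc h1 hi hj hk hl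

lemma sameAt_expFam_iff (hN : N ≤ 2 * n + 1) (x : Fam n) {S : Big N} {i j : Fin N}
    (hi : i ∈ S.1) (hj : j ∈ S.1) :
    SameAt (expFam hN x) S i j ↔ expVec n x S i = expVec n x S j := by
  obtain ⟨c, hc, h1⟩ := expFam_diff hN x S
  rw [SameAt, ← sub_eq_zero, h1 i hi j hj, mul_eq_zero, or_iff_right hc, sub_eq_zero]

/-- The old marked point replaced by the points `2i` and `2i+1`. -/
lemma exists_half {S : Finset (Fin N)} (h1 : ¬ ∃ j ∈ S, 2 * n ≤ j.1) {k : Fin N} (hk : k ∈ S) :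
    ∃ i ∈ base n S, k.1 / 2 = i.1 ∧ ∀ w : Fin n → ℝ, pull n N w k = w i := by
  have hk' : k.1 / 2 < n := by
    by_contra hc
    exact h1 ⟨k, hk, by omega⟩
  exact ⟨⟨k.1 / 2, hk'⟩, mem_base.2 ⟨k, hk, rfl⟩, rfl, fun w => by simp [pull, hk']⟩

lemma FamLE.expFam (hN : N ≤ 2 * n + 1) {y x : Fam n} (hyx : FamLE y x) :
    FamLE (expFam hN y) (expFam hN x) := by
  intro S i hi j hj k hk l hl
  rw [cross_expFam_nonneg_iff hN x hi hj hk hl, cross_expFam_nonneg_iff hN y hi hj hk hl]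
  by_cases h1 : ∃ j ∈ S.1, 2 * n ≤ j.1
  · simp only [expVec, if_pos h1, imp_self]
  by_cases h2 : 2 ≤ (base n S.1).card
  · simp only [expVec, if_neg h1, dif_pos h2]
    obtain ⟨i, hi, -, ei⟩ := exists_half h1 hi
    obtain ⟨j, hj, -, ej⟩ := exists_half h1 hj
    obtain ⟨k, hk, -, ek⟩ := exists_half h1 hk
    obtain ⟨l, hl, -, el⟩ := exists_half h1 hl
    simp only [ei, ej, ek, el]
    rw [← cross_nonneg_iff, ← cross_nonneg_iff]
    exact hyx _ i hi j hj k hk l hl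
  · simp only [expVec, if_neg h1, dif_neg h2, imp_self]

lemma base_evenSet (h : 2 * n ≤ N) (S : Finset (Fin n)) : base n (evenSet h S) = S := by
  ext i
  rw [mem_base]
  constructor
  · rintro ⟨k, hk, e⟩
    obtain ⟨j, hj, rfl⟩ := mem_evenSet.1 hk
    have : j = i := Fin.ext (by simp only [evenPt] at e; omega)
    exact this ▸ hj
  · exact fun hi => ⟨_, evenPt_mem_evenSet.2 hi, by simp [evenPt]⟩

lemma not_exists_last_evenSet (h : 2 * n ≤ N) (S : Finset (Fin n)) :
    ¬ ∃ j ∈ evenSet h S, 2 * n ≤ j.1 := by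
  rintro ⟨k, hk, e⟩
  obtain ⟨j, -, rfl⟩ := mem_evenSet.1 hk
  simp only [evenPt] at e
  omega

/-- At a set of first points the expanded curve carries the old coordinate, because the old points
below it are in bijection with it. -/
lemma forget_expFam (h : 2 * n ≤ N) (hN : N ≤ 2 * n + 1) (x : Fam n) :
    forgetOdd h (expFam hN x) = x := by
  funext S
  obtain ⟨c, -, h1⟩ := forget_diff h (expFam hN x) S
  obtain ⟨d, -, h2⟩ := expFam_diff hN x (evenBig h S)
  refine eq_of_diff (c * d) fun i hi j hj => ?_
  have hb : 2 ≤ (base n (evenBig h S).1).card := by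
    rw [show base n (evenBig h S).1 = S.1 from base_evenSet h S.1]; exact S.2
  have hbS : (⟨base n (evenBig h S).1, hb⟩ : Big n) = S := Subtype.ext (base_evenSet h S.1)
  have hv : ∀ i, expVec n x (evenBig h S) (evenPt h i) = (x S).rep.1 i := by
    intro i
    have e : (x ⟨base n (evenBig h S).1, hb⟩).rep.1 = (x S).rep.1 :=
      congrArg (fun T : Big n => (x T).rep.1) hbS
    have hl : ¬ ∃ j ∈ (evenBig h S).1, 2 * n ≤ j.1 := not_exists_last_evenSet h S.1
    rw [expVec, if_neg hl, dif_pos hb, e]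
    simp [pull, evenPt]
  rw [h1 i hi j hj, h2 _ (evenPt_mem_evenSet.2 hi) _ (evenPt_mem_evenSet.2 hj), hv, hv, mul_assoc]

lemma expFam_injective (h : 2 * n ≤ N) (hN : N ≤ 2 * n + 1) : Function.Injective (expFam hN) :=
  Function.LeftInverse.injective (forget_expFam h hN)

lemma famLE_expFam_iff (h : 2 * n ≤ N) (hN : N ≤ 2 * n + 1) {y x : Fam n} :
    FamLE (expFam hN y) (expFam hN x) ↔ FamLE y x := by
  refine ⟨fun hyx => ?_, FamLE.expFam hN⟩
  simpa only [forget_expFam] using hyx.forgetOdd h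

/-- The expanded curves form a lower set. -/
lemma eq_expFam_of_le (h : 2 * n ≤ N) (hN : N ≤ 2 * n + 1) {z : Fam N} (hz : Compat z) {x : Fam n}
    (hzx : FamLE z (expFam hN x)) : z = expFam hN (forgetOdd h z) := by
  funext S
  suffices hs : ∃ c : ℝ, ∀ i ∈ S.1, ∀ j ∈ S.1, (z S).rep.1 i - (z S).rep.1 j =
      c * (expVec n (forgetOdd h z) S i - expVec n (forgetOdd h z) S j) by
    obtain ⟨c, hc⟩ := hs
    obtain ⟨d, hd, h2⟩ := expFam_diff hN (forgetOdd h z) S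
    refine eq_of_diff (c / d) fun i hi j hj => ?_
    rw [hc i hi j hj, h2 i hi j hj]
    field_simp
  -- The three cases of the expansion. Here `z` may only be coarser than the expanded curve: it
  -- collapses all points of `S` other than the last, which leaves one class in `P(V S)`.
  by_cases h1 : ∃ j ∈ S.1, 2 * n ≤ j.1
  · have e : expVec n (forgetOdd h z) S = lastVec n N := if_pos h1
    have e' : expVec n x S = lastVec n N := if_pos h1
    have hsame : ∀ i ∈ S.1, ∀ j ∈ S.1, lastVec n N i = lastVec n N j →
        (z S).rep.1 i = (z S).rep.1 j := fun i hi j hj hij =>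
      hzx.sameAt hi hj ((sameAt_expFam_iff hN x hi hj).2 (by rw [e', hij]))
    rw [e]
    obtain ⟨t, ht, htn⟩ := h1
    obtain ⟨k, hk, hkt⟩ := Finset.exists_mem_ne S.2 t
    have hlt : lastVec n N t = 1 := by simp [lastVec, htn]
    have hl0 : ∀ i : Fin N, i ≠ t → lastVec n N i = 0 := by
      intro i hit
      have := Fin.val_ne_of_ne hit
      have := i.2
      have := t.2
      simp only [lastVec, ite_eq_right_iff, one_ne_zero, imp_false]
      omega
    have hval : ∀ i ∈ S.1, (z S).rep.1 i = (z S).rep.1 k +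
        ((z S).rep.1 t - (z S).rep.1 k) * lastVec n N i := by
      intro i hi
      by_cases hit : i = t
      · rw [hit, hlt]; ring
      · rw [hl0 i hit, hsame i hi k hk (by rw [hl0 i hit, hl0 k hkt])]; ring
    refine ⟨(z S).rep.1 t - (z S).rep.1 k, fun i hi j hj => ?_⟩
    linear_combination hval i hi - hval j hj
  by_cases h2 : 2 ≤ (base n S.1).card
  · have e : expVec n (forgetOdd h z) S = pull n N (forgetOdd h z ⟨base n S.1, h2⟩).rep.1 := by
      rw [expVec, if_neg h1, dif_pos h2]
    rw [e]
    set B : Big n := ⟨base n S.1, h2⟩ with hB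
    -- The coordinates at `S` and at the first points are compared through their union. There `z`
    -- does not distinguish the two points replacing an old one, so a separated pair can be chosen
    -- both in `S` and among the first points.
    set T : Big N := ⟨S.1 ∪ evenSet h B.1, S.2.trans (Finset.card_le_card
      Finset.subset_union_left)⟩ with hT
    have hST : S.1 ⊆ T.1 := Finset.subset_union_left
    have hBT : (evenBig h B).1 ⊆ T.1 := Finset.subset_union_right
    have hT1 : ¬ ∃ j ∈ T.1, 2 * n ≤ j.1 := by
      rintro ⟨j, hj, hjn⟩
      rcases Finset.mem_union.1 hj with hj | hj
      · exact h1 ⟨j, hj, hjn⟩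
      · exact not_exists_last_evenSet h _ ⟨j, hj, hjn⟩
    have hTB : base n T.1 = B.1 := by
      ext i
      refine ⟨fun hi => ?_, fun hi => ?_⟩
      · obtain ⟨j, hj, hji⟩ := mem_base.1 hi
        rcases Finset.mem_union.1 hj with hj | hj
        · exact mem_base.2 ⟨j, hj, hji⟩
        · rw [← base_evenSet h B.1]
          exact mem_base.2 ⟨j, hj, hji⟩
      · obtain ⟨j, hj, hji⟩ := mem_base.1 hi
        exact mem_base.2 ⟨j, hST hj, hji⟩
    have hT2 : 2 ≤ (base n T.1).card := by rw [hTB]; exact h2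
    have hpair : ∀ k ∈ T.1, ∀ i : Fin n, k.1 / 2 = i.1 → i ∈ B.1 →
        (z T).rep.1 k = (z T).rep.1 (evenPt h i) := by
      intro k hk i hki hi
      have hi' := hBT (evenPt_mem_evenSet.2 hi)
      refine hzx.sameAt hk hi' ((sameAt_expFam_iff hN x hk hi').2 ?_)
      rw [expVec, if_neg hT1, dif_pos hT2]
      simp [pull, evenPt, hki]
    obtain ⟨k, hk, l, hl, hkl⟩ := exists_rep_ne (z T)
    obtain ⟨k', hk', ek, -⟩ := exists_half hT1 hk
    obtain ⟨l', hl', el, -⟩ := exists_half hT1 hl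
    rw [hTB] at hk' hl'
    rw [hpair k hk k' ek hk', hpair l hl l' el hl'] at hkl
    obtain ⟨b, hb, hbd⟩ := hz.exists_diff hBT (evenPt_mem_evenSet.2 hk') (evenPt_mem_evenSet.2 hl')
      hkl
    obtain ⟨k₂, hk₂, ek₂⟩ := mem_base.1 hk'
    obtain ⟨l₂, hl₂, el₂⟩ := mem_base.1 hl'
    rw [← hpair k₂ (hST hk₂) k' ek₂ hk', ← hpair l₂ (hST hl₂) l' el₂ hl'] at hkl
    obtain ⟨a, -, had⟩ := hz.exists_diff hST hk₂ hl₂ hkl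
    obtain ⟨c, hc, hcd⟩ := forget_diff h z B
    refine ⟨a / (b * c), fun i hi j hj => ?_⟩
    obtain ⟨i', hi', ei, hpi⟩ := exists_half h1 hi
    obtain ⟨j', hj', ej, hpj⟩ := exists_half h1 hj
    rw [hpi, hpj, hcd i' hi' j' hj', hbd _ (evenPt_mem_evenSet.2 hi') _ (evenPt_mem_evenSet.2 hj'),
      had i hi j hj, hpair i (hST hi) i' ei hi', hpair j (hST hj) j' ej hj']
    field_simp
  · have e : expVec n (forgetOdd h z) S = pairVec n N := by
      rw [expVec, if_neg h1, dif_neg h2]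
    rw [e]
    obtain ⟨i, hi, j, hj, hij⟩ := Finset.one_lt_card.1 S.2
    -- Only one old point lies below `S`, so `S` is a pair and `P(V S)` is a single point.
    have hhalf : ∀ k ∈ S.1, k.1 / 2 = i.1 / 2 := by
      intro k hk
      by_contra hne
      obtain ⟨k', hk', ek, -⟩ := exists_half h1 hk
      obtain ⟨i', hi', ei, -⟩ := exists_half h1 hi
      refine h2 (Finset.one_lt_card.2 ⟨k', hk', i', hi', fun e => hne ?_⟩)
      rw [ek, ei, e]
    have hmem : ∀ k ∈ S.1, k = i ∨ k = j := by
      intro k hk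
      have e1 := hhalf k hk
      have e2 := hhalf j hj
      have e3 := Fin.val_ne_of_ne hij
      simp only [Fin.ext_iff]
      omega
    have hne : pairVec n N i - pairVec n N j ≠ 0 := by
      intro h0
      refine ctr_pairVec_ne_zero S h1 h2 ((ctr_eq_zero_iff _ _).2 fun k hk l hl => ?_)
      rcases hmem k hk with rfl | rfl <;> rcases hmem l hl with rfl | rfl <;>
        linarith
    refine ⟨((z S).rep.1 i - (z S).rep.1 j) / (pairVec n N i - pairVec n N j), fun k hk l hl => ?_⟩
    rw [div_mul_eq_mul_div, eq_div_iff hne]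
    rcases hmem k hk with rfl | rfl <;> rcases hmem l hl with rfl | rfl <;> ring

/-! ### Stratified embeddings -/

lemma image_cls {X Y : Type*} {le : X → X → Prop} {le' : Y → Y → Prop} {f : X → Y}
    (hf : ∀ x y, le' (f x) (f y) ↔ le x y) (hdown : ∀ x z, le' z (f x) → z ∈ range f) (x : X) :
    f '' cls le x = cls le' (f x) := by
  ext z
  constructor
  · rintro ⟨y, ⟨h1, h2⟩, rfl⟩
    exact ⟨(hf _ _).2 h1, (hf _ _).2 h2⟩
  · rintro ⟨h1, h2⟩
    obtain ⟨y, rfl⟩ := hdown x z h1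
    exact ⟨y, ⟨(hf _ _).1 h1, (hf _ _).1 h2⟩, rfl⟩

lemma barLE_expBar_iff (x y : Mbar n) : BarLE (expBar n x) (expBar n y) ↔ BarLE x y :=
  famLE_expFam_iff (Nat.le_succ _) le_rfl

lemma mem_range_expBar (x : Mbar n) (z : Mbar (2 * n + 1)) (h : BarLE z (expBar n x)) :
    z ∈ range (expBar n) :=
  ⟨⟨_, forget_mem (Nat.le_succ _) z.2⟩,
    Subtype.ext (eq_expFam_of_le (Nat.le_succ _) le_rfl (compat_of_mem_Mbar z.2) h).symm⟩

lemma expBar_injective (n : ℕ) : Function.Injective (expBar n) := fun _ _ h =>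
  Subtype.ext (expFam_injective (Nat.le_succ _) le_rfl (congrArg Subtype.val h))

lemma isStratifiedEmbedding_expBar (hn : 2 ≤ n) :
    IsStratifiedEmbedding (strataBar n) (strataBar (2 * n + 1)) (expBar n) where
  source := isStratification_bar hn
  target := isStratification_bar (by omega)
  isEmbedding := ((continuous_expBar n).isClosedEmbedding (expBar_injective n)).isEmbedding
  image_mem := by
    rw [strataBar_eq hn, strataBar_eq (n := 2 * n + 1) (by omega)]
    rintro _ ⟨x, rfl⟩
    exact ⟨_, (image_cls barLE_expBar_iff mem_range_expBar x).symm⟩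

lemma pull_evenPt (h : 2 * n ≤ N) (a : Fin n → ℝ) (i : Fin n) : pull n N a (evenPt h i) = a i := by
  simp [pull, evenPt]

lemma expTil_fst_evenPt (x : Mtil n) (i : Fin n) :
    (expTil n x).1.1 (evenPt le_rfl i) = (√2)⁻¹ * x.1.1 i :=
  congrArg _ (pull_evenPt le_rfl x.1.1 i)

lemma expTil_injective (n : ℕ) : Function.Injective (expTil n) := by
  intro x y h
  refine Subtype.ext (Prod.ext (funext fun i => ?_)
    (expFam_injective le_rfl (Nat.le_succ _) (congrArg (fun z => z.1.2) h)))
  have h1 := expTil_fst_evenPt x i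
  rw [h, expTil_fst_evenPt] at h1
  exact (mul_left_cancel₀ (by positivity) h1).symm

lemma tilLE_expTil_iff (x y : Mtil n) : TilLE (expTil n x) (expTil n y) ↔ TilLE x y := by
  have hs : (0 : ℝ) < (√2)⁻¹ := by positivity
  refine and_congr (famLE_expFam_iff le_rfl (Nat.le_succ _)) ⟨fun h i j hij => ?_,
    fun h i j hij => ?_⟩
  · have := h (evenPt le_rfl i) (evenPt le_rfl j)
    simp only [expTil_fst_evenPt, mul_le_mul_iff_right₀ hs] at this
    exact this hij
  · have key : ∀ (x : Mtil n) (k : Fin (2 * n)), (expTil n x).1.1 k =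
        (√2)⁻¹ * x.1.1 ⟨k.1 / 2, by omega⟩ := fun x k => by
      have : k.1 / 2 < n := by omega
      show (√2)⁻¹ * pull n (2 * n) x.1.1 k = _
      simp [pull, this]
    rw [key, key, mul_le_mul_iff_right₀ hs] at hij ⊢
    exact h _ _ hij

/-- The family of `z` is expanded as before, and the order relation forces the sphere vector of `z`
to agree on the two points of each pair. A preimage with the right sign is supplied by the chart of
an order in which `z` is monotone. -/
lemma mem_range_expTil (hn : 2 ≤ n) (x : Mtil n) (z : Mtil (2 * n)) (h : TilLE z (expTil n x)) :
    z ∈ range (expTil n) := by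
  have hs : (0 : ℝ) < (√2)⁻¹ := by positivity
  obtain ⟨k1, k2, k3, k4⟩ := Mtil_rel (n := 2 * n) (by omega) z.2
  have hz : expFam (Nat.le_succ _) (forgetOdd le_rfl z.1.2) = z.1.2 :=
    (eq_expFam_of_le le_rfl (Nat.le_succ _) (compat_of_mem_Mbar k3) h.1).symm
  set a : Fin n → ℝ := fun i => √2 * z.1.1 (evenPt le_rfl i) with ha
  have hza : z.1.1 = (√2)⁻¹ • pull n (2 * n) a := by
    funext k
    have hk : k.1 / 2 < n := by omega
    have e1 : pull n (2 * n) x.1.1 k =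
        pull n (2 * n) x.1.1 (evenPt le_rfl ⟨k.1 / 2, hk⟩) := by
      rw [pull_evenPt]
      simp [pull, hk]
    have e2 : (expTil n x).1.1 k = (expTil n x).1.1 (evenPt le_rfl ⟨k.1 / 2, hk⟩) :=
      congrArg ((√2)⁻¹ * ·) e1
    have e3 : z.1.1 k = z.1.1 (evenPt le_rfl ⟨k.1 / 2, hk⟩) :=
      le_antisymm (h.2 _ _ e2.le) (h.2 _ _ e2.ge)
    simp only [Pi.smul_apply, smul_eq_mul]
    rw [show pull n (2 * n) a k = a ⟨k.1 / 2, hk⟩ by simp [pull, hk], e3, ha]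
    field_simp
  obtain ⟨τ, hτ⟩ := exists_isMonoTil z.2
  -- The order induced by `τ` on the first points.
  obtain ⟨σ, hσ⟩ : ∃ σ : Equiv.Perm (Fin n), ∀ i j, σ.symm i ≤ σ.symm j →
      τ.symm (evenPt le_rfl i) ≤ τ.symm (evenPt le_rfl j) := by
    refine ⟨Tuple.sort fun i => τ.symm (evenPt le_rfl i), fun i j hij => ?_⟩
    have := Tuple.monotone_sort (fun i => τ.symm (evenPt le_rfl i)) hij
    simpa using this
  obtain ⟨u, hu⟩ := exists_chart_eq (compat_of_mem_Mbar (forget_mem (le_refl (2 * n)) k3))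
    (hτ.1.forgetOdd le_rfl hσ)
  have hw := chartTilFam_mem σ hn u
  refine ⟨⟨_, hw⟩, Subtype.ext (Prod.ext ?_ ?_)⟩
  swap
  · exact (congrArg (expFam (Nat.le_succ _)) hu).trans hz
  show (√2)⁻¹ • pull n (2 * n) (chartTilFam σ u).1 = z.1.1
  rw [hza]
  congr 2
  obtain ⟨l1, -⟩ := Mtil_rel hn hw
  obtain ⟨-, -, -, l4⟩ := Mtil_rel (n := 2 * n) (by omega) (expTil n ⟨_, hw⟩).2
  -- Both vectors are centred and increase along `σ`. The squares of their differences agree because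
  -- they are read off from the full coordinate of the same expanded family.
  refine eq_of_products (σ := σ) l1 ?_ (fun i j => ?_) (isMonoTil_chartTil hn u).2 fun i j hij => ?_
  · have := sum_pull (fun t => t) a
    rw [hza] at k1
    simp only [Pi.smul_apply, smul_eq_mul, ← Finset.mul_sum] at k1
    have := (mul_eq_zero.1 k1).resolve_left hs.ne'
    linarith
  · have e : (expTil n ⟨_, hw⟩).1.2 = z.1.2 := (congrArg (expFam (Nat.le_succ _)) hu).trans hz
    have e1 := l4 (evenPt le_rfl i) (evenPt le_rfl j) (evenPt le_rfl i) (evenPt le_rfl j)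
    have e2 := k4 (evenPt le_rfl i) (evenPt le_rfl j) (evenPt le_rfl i) (evenPt le_rfl j)
    rw [e, e2] at e1
    simp only [expTil_fst_evenPt] at e1
    have h2 : √2 * √2 = 2 := Real.mul_self_sqrt (by norm_num)
    have h3 : (√2)⁻¹ * (√2)⁻¹ = 2⁻¹ := by rw [← mul_inv, h2]
    simp only [ha]
    linear_combination -2 * e1 - 2 * ((chartTilFam σ u).1 i - (chartTilFam σ u).1 j) ^ 2 * h3 -
      (z.1.1 (evenPt le_rfl i) - z.1.1 (evenPt le_rfl j)) ^ 2 * h2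
  · exact mul_le_mul_of_nonneg_left (hτ.2 _ _ (hσ i j hij)) (Real.sqrt_nonneg 2)

lemma isBounded_Mtil_fst (hn : 2 ≤ n) :
    Mtil n ⊆ (univ.pi fun _ : Fin n => Icc (-1 : ℝ) 1) ×ˢ univ := by
  intro x hx
  obtain ⟨-, h2, -⟩ := Mtil_rel hn hx
  refine ⟨fun i _ => ?_, mem_univ _⟩
  have : x.1 i ^ 2 ≤ 1 := by
    rw [← h2]
    exact Finset.single_le_sum (fun j _ => sq_nonneg (x.1 j)) (Finset.mem_univ i)
  exact abs_le.1 ((sq_le_one_iff_abs_le_one _).1 this)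

lemma compactSpace_Mtil (hn : 2 ≤ n) : CompactSpace (Mtil n) :=
  isCompact_iff_compactSpace.1 (((isCompact_univ_pi fun _ => isCompact_Icc).prod
    isCompact_univ).of_isClosed_subset isClosed_closure (isBounded_Mtil_fst hn))

lemma isStratifiedEmbedding_expTil (hn : 2 ≤ n) :
    IsStratifiedEmbedding (strataTil n) (strataTil (2 * n)) (expTil n) where
  source := isStratification_til hn
  target := isStratification_til (by omega)
  isEmbedding := by
    have := compactSpace_Mtil hn
    exact ((continuous_expTil n).isClosedEmbedding (expTil_injective n)).isEmbedding
  image_mem := by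
    rw [strataTil_eq hn, strataTil_eq (n := 2 * n) (by omega)]
    rintro _ ⟨x, rfl⟩
    exact ⟨_, (image_cls tilLE_expTil_iff (mem_range_expTil hn) x).symm⟩

end

section

/-! ### Cellular spaces as CW complexes -/

/-- The open cells are the classes, with the cell maps as characteristic maps. A boundary point lies
in a strictly smaller class, so in one of finitely many cells of smaller dimension; `hcl` is the
weak topology. -/
lemma Cellular.isCWWithCells {X : Type} [TopologicalSpace X] [T2Space X] {le : X → X → Prop}
    {dim : X → ℕ} (h : Cellular le dim)
    (hfin : ∀ x, {e | ∃ y, le y x ∧ e = cls le y}.Finite)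
    (hcl : ∀ A : Set X, (∀ x, IsClosed (A ∩ {y | le y x})) → IsClosed A) :
    IsCWWithCells X (range (cls le)) := by
  refine ⟨inferInstance, ?_⟩
  let cell : ℕ → Type := fun d => {e : Set X // ∃ x, dim x = d ∧ e = cls le x}
  have hex : ∀ d (i : cell d), ∃ φ : (Fin d → ℝ) → X, IsCellMap φ (closure i.1) i.1 := by
    rintro d ⟨_, x, rfl, rfl⟩
    obtain ⟨φ, hφ⟩ := h.cell x
    exact ⟨φ, by rw [h.closure_cls]; exact hφ⟩
  choose φ hφ using hex
  let cw : CWComplex (univ : Set X) :=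
    { cell := cell
      map := fun d i => ((hφ d i).injOn.mono Metric.ball_subset_closedBall).toPartialEquiv
      source_eq := fun d i => rfl
      continuousOn := fun d i => (hφ d i).continuousOn
      continuousOn_symm := fun d i => continuousOn_invFunOn (hφ d i).isEmbedding
        ((hφ d i).injOn.mono Metric.ball_subset_closedBall)
      pairwiseDisjoint' := by
        rintro ⟨d, i⟩ - ⟨d', i'⟩ - hne
        change Disjoint (φ d i '' _) (φ d' i' '' _)
        rw [(hφ d i).image_ball, (hφ d' i').image_ball]
        refine Set.disjoint_left.2 fun z hz hz' => hne ?_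
        -- The class determines the cell: comparable points in both directions have equal dimension.
        have hext : ∀ {d d'} {i : cell d} {i' : cell d'}, d = d' → i.1 = i'.1 →
            (⟨d, i⟩ : Σ d, cell d) = ⟨d', i'⟩ := by
          rintro d _ i i' rfl hi
          rw [Subtype.ext hi]
        obtain ⟨x, hd, he⟩ := i.2
        obtain ⟨x', hd', he'⟩ := i'.2
        rw [he] at hz
        rw [he'] at hz'
        refine hext ?_ ?_
        · rw [← hd, ← hd', h.dim_eq hz.2 hz.1, h.dim_eq hz'.2 hz'.1]
        · rw [he, he', ← h.cls_eq hz, ← h.cls_eq hz']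
      mapsTo' := by
        rintro d i
        obtain ⟨x, hd, he⟩ := i.2
        have hI : ∀ m, {j : cell m | ∃ y, le y x ∧ j.1 = cls le y}.Finite := fun m =>
          Set.Finite.of_finite_image ((hfin x).subset (by
            rintro _ ⟨j, hj, rfl⟩; exact hj)) Subtype.val_injective.injOn
        refine ⟨fun m => (hI m).toFinset, fun z hz => ?_⟩
        change φ d i z ∈ _
        have hzc := Metric.sphere_subset_closedBall hz
        have h1 : φ d i z ∈ closure i.1 := by
          rw [← (hφ d i).image_closedBall]; exact mem_image_of_mem _ hzc
        -- The cell map is injective on the whole closed cube, so the sphere misses the open cell.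
        have h2 : φ d i z ∉ i.1 := by
          rw [← (hφ d i).image_ball]
          rintro ⟨w, hw, hwz⟩
          have := (hφ d i).injOn (Metric.ball_subset_closedBall hw) hzc hwz
          rw [this, mem_ball_zero_iff] at hw
          rw [mem_sphere_zero_iff_norm] at hz
          exact hw.ne hz
        rw [he, h.closure_cls] at h1
        rw [he] at h2
        have h1' : le (φ d i z) x := h1
        have h3 : ¬ le x (φ d i z) := fun h3 => h2 ⟨h1, h3⟩
        simp only [mem_iUnion]
        refine ⟨dim (φ d i z), (h.dim_lt _ _ h1' h3).trans_eq hd, ⟨cls le (φ d i z), _, rfl, rfl⟩, ?_, ?_⟩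
        · simp only [Finite.mem_toFinset]
          exact ⟨_, h1, rfl⟩
        · change _ ∈ φ _ _ '' _
          rw [(hφ _ _).image_closedBall]
          exact subset_closure (h.mem_cls _)
      closed' := by
        intro A _ hA
        refine hcl A fun x => ?_
        have := hA (dim x) ⟨cls le x, x, rfl, rfl⟩
        change IsClosed (A ∩ φ _ _ '' _) at this
        rw [(hφ _ _).image_closedBall, h.closure_cls] at this
        exact this
      union' := by
        refine eq_univ_of_forall fun x => ?_
        simp only [mem_iUnion]
        refine ⟨dim x, ⟨cls le x, x, rfl, rfl⟩, ?_⟩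
        change _ ∈ φ _ _ '' _
        rw [(hφ _ _).image_closedBall]
        exact subset_closure (h.mem_cls _) }
  refine ⟨cw, ?_⟩
  have hopen : ∀ d (i : cell d), RelCWComplex.openCell (C := (univ : Set X)) d i = i.1 :=
    fun d i => (hφ d i).image_ball
  ext e
  constructor
  · rintro ⟨x, rfl⟩
    exact ⟨dim x, ⟨cls le x, x, rfl, rfl⟩, (hopen (dim x) ⟨cls le x, x, rfl, rfl⟩).symm⟩
  · rintro ⟨d, i, rfl⟩
    obtain ⟨x, -, he⟩ := i.2
    exact ⟨x, ((hopen d i).trans he).symm⟩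

/-! ### Inductive limits of sequences -/

section Tower

variable (F : ℕ ⥤ TopCat.{0})

/-- The inductive limit of a sequence of spaces. -/
abbrev Tower : Type := (colimit F : TopCat.{0})

/-- The canonical map to the inductive limit. -/
def toTower (k : ℕ) (x : F.obj k) : Tower F := (colimit.ι F k).hom x

/-- The maps of the sequence. -/
def up {k l : ℕ} (h : k ≤ l) (x : F.obj k) : F.obj l := (F.map (homOfLE h)).hom x

variable {F}

lemma continuous_toTower (k : ℕ) : Continuous (toTower F k) := (colimit.ι F k).hom.continuous

lemma toTower_up {k l : ℕ} (h : k ≤ l) (x : F.obj k) : toTower F l (up F h x) = toTower F k x :=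
  ConcreteCategory.congr_hom (colimit.w F (homOfLE h)) x

lemma up_up {k l m : ℕ} (h : k ≤ l) (h' : l ≤ m) (x : F.obj k) :
    up F h' (up F h x) = up F (h.trans h') x :=
  (ConcreteCategory.congr_hom (F.map_comp (homOfLE h) (homOfLE h')) x).symm

lemma up_self {k : ℕ} (x : F.obj k) : up F le_rfl x = x :=
  ConcreteCategory.congr_hom (F.map_id k) x

lemma isClosed_tower_iff {A : Set (Tower F)} : IsClosed A ↔ ∀ k, IsClosed (toTower F k ⁻¹' A) :=
  TopCat.isClosed_iff_of_isColimit _ (colimit.isColimit F) A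

lemma exists_toTower (t : Tower F) : ∃ k x, toTower F k x = t := by
  obtain ⟨k, x, hx⟩ := Types.jointly_surjective_of_isColimit
    (isColimitOfPreserves (CategoryTheory.forget TopCat) (colimit.isColimit F)) t
  exact ⟨k, x, hx⟩

lemma exists_toTower_ge {k l : ℕ} (h : k ≤ l) (x : F.obj k) :
    ∃ y, toTower F l y = toTower F k x := ⟨_, toTower_up h x⟩

/-- Compatible continuous maps from the spaces of the sequence. -/
lemma exists_desc {Y : Type} [TopologicalSpace Y] (g : ∀ k, F.obj k → Y)
    (hg : ∀ k, Continuous (g k)) (hs : ∀ k x, g (k + 1) (up F (Nat.le_succ k) x) = g k x) :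
    ∃ p : Tower F → Y, Continuous p ∧ ∀ k x, p (toTower F k x) = g k x := by
  have hs' : ∀ k l (h : k ≤ l) x, g l (up F h x) = g k x := by
    intro k l h
    induction l, h using Nat.le_induction with
    | base => intro x; rw [up_self]
    | succ l h ih => intro x; rw [← ih, ← hs l, up_up]
  let c : Cocone F :=
    { pt := TopCat.of Y
      ι := { app := fun k => TopCat.ofHom ⟨g k, hg k⟩
             naturality := fun k l f => by
              ext x
              exact hs' k l (leOfHom f) x } }
  exact ⟨(colimit.desc F c).hom, (colimit.desc F c).hom.continuous, fun k x =>
    ConcreteCategory.congr_hom (colimit.ι_desc c k) x⟩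

/-- Maps to Hausdorff spaces with compatible left inverses separate the points of the limit. -/
lemma tower_separated {Y : ℕ → Type} [∀ k, TopologicalSpace (Y k)] [∀ k, T2Space (Y k)]
    {q : ∀ k, F.obj k → Y k} (hq : ∀ k, Continuous (q k)) (hi : ∀ k, Function.Injective (q k))
    {G : ∀ k, Y (k + 1) → Y k} (hG : ∀ k, Continuous (G k))
    (h : ∀ k x, G k (q (k + 1) (up F (Nat.le_succ k) x)) = q k x) :
    (∀ k, Function.Injective (toTower F k)) ∧ T2Space (Tower F) := by
  -- The composite of `k` successive retractions, down to level `m`.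
  let U : ∀ m k, Y (m + k) → Y m := fun m k => Nat.rec id (fun k ih y => ih (G (m + k) y)) k
  have hU : ∀ m k, Continuous (U m k) := by
    intro m k
    induction k with
    | zero => exact continuous_id
    | succ k ih => exact ih.comp (hG _)
  have hs : ∀ m k x, U m (k + 1) (q (m + (k + 1)) (up F (Nat.le_succ (m + k)) x)) =
      U m k (q (m + k) x) := fun m k x => congrArg (U m k) (h (m + k) x)
  -- The map of the limit to `Y m`: on level `k`, first go up to level `m + k`, which is at least
  -- both `k` and `m`, and then retract.
  have hp : ∀ m, ∃ p : Tower F → Y m, Continuous p ∧ ∀ k x, p (toTower F k x) =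
      U m k (q (m + k) (up F (Nat.le_add_left k m) x)) := fun m => by
    refine exists_desc (fun k x => U m k (q (m + k) (up F (Nat.le_add_left k m) x)))
      (fun k => ?_) fun k x => ?_
    · exact (hU m k).comp ((hq _).comp (F.map (homOfLE (Nat.le_add_left k m))).hom.continuous)
    · rw [← hs, up_up, up_up]
  choose p hpc hp using hp
  have hpq : ∀ m x, p m (toTower F m x) = q m x := by
    intro m x
    rw [hp]
    have : ∀ k, U m k (q (m + k) (up F (Nat.le_add_right m k) x)) = q m x := by
      intro k
      induction k with
      | zero => exact congrArg (q m) (up_self x)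
      | succ k ih => rw [← ih, ← hs, up_up]
    exact this m
  refine ⟨fun k x y hxy => hi k (by rw [← hpq, ← hpq, hxy]), ?_⟩
  refine T2Space.of_injective_continuous (f := fun t m => p m t) (fun s t hst => ?_)
    (continuous_pi hpc)
  obtain ⟨k, x, rfl⟩ := exists_toTower s
  obtain ⟨l, y, rfl⟩ := exists_toTower t
  have := congrFun hst (max k l)
  dsimp only at this
  rw [← toTower_up (le_max_left k l), ← toTower_up (le_max_right k l) y, hpq, hpq] at this
  rw [← toTower_up (le_max_left k l), hi _ this, toTower_up]

/-! ### Towers of cellular spaces -/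

/-- A sequence of cellular spaces which are lower sets in the following ones. -/
structure IsCellTower (F : ℕ ⥤ TopCat.{0}) (le : ∀ k, F.obj k → F.obj k → Prop)
    (dim : ∀ k, F.obj k → ℕ) : Prop where
  cellular : ∀ k, Cellular (le k) (dim k)
  finite : ∀ k, (range (cls (le k))).Finite
  le_iff : ∀ k x y, le (k + 1) (up F (Nat.le_succ k) x) (up F (Nat.le_succ k) y) ↔ le k x y
  down : ∀ k x z, le (k + 1) z (up F (Nat.le_succ k) x) → z ∈ range (up F (Nat.le_succ k))
  injective : ∀ k, Function.Injective (toTower F k)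
  t2 : T2Space (Tower F)

variable {le : ∀ k, F.obj k → F.obj k → Prop} {dim : ∀ k, F.obj k → ℕ}

variable (le) in
/-- The face order of the limit. -/
def towerLE (s t : Tower F) : Prop := ∃ k x y, le k x y ∧ toTower F k x = s ∧ toTower F k y = t

variable (dim) in
/-- The dimension of the cells of the limit. -/
def towerDim (t : Tower F) : ℕ := dim _ (exists_toTower t).choose_spec.choose

namespace IsCellTower

variable (h : IsCellTower F le dim)
include h

lemma le_up_iff {k l : ℕ} (hkl : k ≤ l) (x y : F.obj k) :
    le l (up F hkl x) (up F hkl y) ↔ le k x y := by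
  induction l, hkl using Nat.le_induction with
  | base => rw [up_self, up_self]
  | succ l hkl ih => rw [← ih, ← h.le_iff l, up_up, up_up]

lemma down_up {k l : ℕ} (hkl : k ≤ l) (x : F.obj k) (z : F.obj l) (hz : le l z (up F hkl x)) :
    ∃ y, up F hkl y = z := by
  induction l, hkl using Nat.le_induction with
  | base => exact ⟨z, up_self z⟩
  | succ l hkl ih =>
    rw [← up_up hkl (Nat.le_succ l)] at hz
    obtain ⟨w, rfl⟩ := h.down l _ z hz
    obtain ⟨y, rfl⟩ := ih w ((h.le_iff l _ _).1 hz)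
    exact ⟨y, (up_up _ _ _).symm⟩

lemma towerLE_iff {k : ℕ} (x y : F.obj k) :
    towerLE le (toTower F k x) (toTower F k y) ↔ le k x y := by
  refine ⟨?_, fun hxy => ⟨k, x, y, hxy, rfl, rfl⟩⟩
  rintro ⟨l, x', y', h1, h2, h3⟩
  rw [← toTower_up (le_max_right k l), ← toTower_up (le_max_left k l)] at h2 h3
  rw [← h.le_up_iff (le_max_left k l), ← h.injective _ h2, ← h.injective _ h3, h.le_up_iff]
  exact h1

/-- Each level is a lower set of the limit. This lets all the cell data be inherited unchanged from
the levels. -/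
lemma exists_of_towerLE {k : ℕ} {s : Tower F} {x : F.obj k} (hs : towerLE le s (toTower F k x)) :
    s ∈ range (toTower F k) := by
  obtain ⟨l, x', y', h1, rfl, h3⟩ := hs
  rw [← toTower_up (le_max_right k l), ← toTower_up (le_max_left k l)] at h3
  rw [← h.le_up_iff (le_max_right k l), h.injective _ h3] at h1
  obtain ⟨y, hy⟩ := h.down_up _ _ _ h1
  exact ⟨y, by rw [← toTower_up (le_max_left k l), hy, toTower_up]⟩

lemma dim_up {k l : ℕ} (hkl : k ≤ l) (x : F.obj k) : dim l (up F hkl x) = dim k x :=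
  (h.cellular k).dim_map (h.cellular l) (h.le_up_iff hkl) (h.down_up hkl) x

lemma dim_eq_of_toTower_eq {k l : ℕ} {x : F.obj k} {y : F.obj l}
    (hxy : toTower F k x = toTower F l y) : dim k x = dim l y := by
  rw [← toTower_up (le_max_left k l), ← toTower_up (le_max_right k l)] at hxy
  rw [← h.dim_up (le_max_left k l), h.injective _ hxy, h.dim_up]

lemma towerDim_eq {k : ℕ} (x : F.obj k) : towerDim dim (toTower F k x) = dim k x :=
  h.dim_eq_of_toTower_eq (exists_toTower (toTower F k x)).choose_spec.choose_spec

lemma image_le {k : ℕ} (x : F.obj k) :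
    toTower F k '' {y | le k y x} = {s | towerLE le s (toTower F k x)} := by
  ext s
  constructor
  · rintro ⟨y, hy, rfl⟩
    exact (h.towerLE_iff y x).2 hy
  · intro hs
    obtain ⟨y, rfl⟩ := h.exists_of_towerLE hs
    exact ⟨y, (h.towerLE_iff y x).1 hs, rfl⟩

lemma image_cls {k : ℕ} (x : F.obj k) :
    toTower F k '' cls (le k) x = cls (towerLE le) (toTower F k x) :=
  RealModuli.image_cls h.towerLE_iff (fun _ _ hs => h.exists_of_towerLE hs) x

lemma cellular_tower : Cellular (towerLE le) (towerDim dim) where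
  refl t := by
    obtain ⟨k, x, rfl⟩ := exists_toTower t
    exact (h.towerLE_iff x x).2 ((h.cellular k).refl x)
  trans s t u hst htu := by
    obtain ⟨k, x, rfl⟩ := exists_toTower u
    obtain ⟨y, rfl⟩ := h.exists_of_towerLE htu
    obtain ⟨z, rfl⟩ := h.exists_of_towerLE hst
    rw [h.towerLE_iff] at hst htu ⊢
    exact (h.cellular k).trans _ _ _ hst htu
  dim_lt t s hst hts := by
    obtain ⟨k, x, rfl⟩ := exists_toTower t
    obtain ⟨y, rfl⟩ := h.exists_of_towerLE hst
    rw [h.towerLE_iff] at hst hts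
    rw [h.towerDim_eq, h.towerDim_eq]
    exact (h.cellular k).dim_lt _ _ hst hts
  facet t ht := by
    obtain ⟨k, x, rfl⟩ := exists_toTower t
    rw [h.towerDim_eq] at ht
    obtain ⟨y, h1, h2, h3⟩ := (h.cellular k).facet x ht
    refine ⟨toTower F k y, ?_⟩
    rw [h.towerLE_iff, h.towerLE_iff, h.towerDim_eq, h.towerDim_eq]
    exact ⟨h1, h2, h3⟩
  cell t := by
    obtain ⟨k, x, rfl⟩ := exists_toTower t
    obtain ⟨φ, hφ⟩ := (h.cellular k).cell x
    rw [h.towerDim_eq]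
    refine ⟨toTower F k ∘ φ, ?_⟩
    have := hφ.comp (continuous_toTower k).continuousOn (h.injective k).injOn
    rw [h.image_le] at this
    rw [show toTower F k '' {y | le k y x ∧ le k x y} = cls (towerLE le) (toTower F k x) from
      h.image_cls x] at this
    exact this

lemma finite_cells {k : ℕ} (x : F.obj k) :
    {e | ∃ s, towerLE le s (toTower F k x) ∧ e = cls (towerLE le) s}.Finite := by
  refine ((h.finite k).image (toTower F k '' ·)).subset ?_
  rintro _ ⟨s, hs, rfl⟩
  obtain ⟨y, rfl⟩ := h.exists_of_towerLE hs
  exact ⟨_, ⟨y, rfl⟩, h.image_cls y⟩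

/-- Closedness is tested on the levels, and each level is a finite union of closed cells. -/
lemma isClosed_of_cells {A : Set (Tower F)}
    (hA : ∀ t, IsClosed (A ∩ {s | towerLE le s t})) : IsClosed A := by
  refine isClosed_tower_iff.2 fun k => ?_
  have : toTower F k ⁻¹' A = ⋃ C ∈ range (cls (le k)), ⋃ x ∈ C,
      toTower F k ⁻¹' (A ∩ {s | towerLE le s (toTower F k x)}) := by
    ext y
    simp only [mem_preimage, mem_iUnion, mem_inter_iff]
    constructor
    · intro hy
      exact ⟨_, ⟨y, rfl⟩, y, (h.cellular k).mem_cls y, hy, (h.cellular_tower).refl _⟩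
    · rintro ⟨_, _, _, _, hy, _⟩
      exact hy
  rw [this]
  refine (h.finite k).isClosed_biUnion ?_
  rintro _ ⟨x, rfl⟩
  have : ⋃ y ∈ cls (le k) x, toTower F k ⁻¹' (A ∩ {s | towerLE le s (toTower F k y)}) =
      toTower F k ⁻¹' (A ∩ {s | towerLE le s (toTower F k x)}) := by
    refine Subset.antisymm (iUnion₂_subset fun y hy z hz => ⟨hz.1, ?_⟩)
      (subset_biUnion_of_mem (u := fun y => toTower F k ⁻¹' (A ∩ {s | towerLE le s (toTower F k y)}))
        ((h.cellular k).mem_cls x))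
    exact h.cellular_tower.trans _ _ _ hz.2 ((h.towerLE_iff _ _).2 hy.1)
  rw [this]
  exact (hA _).preimage (continuous_toTower k)

lemma range_cls : range (cls (towerLE le)) =
    {e | ∃ k, ∃ s ∈ range (cls (le k)), e = toTower F k '' s} := by
  ext e
  constructor
  · rintro ⟨t, rfl⟩
    obtain ⟨k, x, rfl⟩ := exists_toTower t
    exact ⟨k, _, ⟨x, rfl⟩, (h.image_cls x).symm⟩
  · rintro ⟨k, _, ⟨x, rfl⟩, rfl⟩
    exact ⟨_, (h.image_cls x).symm⟩

lemma isCWWithCells :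
    IsCWWithCells (Tower F) {e | ∃ k, ∃ s ∈ range (cls (le k)), e = toTower F k '' s} := by
  have := h.t2
  rw [← h.range_cls]
  refine h.cellular_tower.isCWWithCells (fun t => ?_) fun A hA => h.isClosed_of_cells hA
  obtain ⟨k, x, rfl⟩ := exists_toTower t
  exact h.finite_cells x

/-- Finitely many cells lie in one level `m`, and the cells meeting `U` cover `U`. So `U` would be
contained in level `m`, although its preimage in level `m + 1` is open and nonempty and must meet
the dense complement of level `m`. -/
lemma nowhereLocallyFinite
    (hd : ∀ k, Dense (range (up F (Nat.le_succ k)))ᶜ) :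
    NowhereLocallyFinite {e | ∃ k, ∃ s ∈ range (cls (le k)), e = toTower F k '' s} := by
  intro t U hU hfin
  have hbd : ∃ m, ∀ e ∈ {e | e ∈ {e | ∃ k, ∃ s ∈ range (cls (le k)), e = toTower F k '' s} ∧
      (e ∩ U).Nonempty}, e ⊆ range (toTower F m) := by
    have h1 : ∀ e ∈ {e | e ∈ {e | ∃ k, ∃ s ∈ range (cls (le k)), e = toTower F k '' s} ∧
        (e ∩ U).Nonempty}, ∃ k, e ⊆ range (toTower F k) := by
      rintro _ ⟨⟨k, s, -, rfl⟩, -⟩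
      exact ⟨k, image_subset_range _ _⟩
    choose! f hf using h1
    obtain ⟨m, hm⟩ := (hfin.image f).bddAbove
    refine ⟨m, fun e he => (hf e he).trans ?_⟩
    rintro _ ⟨x, rfl⟩
    exact exists_toTower_ge (hm (mem_image_of_mem f he)) x
  obtain ⟨m, hm⟩ := hbd
  have hUm : U ⊆ range (toTower F m) := by
    intro u hu
    obtain ⟨k, x, rfl⟩ := exists_toTower u
    have hx := mem_image_of_mem (toTower F k) ((h.cellular k).mem_cls x)
    exact hm _ ⟨⟨k, _, ⟨x, rfl⟩, rfl⟩, ⟨_, hx, hu⟩⟩ hx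
  obtain ⟨V, hVU, hV, htV⟩ := mem_nhds_iff.1 hU
  obtain ⟨x, rfl⟩ := hUm (mem_of_mem_nhds hU)
  obtain ⟨y, hy, hyV⟩ := (hd m).exists_mem_open (hV.preimage (continuous_toTower (m + 1)))
    ⟨up F (Nat.le_succ m) x, by rw [mem_preimage, toTower_up]; exact htV⟩
  obtain ⟨z, hz⟩ := hUm (hVU hyV)
  rw [← toTower_up (Nat.le_succ m)] at hz
  exact hy ⟨z, h.injective _ hz⟩

end IsCellTower

end Tower

end

section

/-! ### The two towers -/

lemma up_systemBar (k : ℕ) (x : Mbar (levBar k)) :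
    up systemBar (Nat.le_succ k) x = expBar (levBar k) x :=
  ConcreteCategory.congr_hom (Functor.ofSequence_map_homOfLE_succ
    (fun k => TopCat.ofHom ⟨expBar (levBar k), continuous_expBar _⟩) k) x

lemma up_systemTil (k : ℕ) (x : Mtil (levTil k)) :
    up systemTil (Nat.le_succ k) x = expTil (levTil k) x :=
  ConcreteCategory.congr_hom (Functor.ofSequence_map_homOfLE_succ
    (fun k => TopCat.ofHom ⟨expTil (levTil k), continuous_expTil _⟩) k) x

lemma two_le_levBar (k : ℕ) : 2 ≤ levBar k := by
  cases k with
  | zero => exact le_rfl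
  | succ k => have := levBar_add_one k; have := Nat.one_le_two_pow (n := k); rw [levBar]; omega

lemma two_le_levTil (k : ℕ) : 2 ≤ levTil k := by
  rw [levTil_eq, pow_succ]
  have := Nat.one_le_two_pow (n := k)
  omega

/-- The retractions are the maps forgetting the odd marked points. -/
lemma tower_separated_bar : (∀ k, Function.Injective (toTower systemBar k)) ∧
    T2Space (Tower systemBar) :=
  tower_separated (F := systemBar) (Y := fun k => Fam (levBar k))
    (q := fun k (x : Mbar (levBar k)) => x.1) (fun _ => continuous_subtype_val)
    (fun _ => Subtype.val_injective) (G := fun k => forgetOdd (Nat.le_succ (2 * levBar k)))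
    (fun _ => continuous_forget _) fun k x =>
      (congrArg (fun y : Mbar (2 * levBar k + 1) => forgetOdd (Nat.le_succ (2 * levBar k)) y.1)
        (up_systemBar k x)).trans (forget_expFam (Nat.le_succ (2 * levBar k)) le_rfl _)

lemma tower_separated_til : (∀ k, Function.Injective (toTower systemTil k)) ∧
    T2Space (Tower systemTil) :=
  tower_separated (F := systemTil) (Y := fun k => (Fin (levTil k) → ℝ) × Fam (levTil k))
    (q := fun k (x : Mtil (levTil k)) => x.1) (fun _ => continuous_subtype_val)
    (fun _ => Subtype.val_injective)
    (G := fun k z => (√2 • (z.1 ∘ evenPt (le_refl (2 * levTil k))),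
      forgetOdd (le_refl (2 * levTil k)) z.2))
    (fun k => Continuous.prodMk (by fun_prop) ((continuous_forget _).comp continuous_snd))
    fun k x => by
      refine (congrArg (fun y : Mtil (2 * levTil k) =>
        (√2 • (y.1.1 ∘ evenPt (le_refl (2 * levTil k))),
          forgetOdd (le_refl (2 * levTil k)) y.1.2)) (up_systemTil k x)).trans ?_
      refine Prod.ext (funext fun i => ?_) (forget_expFam le_rfl (Nat.le_succ _) _)
      have h := expTil_fst_evenPt (n := levTil k) x i
      show √2 * (expTil (levTil k) x).1.1 (evenPt le_rfl i) = _
      rw [h, mul_inv_cancel_left₀ (by positivity)]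

lemma exists_isCellTower_bar :
    ∃ dim, IsCellTower systemBar (fun k => BarLE (n := levBar k)) dim := by
  choose dim hdim using fun k => exists_cellular_bar (levBar k)
  refine ⟨dim, ⟨hdim, fun k => ?_, fun k x y => ?_, fun k x z hz => ?_, tower_separated_bar.1,
    tower_separated_bar.2⟩⟩
  · have := finite_openStrata_closedStrata (tileBar (n := levBar k)) divisorBar
    rwa [← strataBar, strataBar_eq (two_le_levBar k)] at this
  · exact (iff_of_eq (congrArg₂ (BarLE (n := 2 * levBar k + 1)) (up_systemBar k x)
      (up_systemBar k y))).trans (barLE_expBar_iff _ _)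
  · obtain ⟨y, hy⟩ := mem_range_expBar _ _
      ((congrArg (BarLE (n := 2 * levBar k + 1) z) (up_systemBar k x)).mp hz)
    exact ⟨y, (up_systemBar k y).trans hy⟩

lemma exists_isCellTower_til :
    ∃ dim, IsCellTower systemTil (fun k => TilLE (n := levTil k)) dim := by
  choose dim hdim using fun k => exists_cellular_til (two_le_levTil k)
  refine ⟨dim, ⟨hdim, fun k => ?_, fun k x y => ?_, fun k x z hz => ?_, tower_separated_til.1,
    tower_separated_til.2⟩⟩
  · have := finite_openStrata_closedStrata (tileTil (n := levTil k)) divisorTil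
    rwa [← strataTil, strataTil_eq (two_le_levTil k)] at this
  · exact (iff_of_eq (congrArg₂ (TilLE (n := 2 * levTil k)) (up_systemTil k x)
      (up_systemTil k y))).trans (tilLE_expTil_iff _ _)
  · obtain ⟨y, hy⟩ := mem_range_expTil (two_le_levTil k) _ _
      ((congrArg (TilLE (n := 2 * levTil k) z) (up_systemTil k x)).mp hz)
    exact ⟨y, (up_systemTil k y).trans hy⟩

lemma strataTowerBar_eq : strataTowerBar =
    {e | ∃ k, ∃ s ∈ range (cls (BarLE (n := levBar k))), e = toTower systemBar k '' s} := by
  have : ∀ k, range (cls (BarLE (n := levBar k))) = strataBar (levBar k) := fun k =>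
    (strataBar_eq (two_le_levBar k)).symm
  simp only [this]
  rfl

lemma strataTowerTil_eq : strataTowerTil =
    {e | ∃ k, ∃ s ∈ range (cls (TilLE (n := levTil k))), e = toTower systemTil k '' s} := by
  have : ∀ k, range (cls (TilLE (n := levTil k))) = strataTil (levTil k) := fun k =>
    (strataTil_eq (two_le_levTil k)).symm
  simp only [this]
  rfl

/-! ### Generic curves are not expanded -/

variable {n N : ℕ}

/-- The coordinate of the three points `0, 1, 2` of an expanded curve collapses the pair `0, 1`,
whereas distinct points of a line are never collapsed. -/
lemma conf_ne_expFam (hn : 2 ≤ n) (h : 2 * n ≤ N) (hN : N ≤ 2 * n + 1) {b : Fin N → ℝ}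
    (hb : Function.Injective b) (x : Fam n) : conf b hb ≠ expFam hN x := by
  intro he
  have hN' : 4 ≤ N := by omega
  set S : Big N := ⟨{(⟨0, by omega⟩ : Fin N), (⟨1, by omega⟩ : Fin N), (⟨2, by omega⟩ : Fin N)}, by
    rw [Finset.card_insert_of_notMem (by simp), Finset.card_pair (by simp)]; omega⟩ with hS
  have h0 : (⟨0, by omega⟩ : Fin N) ∈ S.1 := by simp [hS]
  have h1 : (⟨1, by omega⟩ : Fin N) ∈ S.1 := by simp [hS]
  have h2 : (⟨2, by omega⟩ : Fin N) ∈ S.1 := by simp [hS]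
  have hl : ¬ ∃ j ∈ S.1, 2 * n ≤ j.1 := by
    rintro ⟨j, hj, hjn⟩
    simp only [hS, Finset.mem_insert, Finset.mem_singleton] at hj
    rcases hj with rfl | rfl | rfl <;> simp only at hjn <;> omega
  have hbase : 2 ≤ (base n S.1).card :=
    Finset.one_lt_card.2 ⟨⟨0, by omega⟩, mem_base.2 ⟨_, h0, by norm_num⟩, ⟨1, by omega⟩,
      mem_base.2 ⟨_, h2, by norm_num⟩, by simp⟩
  have hs : SameAt (expFam hN x) S ⟨0, by omega⟩ ⟨1, by omega⟩ := by
    rw [sameAt_expFam_iff hN x h0 h1, expVec, if_neg hl, dif_pos hbase]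
    simp only [pull, LinearMap.coe_mk, AddHom.coe_mk]
  rw [← he] at hs
  have := (sameAt_mk (v := fun _ => b) (fun S => ctr_ne_zero_of_injective hb S) h0 h1).1 hs
  simpa using hb this

lemma dense_subtype_of_closure {X : Type*} [TopologicalSpace X] {s : Set X} {t : Set (closure s)}
    (h : ∀ x (hx : x ∈ s), (⟨x, subset_closure hx⟩ : closure s) ∈ t) : Dense t := by
  rw [Subtype.dense_iff]
  exact closure_mono fun x hx => ⟨⟨x, subset_closure hx⟩, h x hx, rfl⟩

lemma dense_compl_range_expBar (hn : 2 ≤ n) : Dense (range (expBar n))ᶜ := by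
  refine dense_subtype_of_closure ?_
  rintro x ⟨a, ha, rfl⟩ ⟨y, hy⟩
  exact conf_ne_expFam hn (Nat.le_succ _) le_rfl ha y.1 (congrArg Subtype.val hy).symm

lemma dense_compl_range_expTil (hn : 2 ≤ n) : Dense (range (expTil n))ᶜ := by
  refine dense_subtype_of_closure ?_
  rintro x ⟨_, ha, hx⟩ ⟨y, hy⟩
  exact conf_ne_expFam hn le_rfl (Nat.le_succ _) ha y.1.2
    (hx.symm.trans (congrArg (fun z : Mtil (2 * n) => z.1.2) hy).symm)

/-! ### Base points -/

/-- The only index set has two elements, and any two distinct points of the line are affinely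
equivalent to any other two. -/
instance : Subsingleton (Fam 2) := by
  refine ⟨fun x y => funext fun S => ?_⟩
  have hS : S.1 = Finset.univ := Finset.eq_univ_of_card _
    (le_antisymm (Finset.card_le_univ _) (by simpa using S.2))
  have h01 : ∀ p : Projectivization ℝ (V S.1), p.rep.1 0 - p.rep.1 1 ≠ 0 := by
    intro p h0
    obtain ⟨i, -, j, -, hij⟩ := exists_rep_ne p
    fin_cases i <;> fin_cases j <;> simp only [Fin.zero_eta, Fin.mk_one, ne_eq] at hij
    · exact hij trivial
    · exact hij (sub_eq_zero.1 h0)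
    · exact hij (sub_eq_zero.1 h0).symm
    · exact hij trivial
  have := h01 (y S)
  refine eq_of_diff (((x S).rep.1 0 - (x S).rep.1 1) / ((y S).rep.1 0 - (y S).rep.1 1))
    fun i _ j _ => ?_
  rw [div_mul_eq_mul_div, eq_div_iff this]
  fin_cases i <;> fin_cases j <;> simp only [Fin.zero_eta, Fin.mk_one] <;> ring

lemma card_Mbar_two : Nat.card (Mbar 2) = 1 := by
  rw [Nat.card_eq_one_iff_unique]
  refine ⟨⟨fun x y => Subtype.ext (Subsingleton.elim _ _)⟩, ?_⟩
  have ha : Function.Injective fun i : Fin 2 => (i.1 : ℝ) := fun i j h => by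
    have h' : (i.1 : ℝ) = j.1 := h
    exact Fin.ext (by exact_mod_cast h')
  exact ⟨⟨_, subset_closure ⟨_, ha, rfl⟩⟩⟩

lemma Mtil_two_cases (x : Mtil 2) :
    x.1.1 = ![√(1 / 2), -√(1 / 2)] ∨ x.1.1 = ![-√(1 / 2), √(1 / 2)] := by
  obtain ⟨h1, h2, -⟩ := Mtil_rel le_rfl x.2
  rw [Fin.sum_univ_two] at h1 h2
  have e1 : x.1.1 1 = -x.1.1 0 := by linarith
  have e2 : x.1.1 0 ^ 2 = √(1 / 2) ^ 2 := by
    rw [Real.sq_sqrt (by norm_num)]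
    rw [e1] at h2
    linarith
  rcases sq_eq_sq_iff_eq_or_eq_neg.1 e2 with e | e
  · left
    funext i
    fin_cases i
    · exact e
    · exact e1.trans (by rw [e]; rfl)
  · right
    funext i
    fin_cases i
    · exact e
    · exact e1.trans (by rw [e, neg_neg]; rfl)

lemma sqrt_half_pos : 0 < √(1 / 2 : ℝ) := Real.sqrt_pos.2 (by norm_num)

lemma exists_Mtil_two {a : Fin 2 → ℝ} {c : ℝ} (hc : c ^ 2 = 1 / 2) (h0 : a = ![c, -c]) :
    ∃ x : Mtil 2, x.1.1 = a := by
  subst h0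
  have hc0 : c ≠ 0 := by rintro rfl; norm_num at hc
  have hinj : Function.Injective ![c, -c] := by
    intro i j hij
    have : c ≠ -c := fun h => hc0 (by linarith)
    fin_cases i <;> fin_cases j <;> first | rfl | exact absurd hij this | exact absurd hij.symm this
  refine ⟨⟨(![c, -c], conf _ hinj), subset_closure ⟨⟨?_, ?_⟩, hinj, rfl⟩⟩, rfl⟩
  · simp
  · simp [hc]; norm_num

lemma Mtil_two_ext {x y : Mtil 2} (h : x.1.1 = y.1.1) : x = y :=
  Subtype.ext (Prod.ext h (Subsingleton.elim _ _))

lemma card_Mtil_two : Nat.card (Mtil 2) = 2 := by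
  have hs : √(1 / 2 : ℝ) ^ 2 = 1 / 2 := Real.sq_sqrt (by norm_num)
  obtain ⟨p, hp⟩ := exists_Mtil_two hs rfl
  obtain ⟨q, hq⟩ := exists_Mtil_two (c := -√(1 / 2)) (by rw [neg_sq, hs]) rfl
  rw [neg_neg] at hq
  rw [Nat.card_eq_two_iff]
  refine ⟨p, q, fun h => ?_, eq_univ_of_forall fun x => ?_⟩
  · have := congrFun (hp.symm.trans ((congrArg (fun x => x.1.1) h).trans hq)) 0
    simp only [Matrix.cons_val_zero] at this
    linarith [sqrt_half_pos]
  · rcases Mtil_two_cases x with h | h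
    · exact Or.inl (Mtil_two_ext (h.trans hp.symm))
    · exact Or.inr (Mtil_two_ext (h.trans hq.symm))

/-- The two points of the cover order the two marked points in opposite ways, so neither is below
the other. -/
lemma eq_of_tilLE_two {x y : Mtil 2} (h : TilLE y x) : y = x := by
  refine Mtil_two_ext ?_
  have hpos := sqrt_half_pos
  have h01 := h.2 0 1
  have h10 := h.2 1 0
  rcases Mtil_two_cases x with hx | hx <;> rcases Mtil_two_cases y with hy | hy <;>
    rw [hx, hy] at h01 h10 ⊢ <;> simp only [Matrix.cons_val_zero, Matrix.cons_val_one] at h01 h10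
  · exact absurd (h10 (by linarith)) (by linarith)
  · exact absurd (h01 (by linarith)) (by linarith)

lemma singleton_mem_strataTowerBar (p : Mbar (levBar 0)) :
    {toTowerBar 0 p} ∈ strataTowerBar := by
  rw [strataTowerBar_eq]
  refine ⟨0, _, ⟨p, rfl⟩, ?_⟩
  have : cls BarLE p = {p} := by
    have : Subsingleton (Mbar (levBar 0)) :=
      ⟨fun x y => Subtype.ext (Subsingleton.elim (α := Fam 2) _ _)⟩
    exact (subsingleton_of_subsingleton).eq_singleton_of_mem ⟨FamLE.refl _, FamLE.refl _⟩
  exact ((congrArg (fun s : Set (systemBar.obj 0) => toTower systemBar 0 '' s) this).trans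
    image_singleton).symm

lemma singleton_mem_strataTowerTil (p : Mtil (levTil 0)) :
    {toTowerTil 0 p} ∈ strataTowerTil := by
  rw [strataTowerTil_eq]
  refine ⟨0, _, ⟨p, rfl⟩, ?_⟩
  have : cls TilLE p = {p} :=
    Subset.antisymm (fun y hy => eq_of_tilLE_two hy.1)
      (singleton_subset_iff.2 ⟨TilLE.refl _, TilLE.refl _⟩)
  exact ((congrArg (fun s : Set (systemTil.obj 0) => toTower systemTil 0 '' s) this).trans
    image_singleton).symm

/-! ### The two towers as CW complexes -/

lemma isCWWithCells_bar :
    IsCWWithCells TowerBar strataTowerBar ∧ NowhereLocallyFinite strataTowerBar := by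
  obtain ⟨dim, h⟩ := exists_isCellTower_bar
  rw [strataTowerBar_eq]
  refine ⟨h.isCWWithCells, h.nowhereLocallyFinite fun k => ?_⟩
  rw [show up systemBar (Nat.le_succ k) = expBar (levBar k) from funext (up_systemBar k)]
  exact dense_compl_range_expBar (two_le_levBar k)

lemma isCWWithCells_til :
    IsCWWithCells TowerTil strataTowerTil ∧ NowhereLocallyFinite strataTowerTil := by
  obtain ⟨dim, h⟩ := exists_isCellTower_til
  rw [strataTowerTil_eq]
  refine ⟨h.isCWWithCells, h.nowhereLocallyFinite fun k => ?_⟩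
  rw [show up systemTil (Nat.le_succ k) = expTil (levTil k) from funext (up_systemTil k)]
  exact dense_compl_range_expTil (two_le_levTil k)

end

end RealModuli

end

theorem proposition3 :
    (∀ n : ℕ, 2 ≤ n → RealModuli.IsStratifiedEmbedding
      (RealModuli.strataBar n) (RealModuli.strataBar (2 * n + 1)) (RealModuli.expBar n)) ∧
    (∀ n : ℕ, 2 ≤ n → RealModuli.IsStratifiedEmbedding
      (RealModuli.strataTil n) (RealModuli.strataTil (2 * n)) (RealModuli.expTil n)) ∧
    (RealModuli.IsCWWithCells RealModuli.TowerBar RealModuli.strataTowerBar ∧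
      RealModuli.NowhereLocallyFinite RealModuli.strataTowerBar) ∧
    (RealModuli.IsCWWithCells RealModuli.TowerTil RealModuli.strataTowerTil ∧
      RealModuli.NowhereLocallyFinite RealModuli.strataTowerTil) ∧
    (Nat.card (RealModuli.Mbar (RealModuli.levBar 0)) = 1 ∧
      ∀ p, {RealModuli.toTowerBar 0 p} ∈ RealModuli.strataTowerBar) ∧
    (Nat.card (RealModuli.Mtil (RealModuli.levTil 0)) = 2 ∧
      ∀ p, {RealModuli.toTowerTil 0 p} ∈ RealModuli.strataTowerTil) :=
  ⟨fun _ hn => RealModuli.isStratifiedEmbedding_expBar hn,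
    fun _ hn => RealModuli.isStratifiedEmbedding_expTil hn,
    RealModuli.isCWWithCells_bar, RealModuli.isCWWithCells_til,
    ⟨RealModuli.card_Mbar_two, RealModuli.singleton_mem_strataTowerBar⟩,
    ⟨RealModuli.card_Mtil_two, RealModuli.singleton_mem_strataTowerTil⟩⟩
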